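/- Let $\Bbbk$ be a field, let $N=|\mathbf{x}|$ be the number of punctures, and let $0<i<N$. **The category $\mathcal C$.** It is the $\Bbbk$-linear category with objects $T_0,\dots,T_N$, with $\operatorname{Hom}(T_j,T_l)=\bigoplus_{\alpha\ge 0}\Bbbk\,a_{lj}s^\alpha$ (in degree $0$), and with composition $$a_{lm}s^\beta\cdot a_{mj}s^\alpha=a_{lj}s^{\beta+\alpha+\delta(j,m,l)},$$ where $\delta(j,m,l)=0$ if $(j-m)(m-l)\ge 0$, and $\delta(j,m,l)=\min(|j-m|,|m-l|)$ otherwise. **The bimodule $\mathfrak B_{i^-}$.** It is the $\mathcal C$-bimodule of strand diagrams with one black strand, in which the red strands $x_i$ and $x_{i+1}$ (those next to $T_i$) cross once. It is generated by elements $x_m\in\mathfrak B_{i^-}(T_m,T_m)$, $m\ne i$ (the red crossing, passed by the black strand at the position $m$), subject to - $s_m x_m=x_m s_m$ for $m\neq i$, where $s_m=a_{mm}s$; - $a_{m'm}x_m=x_{m'}a_{m'm}$ for $m,m'\ne i$ with $|m-m'|=1$ or $\{m,m'\}=\{i-1,i+1\}$; - $a_{i,i-1}x_{i-1}a_{i-1,i}=a_{i,i+1}x_{i+1}a_{i+1,i}$.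 $\mathrm{HH}^n(\mathfrak B_{i^-})$ is the Hochschild cohomology of $\mathcal C$ with coefficients in $\mathfrak B_{i^-}$, i.e. the cohomology of the complex of families of multilinear maps $\operatorname{Hom}(X_{n-1},X_n)\times\dots\times\operatorname{Hom}(X_0,X_1)\to\mathfrak B_{i^-}(X_0,X_n)$ with the Hochschild differential. **The negative braiding functor.** $\beta_{i^-}\colon\mathcal C\to\mathrm{Tw}^b(\mathcal C)$ is the $A_\infty$-functor to the bounded twisted complexes over $\mathcal C$ given as follows. On objects, $\beta_{i^-}T_j=T_j$ for $j\neq i$, and $$\beta_{i^-}T_i=\bigl(T_i\xrightarrow{(a_{i-1,i},\,-a_{i+1,i})}T_{i-1}\oplus T_{i+1}\bigr)$$ in degrees $-1$ and $0$. For $j,l\ne i$, $$\beta^1_{i^-}(a_{lj}s^\alpha)=a_{lj}s^\alpha,\qquad \beta^1_{i^-}(s_i^\alpha)=s^\alpha\ \text{on each summand};$$ $\beta^1_{i^-}(a_{ij}s^\alpha)$ is $a_{i-1,j}s^\alpha$ into $T_{i-1}$ if $j<i$ and $a_{i+1,j}s^\alpha$ into $T_{i+1}$ if $j>i$; and $\beta^1_{i^-}(a_{li}s^\alpha)$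 is $(a_{l,i-1}s^\alpha,a_{l,i+1}s^{\alpha+1})$ on $T_{i-1}\oplus T_{i+1}$ if $l>i$ and $(a_{l,i-1}s^{\alpha+1},a_{l,i+1}s^{\alpha})$ if $l<i$. Next, for $l\ne i$, $$\beta^2_{i^-}(a_{il}s^\beta,a_{lj}s^\alpha)=\operatorname{sgn}(i-l)\,a_{ij}s^{\beta+\alpha+|i-l|-1}\quad\text{if } j\ne i,\ (i-j)(i-l)<0,$$ $$\beta^2_{i^-}(a_{il}s^\beta,a_{li}s^\alpha)=\operatorname{sgn}(i-l)\,a_{i,i+\operatorname{sgn}(i-l)}s^{\beta+\alpha+|i-l|-1},$$ both with values in the summand $T_i$ of degree $-1$. All other values of $\beta^2_{i^-}$, and all $\beta^d_{i^-}$ with $d\ge3$, vanish. $H^n\mathrm{Hom}(\mathrm{id},\beta_{i^-})$ is the cohomology of the complex of $A_\infty$-pre-natural transformations from the identity (the inclusion $\mathcal C\to\mathrm{Tw}^b(\mathcal C)$) to $\beta_{i^-}$. **Theorem.** For all $n\ge 0$, as $\Bbbk$-vector spaces, $$H^n\mathrm{Hom}(\mathrm{id},\beta_{i^-})\cong\mathrm{HH}^n(\mathfrak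 B_{i^-})\cong\begin{cases}\Bbbk^{\mathbb Z_{\ge1}},&n=0,\\ \Bbbk^{\mathbb Z_{\ge0}},&n=1,\\ \Bbbk^{N-2},&n=2,\\ 0,&n\ge3,\end{cases}$$ where $\Bbbk^{\mathbb Z_{\ge r}}$ denotes the direct sum $\bigoplus_{\ell\ge r}\Bbbk$. -/

import Mathlib

/-!
Notation: `N` is the number of punctures (red strands), the generators are `T_0, …, T_N`, indexed
by `Fin (N + 1)`; the strands `x_m` and `x_{m+1}` are the neighbours of `T_m`.  All modules are
over a field `k`.
-/

set_option maxSynthPendingDepth 3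

namespace KLRW

open Finsupp

noncomputable section

/-! ### The category `C` -/

/-- The morphism space `Hom(T_i, T_j)`: it has the basis `a_{ji} s^α`, `α ≥ 0`, so for all `i, j`
it is the free module on `ℕ`, with `a_{ji} s^α` represented by `single α 1`. -/
abbrev H (k : Type*) [Field k] : Type _ := ℕ →₀ k

/-- The number `δ(i, j, k)` of dots created when `T_i → T_j` is composed with `T_j → T_k`. -/
def delta {N : ℕ} (i j k : Fin (N + 1)) : ℕ :=
  if 0 ≤ ((i : ℤ) - (j : ℤ)) * ((j : ℤ) - (k : ℤ)) then 0
  else min ((i : ℤ) - (j : ℤ)).natAbs ((j : ℤ) - (k : ℤ)).natAbs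

/-- The bilinear map with `(s^β, s^α) ↦ s^(β + α + c)`. -/
def conv (k : Type*) [Field k] (c : ℕ) : H k →ₗ[k] H k →ₗ[k] H k :=
  Finsupp.linearCombination k fun β : ℕ => Finsupp.lmapDomain k k fun α : ℕ => β + α + c

/-- The composition `Hom(T_j, T_l) × Hom(T_i, T_j) → Hom(T_i, T_l)`,
`a_{lj} s^β · a_{ji} s^α = a_{li} s^(β + α + δ(i, j, l))`. -/
def comp (k : Type*) [Field k] {N : ℕ} (i j l : Fin (N + 1)) : H k →ₗ[k] H k →ₗ[k] H k :=
  conv k (delta i j l)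

/-! ### The bimodule of the negative braiding

A diagram with one crossing of the red strands `x_i` and `x_{i+1}` is a diagram
`a_{mid,src} s^lower` of `C`, then the crossing, which the black strand passes at the position
`mid ≠ i`, then a diagram `a_{tgt,mid} s^upper` of `C` (read from the bottom to the top). -/

/-- Diagrams with one crossing of `x_i` and `x_{i+1}`. -/
@[ext]
structure Diag (N : ℕ) (i : Fin (N + 1)) where
  src : Fin (N + 1)
  mid : Fin (N + 1)
  tgt : Fin (N + 1)
  mid_ne : mid ≠ i
  lower : ℕ
  upper : ℕ

/-- Stack `a_{l,tgt} s^γ` on the top of a diagram. -/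
def Diag.top {N : ℕ} {i : Fin (N + 1)} (l : Fin (N + 1)) (γ : ℕ) (D : Diag N i) : Diag N i where
  src := D.src
  mid := D.mid
  tgt := l
  mid_ne := D.mid_ne
  lower := D.lower
  upper := γ + D.upper + delta D.mid D.tgt l

/-- Stack a diagram on the top of `a_{src,j} s^γ`. -/
def Diag.bot {N : ℕ} {i : Fin (N + 1)} (j : Fin (N + 1)) (γ : ℕ) (D : Diag N i) : Diag N i where
  src := j
  mid := D.mid
  tgt := D.tgt
  mid_ne := D.mid_ne
  lower := D.lower + γ + delta j D.src D.mid
  upper := D.upper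

/-- The relations between diagrams with one red crossing. -/
inductive Rel (N : ℕ) (i : Fin (N + 1)) : Diag N i → Diag N i → Prop
  /-- Isotopy: a dot moves through the level of the red crossing. -/
  | dot (m : Fin (N + 1)) (hm : m ≠ i) :
      Rel N i ⟨m, m, m, hm, 0, 1⟩ ⟨m, m, m, hm, 1, 0⟩
  /-- Isotopy: the crossing of the black strand with a red strand other than `x_i`, `x_{i+1}` moves
  through the level of the red crossing. -/
  | slide (m m' : Fin (N + 1)) (hm : m ≠ i) (hm' : m' ≠ i)
      (h : (m : ℕ) + 1 = m' ∨ (m' : ℕ) + 1 = m) :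
      Rel N i ⟨m, m, m', hm, 0, 0⟩ ⟨m, m', m', hm', 0, 0⟩
  /-- A black strand that crosses both `x_i` and `x_{i+1}` may do so after or before the red
  crossing. -/
  | pass (m m' : Fin (N + 1)) (hm : m ≠ i) (hm' : m' ≠ i)
      (h : ((m : ℕ) + 1 = i ∧ (i : ℕ) + 1 = m') ∨ ((m' : ℕ) + 1 = i ∧ (i : ℕ) + 1 = m)) :
      Rel N i ⟨m, m, m', hm, 0, 0⟩ ⟨m, m', m', hm', 0, 0⟩
  /-- A black strand from `T_i` to `T_i` may pass the red crossing on the left or on the right. -/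
  | turn (m m' : Fin (N + 1)) (hm : m ≠ i) (hm' : m' ≠ i)
      (h : (m : ℕ) + 1 = i) (h' : (i : ℕ) + 1 = m') :
      Rel N i ⟨i, m, i, hm, 0, 0⟩ ⟨i, m', i, hm', 0, 0⟩
  /-- The relations are compatible with stacking on the top. -/
  | top (l : Fin (N + 1)) (γ : ℕ) (D D' : Diag N i) (h : Rel N i D D') :
      Rel N i (D.top l γ) (D'.top l γ)
  /-- The relations are compatible with stacking on the bottom. -/
  | bot (j : Fin (N + 1)) (γ : ℕ) (D D' : Diag N i) (h : Rel N i D D') :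
      Rel N i (D.bot j γ) (D'.bot j γ)

/-- The bimodule `𝔅_{i^-}`, i.e. the direct sum of all the spaces `𝔅_{i^-}(T_j, T_l)`: the free
module on the diagrams with one crossing of `x_i` and `x_{i+1}` up to the relations (`Quot` divides
by the equivalence relation that `Rel` generates). -/
abbrev Bim (k : Type*) [Field k] (N : ℕ) (i : Fin (N + 1)) : Type _ := Quot (Rel N i) →₀ k

/-- The component `𝔅_{i^-}(T_j, T_l)`, spanned by the diagrams from `T_j` to `T_l`. -/
def Bim.part (k : Type*) [Field k] (N : ℕ) (i j l : Fin (N + 1)) : Submodule k (Bim k N i) :=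
  Submodule.span k
    {x | ∃ D : Diag N i, D.src = j ∧ D.tgt = l ∧ x = Finsupp.single (Quot.mk (Rel N i) D) 1}

/-- The left action `Hom(T_m, T_l) × 𝔅(T_j, T_m) → 𝔅(T_j, T_l)`: stacking on the top.  (It is
only ever applied to elements of `𝔅(T_j, T_m)` with the right `m`.) -/
def Bim.lact (k : Type*) [Field k] (N : ℕ) (i l : Fin (N + 1)) :
    H k →ₗ[k] Bim k N i →ₗ[k] Bim k N i :=
  Finsupp.linearCombination k fun γ : ℕ => Finsupp.lmapDomain k k
    (Quot.map (Diag.top l γ) fun D D' h => Rel.top l γ D D' h)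

/-- The right action `𝔅(T_m, T_l) × Hom(T_j, T_m) → 𝔅(T_j, T_l)`: stacking at the bottom; the
element of `Hom(T_j, T_m)` is the first argument. -/
def Bim.ract (k : Type*) [Field k] (N : ℕ) (i j : Fin (N + 1)) :
    H k →ₗ[k] Bim k N i →ₗ[k] Bim k N i :=
  Finsupp.linearCombination k fun γ : ℕ => Finsupp.lmapDomain k k
    (Quot.map (Diag.bot j γ) fun D D' h => Rel.bot j γ D D' h)

/-! ### Chains of morphisms

A chain `X_0 → X_1 → ⋯ → X_d` is given by `X : Fin (d + 1) → Fin (N + 1)` and `a : Fin d → H k`,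
where `a t` is the morphism `X_t → X_{t+1}` (called `a_{t+1}` in the formulas below). -/

/-- Omit the object `X_{t+1}`. -/
def mergeObj {N d : ℕ} (t : Fin d) (X : Fin (d + 2) → Fin (N + 1)) : Fin (d + 1) → Fin (N + 1) :=
  fun s => X (t.succ.castSucc.succAbove s)

/-- Replace the two morphisms `X_t → X_{t+1} → X_{t+2}` by their composite. -/
def mergeHom {k : Type*} [Field k] {N d : ℕ} (t : Fin d) (X : Fin (d + 2) → Fin (N + 1))
    (a : Fin (d + 1) → H k) : Fin d → H k :=
  Fin.contractNth t.castSucc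
    (fun f g => comp k (X t.castSucc.castSucc) (X t.succ.castSucc) (X t.succ.succ) g f) a

/-! ### Hochschild cohomology with coefficients in `𝔅_{i^-}` -/

/-- Functions on the chains of length `d`, with values in `𝔅_{i^-}`. -/
abbrev HFun (k : Type*) [Field k] (N : ℕ) (i : Fin (N + 1)) (d : ℕ) : Type _ :=
  (Fin (d + 1) → Fin (N + 1)) → (Fin d → H k) → Bim k N i

/-- Hochschild cochains: for each `X_0, …, X_d` a multilinear map
`Hom(X_{d-1}, X_d) × ⋯ × Hom(X_0, X_1) → 𝔅_{i^-}(X_0, X_d)`. -/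
def HCochain (k : Type*) [Field k] (N : ℕ) (i : Fin (N + 1)) (d : ℕ) :
    Submodule k (HFun k N i d) where
  carrier := {φ | ∀ X : Fin (d + 1) → Fin (N + 1),
    (∃ m : MultilinearMap k (fun _ : Fin d => H k) (Bim k N i), ∀ a, φ X a = m a) ∧
    ∀ a, φ X a ∈ Bim.part k N i (X 0) (X (Fin.last d))}
  add_mem' := by
    intro φ ψ hφ hψ X
    obtain ⟨⟨m, hm⟩, h⟩ := hφ X
    obtain ⟨⟨m', hm'⟩, h'⟩ := hψ X
    exact ⟨⟨m + m', fun a => by simp [hm, hm']⟩, fun a => add_mem (h a) (h' a)⟩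
  zero_mem' := fun X => ⟨⟨0, fun a => rfl⟩, fun a => zero_mem _⟩
  smul_mem' := by
    intro c φ hφ X
    obtain ⟨⟨m, hm⟩, h⟩ := hφ X
    exact ⟨⟨c • m, fun a => by simp [hm]⟩, fun a => Submodule.smul_mem _ _ (h a)⟩

/-- The Hochschild differential
`(dφ)(a_{n+1}, …, a_1) = φ(a_{n+1}, …, a_2) a_1
  + ∑_{1 ≤ r ≤ n} (-1)^r φ(a_{n+1}, …, a_{r+1} a_r, …, a_1) + (-1)^(n+1) a_{n+1} φ(a_n, …, a_1)`. -/
def hDiff (k : Type*) [Field k] (N : ℕ) (i : Fin (N + 1)) (n : ℕ) :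
    HFun k N i n →ₗ[k] HFun k N i (n + 1) where
  toFun φ := fun X a =>
    Bim.ract k N i (X 0) (a 0) (φ (Fin.tail X) (Fin.tail a))
    + ∑ t : Fin n, (-1 : k) ^ ((t : ℕ) + 1) • φ (mergeObj t X) (mergeHom t X a)
    + (-1 : k) ^ (n + 1) •
        Bim.lact k N i (X (Fin.last (n + 1))) (a (Fin.last n)) (φ (Fin.init X) (Fin.init a))
  map_add' φ ψ := by
    funext X a
    simp only [Pi.add_apply, map_add, smul_add, Finset.sum_add_distrib]
    abel
  map_smul' c φ := by
    funext X a
    simp only [Pi.smul_apply, map_smul, smul_add, Finset.smul_sum, RingHom.id_apply,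
      smul_comm c]

/-- Hochschild cocycles. -/
def HCocycle (k : Type*) [Field k] (N : ℕ) (i : Fin (N + 1)) (n : ℕ) :
    Submodule k (HFun k N i n) :=
  HCochain k N i n ⊓ LinearMap.ker (hDiff k N i n)

/-- Hochschild coboundaries. -/
def HCobound (k : Type*) [Field k] (N : ℕ) (i : Fin (N + 1)) :
    (n : ℕ) → Submodule k (HFun k N i n)
  | 0 => ⊥
  | n + 1 => (HCochain k N i n).map (hDiff k N i n)

/-- The Hochschild cohomology `HH^n(𝔅_{i^-})`: cocycles modulo coboundaries. -/
abbrev HH (k : Type*) [Field k] (N : ℕ) (i : Fin (N + 1)) (n : ℕ) : Type _ :=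
  HCocycle k N i n ⧸ (HCobound k N i n).comap (HCocycle k N i n).subtype

/-! ### Twisted complexes

Only twisted complexes in which each `T_m` occurs at most once are needed. -/

/-- A (pre-)morphism of twisted complexes: `f m' m` is its entry in `Hom(T_m, T_{m'})`. -/
abbrev Mat (k : Type*) [Field k] (N : ℕ) : Type _ := Fin (N + 1) → Fin (N + 1) → H k

/-- Composition of matrices of morphisms, without signs. -/
def Mat.mul {k : Type*} [Field k] {N : ℕ} (g f : Mat k N) : Mat k N :=
  fun m'' m => ∑ m', comp k m m' m'' (g m'' m') (f m' m)

/-- A twisted complex: `T_m` occurs in the degree `r` if `deg m = some r` and does not occur if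
`deg m = none`; `diff` is the bounding cochain `δ`. -/
structure Tw (k : Type*) [Field k] (N : ℕ) where
  deg : Fin (N + 1) → Option ℤ
  diff : Mat k N

/-- The morphisms `P → Q` of degree `r`. -/
def Tw.hom {k : Type*} [Field k] {N : ℕ} (P Q : Tw k N) (r : ℤ) : Submodule k (Mat k N) where
  carrier := {f | ∀ m' m, f m' m ≠ 0 →
    ∃ p q : ℤ, P.deg m = some p ∧ Q.deg m' = some q ∧ q - p = r}
  add_mem' := by
    intro f g hf hg m' m h
    by_cases h1 : f m' m = 0
    · exact hg m' m fun h2 => h (by simp [h1, h2])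
    · exact hf m' m h1
  zero_mem' := fun m' m h => absurd rfl h
  smul_mem' := by
    intro c f hf m' m h
    exact hf m' m fun h1 => h (by simp [h1])

/-- The sign `(-1)^r`. -/
def sgn (k : Type*) [Field k] (r : ℤ) : k := ((r.negOnePow : ℤˣ) : ℤ)

/-- `μ^1(f) = (-1)^r δ f - f δ` for `f : P → Q` of degree `r`. -/
def Tw.mu1 {k : Type*} [Field k] {N : ℕ} (P Q : Tw k N) (r : ℤ) (f : Mat k N) : Mat k N :=
  sgn k r • Mat.mul Q.diff f - Mat.mul f P.diff

/-- `μ^2(g, f) = (-1)^r g f` for `f` of degree `r`. -/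
def Tw.mu2 {k : Type*} [Field k] {N : ℕ} (r : ℤ) (g f : Mat k N) : Mat k N :=
  sgn k r • Mat.mul g f

/-- The object `T_j`, in degree `0`. -/
def gen (k : Type*) [Field k] {N : ℕ} (j : Fin (N + 1)) : Tw k N where
  deg m := if m = j then some 0 else none
  diff := 0

/-- The inclusion of `C` on morphisms: `f : T_j → T_l` as a matrix. -/
def incl (k : Type*) [Field k] {N : ℕ} (j l : Fin (N + 1)) (f : H k) : Mat k N :=
  fun m' m => if m' = l ∧ m = j then f else 0

/-! ### The negative braiding functor `β_{i^-}` on `C` -/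

/-- `β_{i^-} T_j = T_j` for `j ≠ i`, and `β_{i^-} T_i` is the complex
`T_i → T_{i-1} ⊕ T_{i+1}` in the degrees `-1` and `0`, with the differential
`(a_{i-1,i}, -a_{i+1,i})`. -/
def braidObj (k : Type*) [Field k] {N : ℕ} (i j : Fin (N + 1)) : Tw k N :=
  if j = i then
    { deg := fun m =>
        if m = i then some (-1)
        else if (m : ℕ) + 1 = i ∨ (i : ℕ) + 1 = m then some 0 else none
      diff := fun m' m =>
        if m = i ∧ (m' : ℕ) + 1 = i then Finsupp.single 0 1
        else if m = i ∧ (i : ℕ) + 1 = m' then -Finsupp.single 0 1 else 0 }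
  else gen k j

/-- `β_{i^-}^1` on `Hom(T_j, T_l)`.  In the third case `a_{li} s^α` goes to
`(a_{l,i-1} s^α, a_{l,i+1} s^(α+1))` if `l > i`, and to `(a_{l,i-1} s^(α+1), a_{l,i+1} s^α)` if
`l < i`. -/
def braid1 {k : Type*} [Field k] {N : ℕ} (i j l : Fin (N + 1)) (f : H k) : Mat k N :=
  fun m' m =>
    if j ≠ i ∧ l ≠ i then
      if m' = l ∧ m = j then f else 0
    else if j ≠ i ∧ l = i then
      if m = j ∧ ((j < i ∧ (m' : ℕ) + 1 = i) ∨ (i < j ∧ (i : ℕ) + 1 = m')) then f else 0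
    else if j = i ∧ l ≠ i then
      if m' = l ∧ (m : ℕ) + 1 = i then
        (if i < l then f else Finsupp.mapDomain (fun α => α + 1) f)
      else if m' = l ∧ (i : ℕ) + 1 = m then
        (if i < l then Finsupp.mapDomain (fun α => α + 1) f else f)
      else 0
    else
      if m' = m ∧ (m = i ∨ (m : ℕ) + 1 = i ∨ (i : ℕ) + 1 = m) then f else 0

/-- `β_{i^-}^2` on `Hom(T_l, T_q) × Hom(T_j, T_l)`; it vanishes unless `q = i`.
If `j ≠ i` and `(i - j)(i - l) < 0`, then `(a_{il} s^β, a_{lj} s^α)` goes to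
`sgn(i - l) a_{ij} s^(β + α + |i - l| - 1)`, a morphism to the degree `-1` part `T_i`;
if `j = i ≠ l`, it goes to `sgn(i - l) a_{i,i+sgn(i-l)} s^(β + α + |i - l| - 1)`;
otherwise to `0`. -/
def braid2 {k : Type*} [Field k] {N : ℕ} (i j l q : Fin (N + 1)) (g f : H k) : Mat k N :=
  fun m' m =>
    if q = i ∧ l ≠ i ∧ m' = i ∧
        ((j ≠ i ∧ ((i : ℤ) - (j : ℤ)) * ((i : ℤ) - (l : ℤ)) < 0 ∧ m = j) ∨
         (j = i ∧ (m : ℤ) = (i : ℤ) + ((i : ℤ) - (l : ℤ)).sign)) then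
      (((i : ℤ) - (l : ℤ)).sign : k) • conv k (((i : ℤ) - (l : ℤ)).natAbs - 1) g f
    else 0

/-! ### Natural transformations from the identity to `β_{i^-}`

The complex of pre-natural transformations from the inclusion `C → Tw C` to
`β_{i^-} : C → Tw C`. -/

/-- Functions on the chains of all lengths, with values in matrices of morphisms. -/
abbrev NFun (k : Type*) [Field k] (N : ℕ) : Type _ :=
  (d : ℕ) → (Fin (d + 1) → Fin (N + 1)) → (Fin d → H k) → Mat k N

/-- Pre-natural transformations of degree `g`: sequences `η^d`, `d ≥ 0`, of multilinear maps
`Hom(X_{d-1}, X_d) × ⋯ × Hom(X_0, X_1) → Hom^{g-d}(X_0, β_{i^-} X_d)`. -/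
def NCochain (k : Type*) [Field k] (N : ℕ) (i : Fin (N + 1)) (g : ℤ) :
    Submodule k (NFun k N) where
  carrier := {η | ∀ (d : ℕ) (X : Fin (d + 1) → Fin (N + 1)),
    (∃ m : MultilinearMap k (fun _ : Fin d => H k) (Mat k N), ∀ a, η d X a = m a) ∧
    ∀ a, η d X a ∈ Tw.hom (gen k (X 0)) (braidObj k i (X (Fin.last d))) (g - d)}
  add_mem' := by
    intro φ ψ hφ hψ d X
    obtain ⟨⟨m, hm⟩, h⟩ := hφ d X
    obtain ⟨⟨m', hm'⟩, h'⟩ := hψ d X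
    exact ⟨⟨m + m', fun a => by simp [hm, hm']⟩, fun a => add_mem (h a) (h' a)⟩
  zero_mem' := fun d X => ⟨⟨0, fun a => rfl⟩, fun a => zero_mem _⟩
  smul_mem' := by
    intro c φ hφ d X
    obtain ⟨⟨m, hm⟩, h⟩ := hφ d X
    exact ⟨⟨c • m, fun a => by simp [hm]⟩, fun a => Submodule.smul_mem _ _ (h a)⟩

/-- The term `μ^2(β^1(a_d), η^{d-1}(a_{d-1}, …, a_1))`. -/
def postTerm {k : Type*} [Field k] {N : ℕ} (i : Fin (N + 1)) (g : ℤ) (η : NFun k N) : NFun k N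
  | 0 => fun _ _ => 0
  | d + 1 => fun X a =>
      Tw.mu2 (g - d)
        (braid1 i (X (Fin.last d).castSucc) (X (Fin.last (d + 1))) (a (Fin.last d)))
        (η d (Fin.init X) (Fin.init a))

/-- The term `μ^2(β^2(a_d, a_{d-1}), η^{d-2}(a_{d-2}, …, a_1))`. -/
def postTerm2 {k : Type*} [Field k] {N : ℕ} (i : Fin (N + 1)) (g : ℤ) (η : NFun k N) : NFun k N
  | 0 => fun _ _ => 0
  | 1 => fun _ _ => 0
  | d + 2 => fun X a =>
      Tw.mu2 (g - d)
        (braid2 i (X (Fin.last d).castSucc.castSucc) (X (Fin.last (d + 1)).castSucc)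
          (X (Fin.last (d + 2))) (a (Fin.last (d + 1))) (a (Fin.last d).castSucc))
        (η d (Fin.init (Fin.init X)) (Fin.init (Fin.init a)))

/-- The term `(-1)^(g-1) μ^2(η^{d-1}(a_d, …, a_2), a_1)`. -/
def preTerm {k : Type*} [Field k] {N : ℕ} (g : ℤ) (η : NFun k N) : NFun k N
  | 0 => fun _ _ => 0
  | d + 1 => fun X a =>
      sgn k (g - 1) • Tw.mu2 0 (η d (Fin.tail X) (Fin.tail a)) (incl k (X 0) (X 1) (a 0))

/-- The sum `∑_r (-1)^(-r+g-1) η^{d-1}(a_d, …, a_{r+2} a_{r+1}, …, a_1)`. -/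
def innerTerm {k : Type*} [Field k] {N : ℕ} (g : ℤ) (η : NFun k N) : NFun k N
  | 0 => fun _ _ => 0
  | d + 1 => fun X a =>
      ∑ t : Fin d, sgn k (-(t : ℤ) + g - 1) • η d (mergeObj t X) (mergeHom t X a)

theorem Mat.mul_add {k : Type*} [Field k] {N : ℕ} (g f f' : Mat k N) :
    Mat.mul g (f + f') = Mat.mul g f + Mat.mul g f' := by
  funext m'' m
  simp [Mat.mul, Finset.sum_add_distrib]

theorem Mat.add_mul {k : Type*} [Field k] {N : ℕ} (g g' f : Mat k N) :
    Mat.mul (g + g') f = Mat.mul g f + Mat.mul g' f := by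
  funext m'' m
  simp [Mat.mul, Finset.sum_add_distrib]

theorem Mat.mul_smul {k : Type*} [Field k] {N : ℕ} (c : k) (g f : Mat k N) :
    Mat.mul g (c • f) = c • Mat.mul g f := by
  funext m'' m
  simp [Mat.mul, Finset.smul_sum]

theorem Mat.smul_mul {k : Type*} [Field k] {N : ℕ} (c : k) (g f : Mat k N) :
    Mat.mul (c • g) f = c • Mat.mul g f := by
  funext m'' m
  simp [Mat.mul, Finset.smul_sum]

/-- The differential `μ^1` on pre-natural transformations of degree `g` from the identity to
`β_{i^-}`; as the `a_t` have degree `0`, `β^d = 0` for `d ≥ 3`, and `μ^d = 0` for `d ≠ 2` in `C`,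
the terms below are all that there are. -/
def nDiff (k : Type*) [Field k] (N : ℕ) (i : Fin (N + 1)) (g : ℤ) : NFun k N →ₗ[k] NFun k N where
  toFun η := fun d X a =>
    Tw.mu1 (gen k (X 0)) (braidObj k i (X (Fin.last d))) (g - d) (η d X a)
    + postTerm i g η d X a + postTerm2 i g η d X a + preTerm g η d X a - innerTerm g η d X a
  map_add' η η' := by
    funext d X a
    rcases d with _ | _ | d <;>
    simp only [Tw.mu1, Tw.mu2, postTerm, postTerm2, preTerm, innerTerm, Pi.add_apply, Mat.mul_add,
      Mat.add_mul, smul_add, Finset.sum_add_distrib] <;> abel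
  map_smul' c η := by
    funext d X a
    rcases d with _ | _ | d <;>
    simp only [Tw.mu1, Tw.mu2, postTerm, postTerm2, preTerm, innerTerm, Pi.smul_apply, Mat.mul_smul,
      Mat.smul_mul, smul_add, smul_sub, Finset.smul_sum, RingHom.id_apply, smul_comm c, smul_zero]

/-- `A_∞`-natural transformations of degree `g` from the identity to `β_{i^-}`. -/
def NCocycle (k : Type*) [Field k] (N : ℕ) (i : Fin (N + 1)) (g : ℤ) : Submodule k (NFun k N) :=
  NCochain k N i g ⊓ LinearMap.ker (nDiff k N i g)

/-- Coboundaries of degree `g`. -/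
def NCobound (k : Type*) [Field k] (N : ℕ) (i : Fin (N + 1)) (g : ℤ) : Submodule k (NFun k N) :=
  (NCochain k N i (g - 1)).map (nDiff k N i (g - 1))

/-- The cohomology `H^g Hom(id, β_{i^-})`. -/
abbrev HNat (k : Type*) [Field k] (N : ℕ) (i : Fin (N + 1)) (g : ℤ) : Type _ :=
  NCocycle k N i g ⧸ (NCobound k N i g).comap (NCocycle k N i g).subtype

end

end KLRW

/-! The category `C` is the linearised quotient of a poset. Order the lattice points `(a, b)` of the
strip `0 ≤ a - b ≤ N` componentwise. The point `(a, b)` lies over `T_{a-b}`, and a relation `p ≤ q`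
lies over the monomial with `min (q.1 - p.1) (q.2 - p.2)` dots. Each monomial comes from exactly one
relation up to the translation `tau` by `(1, 1)`, and composition in `C` is transitivity (`wt_add`).

A diagram of the bimodule is determined by its ends and its number of dots (`Diag.mk_eq_iff`). So
forgetting the red crossing embeds the bimodule into `C`; the image is everything, except that from
`T_i` to `T_i` at least one dot is required. A Hochschild cochain thus becomes a `tau`-invariant
function on the nerve of the strip. If the exponent of a value is measured relative to the composite
of the arguments, both actions disappear and the Hochschild differential is the simplicial
coboundary (`eval_hDiff`). The relative exponents `r` allowed on a simplex from `p` to `q` form a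
set that grows with the interval (`Filt.mono`), so constructions that stay inside intervals respect
it.

The part of the strip between `p` and `q` is tiled by unit squares and contractible, and an acyclic
carrier argument (`bdry_homotopy`, `exists_cellular`) replaces simplices by lattice points, steps
and squares. Modulo `tau` the strip is an annulus, and the cellular complex splits according to `r`.
For `r ≥ 1` all cells contribute, which gives the cohomology of a circle, `k` in degrees 0 and 1.
For `r = 0` the point of position `i` is missing; the annulus relative to a point has `k` in degree
1 only. For `r = -1` only the squares at the `N - 2` inner positions other than `i` remain, in
degree 2. For `r < -1` nothing remains. The sum is the stated answer (`HH.zero`, `HH.one`, `HH.two`,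
`HH.subsingleton`).

The comparison with natural transformations rests on the exact sequence `0 → Hom(T_j, T_i) →
Hom(T_j, T_{i-1}) ⊕ Hom(T_j, T_{i+1}) → 𝔅(T_j, T_i) → 0`, split by `lower` and `sect`. The
projection `proj` is compatible with the right action and with `β^1` (`proj_mul_incl`,
`proj_braid1_mul`), while `β^1` is multiplicative up to the differential of `β^2`
(`braid1_mul_braid1_mul`). A transformation of degree `n` has only two components. The one with
values in degree 0 projects to a Hochschild cochain; in a cocycle it determines the other one,
because composition with the differential is injective, and the second cocycle equation follows from
the first (`mem_NCocycle_iff`). This yields `HNat.equiv`. -/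

set_option maxSynthPendingDepth 3

namespace KLRW
open Finsupp
noncomputable section

/-! ### The exponents `δ` and the composition -/

section Exponents

variable {N : ℕ}

/-- `delta` is half the defect of the triangle inequality for three positions on a line. In this
form identities between dot numbers are linear in absolute values, within reach of `omega`; nearly
all exponent computations below use it. -/
theorem two_mul_delta (i j l : Fin (N + 1)) :
    2 * delta i j l + ((i : ℤ) - l).natAbs = ((i : ℤ) - j).natAbs + ((j : ℤ) - l).natAbs := by
  unfold delta
  rcases le_total (i : ℤ) j with h1 | h1 <;> rcases le_total (j : ℤ) l with h2 | h2
  · rw [if_pos (mul_nonneg_of_nonpos_of_nonpos (by omega) (by omega))]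
    omega
  · split_ifs with h
    · have : (i : ℤ) - j = 0 ∨ (j : ℤ) - l = 0 := by
        rw [← mul_eq_zero]
        exact le_antisymm (mul_nonpos_of_nonpos_of_nonneg (by omega) (by omega)) h
      omega
    · omega
  · split_ifs with h
    · have : (i : ℤ) - j = 0 ∨ (j : ℤ) - l = 0 := by
        rw [← mul_eq_zero]
        exact le_antisymm (mul_nonpos_of_nonneg_of_nonpos (by omega) (by omega)) h
      omega
    · omega
  · rw [if_pos (mul_nonneg (by omega) (by omega))]
    omega

/-- Both sides are half the excess of the walk `i, j, l, m` over the distance from `i` to `m`. -/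
theorem delta_assoc (i j l m : Fin (N + 1)) :
    delta i j l + delta i l m = delta j l m + delta i j m := by
  have h1 := two_mul_delta i j l
  have h2 := two_mul_delta i l m
  have h3 := two_mul_delta j l m
  have h4 := two_mul_delta i j m
  omega

@[simp] theorem delta_self_left (i l : Fin (N + 1)) : delta i i l = 0 := by
  have := two_mul_delta i i l
  omega

@[simp] theorem delta_self_right (i l : Fin (N + 1)) : delta i l l = 0 := by
  have := two_mul_delta i l l
  omega

variable (k : Type*) [Field k]

theorem conv_single_single (c β α : ℕ) (x y : k) :
    conv k c (single β x) (single α y) = single (β + α + c) (x * y) := by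
  simp [conv, Finsupp.mapDomain_single]

theorem conv_single_left (c β : ℕ) (f : H k) :
    conv k c (single β 1) f = mapDomain (fun α => β + α + c) f := by
  simp [conv]

/-- Two bilinear maps on `H` agree if they agree on monomials. -/
theorem H.ext₂ {k : Type*} [Field k] {W : Type*} [AddCommMonoid W] [Module k W]
    {B B' : H k →ₗ[k] H k →ₗ[k] W}
    (h : ∀ β α, B (single β 1) (single α 1) = B' (single β 1) (single α 1)) : B = B' := by
  ext β α
  exact h β α

theorem conv_comm (c : ℕ) (g f : H k) : conv k c g f = conv k c f g := by
  have : conv k c = (conv k c).flip := H.ext₂ fun β α => by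
    simp [conv_single_single, Nat.add_comm β α]
  exact DFunLike.congr_fun (DFunLike.congr_fun this g) f

theorem conv_conv (c c' e e' : ℕ) (h : c + c' = e + e') (x y z : H k) :
    conv k c' x (conv k c y z) = conv k e' (conv k e x y) z := by
  induction x using Finsupp.induction_linear with
  | zero => simp
  | add a b ha hb => simp only [map_add, LinearMap.add_apply, ha, hb]
  | single α r =>
    induction y using Finsupp.induction_linear with
    | zero => simp
    | add a b ha hb => simp only [map_add, LinearMap.add_apply, ha, hb]
    | single β r' =>
      induction z using Finsupp.induction_linear with
      | zero => simp
      | add a b ha hb => simp only [map_add, ha, hb]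
      | single γ r'' =>
        simp only [conv_single_single, mul_assoc]
        congr 1
        omega

theorem comp_assoc (i j l m : Fin (N + 1)) (x y z : H k) :
    comp k i l m x (comp k i j l y z) = comp k i j m (comp k j l m x y) z :=
  conv_conv k _ _ _ _ (delta_assoc i j l m) x y z

end Exponents

/-! ### Diagrams with one red crossing up to the relations -/

section Diagrams

variable {N : ℕ} {i : Fin (N + 1)}

/-- The total number of dots of a diagram, when the red crossing is forgotten. -/
def Diag.dots (D : Diag N i) : ℕ := D.lower + D.upper + delta D.src D.mid D.tgt

theorem Diag.dots_top (l : Fin (N + 1)) (γ : ℕ) (D : Diag N i) :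
    (D.top l γ).dots = D.dots + γ + delta D.src D.tgt l := by
  have := delta_assoc D.src D.mid D.tgt l
  simp only [Diag.dots, Diag.top]
  omega

theorem Diag.dots_bot (j : Fin (N + 1)) (γ : ℕ) (D : Diag N i) :
    (D.bot j γ).dots = D.dots + γ + delta j D.src D.tgt := by
  have := delta_assoc j D.src D.mid D.tgt
  simp only [Diag.dots, Diag.bot]
  omega

/-- The only relation for which this is not immediate is `turn`: the detours from `i` through `i -
1` and through `i + 1` create one dot each. -/
theorem Rel.invariant {D D' : Diag N i} (h : Rel N i D D') :
    D.src = D'.src ∧ D.tgt = D'.tgt ∧ D.dots = D'.dots := by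
  induction h with
  | dot m hm => simp [Diag.dots]
  | slide m m' hm hm' h => simp [Diag.dots]
  | pass m m' hm hm' h => simp [Diag.dots]
  | turn m m' hm hm' h h' =>
    have h1 := two_mul_delta i m i
    have h2 := two_mul_delta i m' i
    simp only [Diag.dots, true_and]
    omega
  | top l γ D D' h ih =>
    obtain ⟨h1, h2, h3⟩ := ih
    refine ⟨h1, rfl, ?_⟩
    rw [Diag.dots_top, Diag.dots_top, h1, h2, h3]
  | bot j γ D D' h ih =>
    obtain ⟨h1, h2, h3⟩ := ih
    refine ⟨rfl, h2, ?_⟩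
    rw [Diag.dots_bot, Diag.dots_bot, h1, h2, h3]

theorem Diag.mk_dot (j m l : Fin (N + 1)) (hm : m ≠ i) (α β : ℕ) :
    Quot.mk (Rel N i) ⟨j, m, l, hm, α, β + 1⟩ = Quot.mk (Rel N i) ⟨j, m, l, hm, α + 1, β⟩ := by
  have h := Rel.bot j α _ _ (Rel.top l β _ _ (Rel.dot (N := N) m hm))
  have := Quot.sound h
  simpa [Diag.top, Diag.bot, Nat.add_comm] using this

theorem Diag.mk_dots (j m l : Fin (N + 1)) (hm : m ≠ i) (α β : ℕ) :
    Quot.mk (Rel N i) ⟨j, m, l, hm, α, β⟩ = Quot.mk (Rel N i) ⟨j, m, l, hm, α + β, 0⟩ := by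
  induction β generalizing α with
  | zero => rfl
  | succ β ih =>
    rw [Diag.mk_dot, ih]
    congr 2
    omega

/-- The positions next to each other when the position `i` is left out. -/
def Next (i m m' : Fin (N + 1)) : Prop :=
  ((m : ℕ) + 1 = m' ∨ (m' : ℕ) + 1 = m) ∨
    ((m : ℕ) + 1 = i ∧ (i : ℕ) + 1 = m') ∨ ((m' : ℕ) + 1 = i ∧ (i : ℕ) + 1 = m)

/-- The relations `slide` and `pass` with arbitrary morphisms stacked on both sides. Moving the
passage trades the dots created above it for the dots created below it. -/
theorem Diag.mk_next (j l m m' : Fin (N + 1)) (hm : m ≠ i) (hm' : m' ≠ i) (h : Next i m m')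
    (α β : ℕ) :
    Quot.mk (Rel N i) ⟨j, m, l, hm, α, β + delta m m' l⟩ =
      Quot.mk (Rel N i) ⟨j, m', l, hm', α + delta j m m', β⟩ := by
  have h0 : Rel N i ⟨m, m, m', hm, 0, 0⟩ ⟨m, m', m', hm', 0, 0⟩ := by
    rcases h with h | h
    · exact Rel.slide m m' hm hm' h
    · exact Rel.pass m m' hm hm' h
  have := Quot.sound (Rel.bot j α _ _ (Rel.top l β _ _ h0))
  simpa [Diag.top, Diag.bot] using this

/-- Moving the passage of the black strand towards a position `t ≠ i`, along which the strand goes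
anyway. -/
theorem Diag.exists_next (i m t : Fin (N + 1)) (hm : m ≠ i) (hmt : m ≠ t)
    (h : t = i → (m : ℕ) + 1 ≠ i ∧ (i : ℕ) + 1 ≠ m) :
    ∃ m' : Fin (N + 1), m' ≠ i ∧ Next i m m' ∧ delta m m' t = 0 ∧ delta t m' m = 0 ∧
      ((m' : ℤ) - t).natAbs < ((m : ℤ) - t).natAbs := by
  have hm1 : (m : ℕ) ≠ i := fun h => hm (Fin.ext h)
  have hm2 : (m : ℕ) ≠ t := fun h => hmt (Fin.ext h)
  have h1 : (t : ℕ) = i → (m : ℕ) + 1 ≠ i ∧ (i : ℕ) + 1 ≠ m := fun e => h (Fin.ext e)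
  have key : ∃ x : ℕ, x < N + 1 ∧ x ≠ i ∧ (((m : ℕ) + 1 = x ∨ x + 1 = m) ∨
      ((m : ℕ) + 1 = i ∧ (i : ℕ) + 1 = x) ∨ (x + 1 = i ∧ (i : ℕ) + 1 = m)) ∧
      ((m < x ∧ x ≤ t) ∨ (x < m ∧ (t : ℕ) ≤ x)) := by
    rcases lt_or_gt_of_ne hm2 with hlt | hlt
    · by_cases e : (m : ℕ) + 1 = i
      -- The passage jumps over `i`. It does not overshoot: `t = i` is excluded by `h1`, so `t` is
      -- at least `m + 2`.
      · exact ⟨m + 2, by omega, by omega, by omega, by omega⟩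
      · exact ⟨m + 1, by omega, by omega, by omega, by omega⟩
    · by_cases e : (i : ℕ) + 1 = m
      · exact ⟨m - 2, by omega, by omega, by omega, by omega⟩
      · exact ⟨m - 1, by omega, by omega, by omega, by omega⟩
  obtain ⟨x, hx, hxi, hn, hb⟩ := key
  refine ⟨⟨x, hx⟩, fun e => hxi (congrArg Fin.val e), hn, ?_, ?_, ?_⟩
  · have := two_mul_delta m ⟨x, hx⟩ t
    simp only at this
    omega
  · have := two_mul_delta t ⟨x, hx⟩ m
    simp only at this
    omega
  · simp only
    omega

/-- Each move towards the target has `delta m m' l = 0`, so `Diag.mk_next` applies without upper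
dots, and whatever is created is absorbed by the lower exponent. -/
theorem Diag.mk_eq_mid_tgt (j l : Fin (N + 1)) (hl : l ≠ i) (m : Fin (N + 1)) (hm : m ≠ i) (α : ℕ) :
    ∃ α', Quot.mk (Rel N i) ⟨j, m, l, hm, α, 0⟩ = Quot.mk (Rel N i) ⟨j, l, l, hl, α', 0⟩ := by
  induction hd : ((m : ℤ) - l).natAbs using Nat.strong_induction_on generalizing m α with
  | _ d ih =>
    by_cases hml : m = l
    · subst hml
      exact ⟨α, rfl⟩
    · obtain ⟨m', hm', hn, h0, -, hlt⟩ := Diag.exists_next i m l hm hml (fun e => absurd e hl)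
      have := Diag.mk_next j l m m' hm hm' hn α 0
      rw [h0] at this
      rw [this]
      exact ih _ (hd ▸ hlt) m' hm' _ rfl

theorem Diag.mk_eq_mid_src (j l : Fin (N + 1)) (hj : j ≠ i) (m : Fin (N + 1)) (hm : m ≠ i) (α : ℕ) :
    ∃ α', Quot.mk (Rel N i) ⟨j, m, l, hm, α, 0⟩ = Quot.mk (Rel N i) ⟨j, j, l, hj, α', 0⟩ := by
  induction hd : ((m : ℤ) - j).natAbs using Nat.strong_induction_on generalizing m α with
  | _ d ih =>
    by_cases hml : m = j
    · subst hml
      exact ⟨α, rfl⟩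
    · obtain ⟨m', hm', hn, -, h0, hlt⟩ := Diag.exists_next i m j hm hml (fun e => absurd e hj)
      have hn' : Next i m' m := by
        unfold Next at hn ⊢
        omega
      have := Diag.mk_next j l m' m hm' hm hn' α 0
      rw [h0] at this
      rw [add_zero] at this
      rw [← this, Diag.mk_dots]
      exact ih _ (hd ▸ hlt) m' hm' _ rfl

/-- With both ends at `T_i` the passage cannot be moved to an end. It is moved to a neighbour of `i`
instead, and `turn` identifies the two neighbours. -/
theorem Diag.mk_eq_turn (p : Fin (N + 1)) (hp : (p : ℕ) + 1 = i)
    (hpi : p ≠ i) (m : Fin (N + 1)) (hm : m ≠ i) (α : ℕ) :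
    ∃ α', Quot.mk (Rel N i) ⟨i, m, i, hm, α, 0⟩ = Quot.mk (Rel N i) ⟨i, p, i, hpi, α', 0⟩ := by
  induction hd : ((m : ℤ) - i).natAbs using Nat.strong_induction_on generalizing m α with
  | _ d ih =>
    by_cases h1 : (m : ℕ) + 1 = i
    · obtain rfl : m = p := Fin.ext (by omega)
      exact ⟨α, rfl⟩
    by_cases h2 : (i : ℕ) + 1 = m
    · have := Quot.sound (Rel.bot i α _ _ (Rel.turn (N := N) (i := i) p m hpi hm hp h2))
      refine ⟨α, ?_⟩
      simpa [Diag.bot] using this.symm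
    obtain ⟨m', hm', hn, h0, -, hlt⟩ := Diag.exists_next i m i hm hm (fun _ => ⟨h1, h2⟩)
    have := Diag.mk_next i i m m' hm hm' hn α 0
    rw [h0] at this
    rw [this]
    exact ih _ (hd ▸ hlt) m' hm' _ rfl

/-- Diagrams are equivalent if they have the same ends and the same number of dots. -/
theorem Diag.mk_eq_iff (hi : 0 < (i : ℕ)) (D D' : Diag N i) :
    Quot.mk (Rel N i) D = Quot.mk (Rel N i) D' ↔
      D.src = D'.src ∧ D.tgt = D'.tgt ∧ D.dots = D'.dots := by
  have inv : ∀ D D' : Diag N i, Quot.mk (Rel N i) D = Quot.mk (Rel N i) D' →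
      D.src = D'.src ∧ D.tgt = D'.tgt ∧ D.dots = D'.dots := by
    intro D D' h
    replace h := Quot.eqvGen_exact h
    induction h with
    | rel _ _ h => exact h.invariant
    | refl => exact ⟨rfl, rfl, rfl⟩
    | symm _ _ _ ih => exact ⟨ih.1.symm, ih.2.1.symm, ih.2.2.symm⟩
    | trans _ _ _ _ _ ih ih' =>
      exact ⟨ih.1.trans ih'.1, ih.2.1.trans ih'.2.1, ih.2.2.trans ih'.2.2⟩
  refine ⟨inv D D', ?_⟩
  obtain ⟨j, m, l, hm, α, β⟩ := D
  obtain ⟨j', m', l', hm', α', β'⟩ := D'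
  rintro ⟨hj, hl, hd⟩
  simp only at hj hl
  subst hj hl
  -- The passage can be moved to a position `q` that depends on the ends only. The single exponent
  -- that is left is then fixed by the number of dots.
  have norm : ∃ q : Fin (N + 1), ∃ hq : q ≠ i, ∀ (m : Fin (N + 1)) (hm : m ≠ i) (α : ℕ),
      ∃ α', Quot.mk (Rel N i) ⟨j, m, l, hm, α, 0⟩ = Quot.mk (Rel N i) ⟨j, q, l, hq, α', 0⟩ := by
    by_cases hl : l = i
    · by_cases hj : j = i
      · subst hl
        subst hj
        have hp : (⟨j - 1, by omega⟩ : Fin (N + 1)) ≠ j := by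
          intro e
          have := congrArg Fin.val e
          simp only at this
          omega
        exact ⟨_, hp, Diag.mk_eq_turn _ (by simp only; omega) hp⟩
      · exact ⟨j, hj, Diag.mk_eq_mid_src j l hj⟩
    · exact ⟨l, hl, Diag.mk_eq_mid_tgt j l hl⟩
  obtain ⟨q, hq, hn⟩ := norm
  obtain ⟨γ, h1⟩ := hn m hm (α + β)
  obtain ⟨γ', h2⟩ := hn m' hm' (α' + β')
  rw [← Diag.mk_dots] at h1 h2
  have h3 := (inv _ _ h1).2.2
  have h4 := (inv _ _ h2).2.2
  rw [h1, h2]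
  have : γ = γ' := by
    rw [hd, h4] at h3
    simp only [Diag.dots] at h3
    omega
  rw [this]

end Diagrams

end
end KLRW

namespace KLRW
open Finsupp
noncomputable section

/-! ### The bimodule as an ideal of the category -/

section Bimodule

variable {N : ℕ} {i : Fin (N + 1)}

/-- A diagram with given ends and (if possible) a given number of dots. -/
def Diag.normal (hi : 0 < (i : ℕ)) (j l : Fin (N + 1)) (e : ℕ) : Diag N i :=
  if hl : l ≠ i then ⟨j, l, l, hl, e, 0⟩
  else if hj : j ≠ i then ⟨j, j, l, hj, e, 0⟩
  else ⟨j, ⟨i - 1, by omega⟩, l, fun h => by have := congrArg Fin.val h; simp only at this; omega,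
    e - 1, 0⟩

@[simp] theorem Diag.normal_src (hi : 0 < (i : ℕ)) (j l : Fin (N + 1)) (e : ℕ) :
    (Diag.normal hi j l e).src = j := by
  unfold Diag.normal
  split_ifs <;> rfl

@[simp] theorem Diag.normal_tgt (hi : 0 < (i : ℕ)) (j l : Fin (N + 1)) (e : ℕ) :
    (Diag.normal hi j l e).tgt = l := by
  unfold Diag.normal
  split_ifs <;> rfl

/-- With both ends at `T_i` the detour through `i - 1` contributes one dot, so `Diag.normal` stores
`e - 1`; this truncates at `e = 0`, the excluded case. -/
theorem Diag.dots_normal (hi : 0 < (i : ℕ)) (j l : Fin (N + 1)) (e : ℕ)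
    (h : j = i → l = i → e ≠ 0) : (Diag.normal hi j l e).dots = e := by
  unfold Diag.normal
  split_ifs with h1 h2
  · simp [Diag.dots]
  · simp [Diag.dots]
  · rw [not_not] at h1 h2
    have h3 := h h2 h1
    subst h1
    subst h2
    have := two_mul_delta j ⟨j - 1, by omega⟩ j
    simp only [Diag.dots] at this ⊢
    omega

/-- The passage avoids `i`, so a strand from `T_i` to `T_i` has to make a detour. This is the only
obstruction to inserting the red crossing. -/
theorem Diag.dots_pos (D : Diag N i) (h : D.src = i) (h' : D.tgt = i) : D.dots ≠ 0 := by
  have := two_mul_delta D.src D.mid D.tgt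
  have hm : (D.mid : ℕ) ≠ i := fun e => D.mid_ne (Fin.ext e)
  have h1 := congrArg Fin.val h
  have h2 := congrArg Fin.val h'
  unfold Diag.dots
  omega

variable (k : Type*) [Field k]

/-- Forgetting the red crossing: the inclusion of the bimodule into the category. -/
def Bim.forget (N : ℕ) (i : Fin (N + 1)) : Bim k N i →ₗ[k] H k :=
  Finsupp.lmapDomain k k (Quot.lift Diag.dots fun _ _ h => h.invariant.2.2)

theorem Bim.forget_single (D : Diag N i) (c : k) :
    Bim.forget k N i (single (Quot.mk _ D) c) = single D.dots c := by
  simp [Bim.forget]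

/-- Inserting the red crossing into a morphism `T_j → T_l`. -/
def Bim.insert (hi : 0 < (i : ℕ)) (j l : Fin (N + 1)) : H k →ₗ[k] Bim k N i :=
  Finsupp.lmapDomain k k fun e => Quot.mk _ (Diag.normal hi j l e)

/-- The morphisms `T_j → T_l` into which the red crossing can be inserted. -/
def Bim.image (i j l : Fin (N + 1)) : Submodule k (H k) where
  carrier := {v | j = i → l = i → v 0 = 0}
  add_mem' := by
    intro a b ha hb h h'
    simp [ha h h', hb h h']
  zero_mem' := fun _ _ => rfl
  smul_mem' := by
    intro c a ha h h'
    simp [ha h h']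

variable {k}

theorem Bim.insert_mem (hi : 0 < (i : ℕ)) (j l : Fin (N + 1)) (v : H k) :
    Bim.insert k hi j l v ∈ Bim.part k N i j l := by
  induction v using Finsupp.induction_linear with
  | zero => simp
  | add a b ha hb => rw [map_add]; exact add_mem ha hb
  | single e c =>
    have : Bim.insert k hi j l (single e c) =
        c • single (Quot.mk _ (Diag.normal hi j l e)) (1 : k) := by
      simp [Bim.insert]
    rw [this]
    exact Submodule.smul_mem _ _ (Submodule.subset_span ⟨_, by simp, by simp, rfl⟩)

theorem Bim.forget_mem {j l : Fin (N + 1)} {x : Bim k N i} (hx : x ∈ Bim.part k N i j l) :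
    Bim.forget k N i x ∈ Bim.image k i j l := by
  induction hx using Submodule.span_induction with
  | mem x h =>
    obtain ⟨D, rfl, rfl, rfl⟩ := h
    intro h h'
    rw [Bim.forget_single, Finsupp.single_apply, if_neg (Diag.dots_pos D h h')]
  | zero => simp
  | add x y _ _ hx hy => rw [map_add]; exact add_mem hx hy
  | smul c x _ hx => rw [map_smul]; exact Submodule.smul_mem _ _ hx

/-- A class of diagrams is known from its ends and its dots, so the normal diagram rebuilt from them
lies in the same class. -/
theorem Bim.insert_forget (hi : 0 < (i : ℕ)) {j l : Fin (N + 1)} {x : Bim k N i}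
    (hx : x ∈ Bim.part k N i j l) : Bim.insert k hi j l (Bim.forget k N i x) = x := by
  induction hx using Submodule.span_induction with
  | mem x h =>
    obtain ⟨D, rfl, rfl, rfl⟩ := h
    rw [Bim.forget_single]
    simp only [Bim.insert, Finsupp.lmapDomain_apply, Finsupp.mapDomain_single]
    congr 1
    rw [Diag.mk_eq_iff hi]
    exact ⟨by simp, by simp, Diag.dots_normal hi _ _ _ (Diag.dots_pos D)⟩
  | zero => simp
  | add x y _ _ hx hy => rw [map_add, map_add, hx, hy]
  | smul c x _ hx => rw [map_smul, map_smul, hx]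

theorem Bim.forget_insert (hi : 0 < (i : ℕ)) {j l : Fin (N + 1)} {v : H k}
    (hv : v ∈ Bim.image k i j l) : Bim.forget k N i (Bim.insert k hi j l v) = v := by
  unfold Bim.forget Bim.insert
  rw [Finsupp.lmapDomain_apply, Finsupp.lmapDomain_apply, ← Finsupp.mapDomain_comp]
  conv_rhs => rw [← Finsupp.mapDomain_id (v := v)]
  refine Finsupp.mapDomain_congr fun e he => ?_
  refine Diag.dots_normal hi j l e fun h h' e0 => ?_
  rw [Finsupp.mem_support_iff, e0] at he
  exact he (hv h h')

theorem Bim.forget_inj (hi : 0 < (i : ℕ)) {j l : Fin (N + 1)} {x y : Bim k N i}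
    (hx : x ∈ Bim.part k N i j l) (hy : y ∈ Bim.part k N i j l)
    (h : Bim.forget k N i x = Bim.forget k N i y) : x = y := by
  rw [← Bim.insert_forget hi hx, h, Bim.insert_forget hi hy]

theorem Bim.lact_single (l : Fin (N + 1)) (γ : ℕ) (c : k) (D : Diag N i) :
    Bim.lact k N i l (single γ c) (single (Quot.mk _ D) 1) =
      c • single (Quot.mk _ (D.top l γ)) 1 := by
  simp [Bim.lact, Quot.map]

theorem Bim.ract_single (l : Fin (N + 1)) (γ : ℕ) (c : k) (D : Diag N i) :
    Bim.ract k N i l (single γ c) (single (Quot.mk _ D) 1) =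
      c • single (Quot.mk _ (D.bot l γ)) 1 := by
  simp [Bim.ract, Quot.map]

theorem Bim.lact_mem {j m : Fin (N + 1)} (l : Fin (N + 1)) (f : H k) {x : Bim k N i}
    (hx : x ∈ Bim.part k N i j m) : Bim.lact k N i l f x ∈ Bim.part k N i j l := by
  induction f using Finsupp.induction_linear with
  | zero => simp
  | add a b ha hb => rw [map_add]; exact add_mem ha hb
  | single γ c =>
    induction hx using Submodule.span_induction with
    | mem x h =>
      obtain ⟨D, rfl, rfl, rfl⟩ := h
      rw [Bim.lact_single]
      exact Submodule.smul_mem _ _ (Submodule.subset_span ⟨D.top l γ, rfl, rfl, rfl⟩)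
    | zero => simp
    | add x y _ _ hx hy => rw [map_add]; exact add_mem hx hy
    | smul c x _ hx => rw [map_smul]; exact Submodule.smul_mem _ _ hx

theorem Bim.ract_mem {m l : Fin (N + 1)} (j : Fin (N + 1)) (f : H k) {x : Bim k N i}
    (hx : x ∈ Bim.part k N i m l) : Bim.ract k N i j f x ∈ Bim.part k N i j l := by
  induction f using Finsupp.induction_linear with
  | zero => simp
  | add a b ha hb => rw [map_add]; exact add_mem ha hb
  | single γ c =>
    induction hx using Submodule.span_induction with
    | mem x h =>
      obtain ⟨D, rfl, rfl, rfl⟩ := h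
      rw [Bim.ract_single]
      exact Submodule.smul_mem _ _ (Submodule.subset_span ⟨D.bot j γ, rfl, rfl, rfl⟩)
    | zero => simp
    | add x y _ _ hx hy => rw [map_add]; exact add_mem hx hy
    | smul c x _ hx => rw [map_smul]; exact Submodule.smul_mem _ _ hx

/-- Together with `Bim.forget_ract` this makes the embedding into `C` one of bimodules, so that
identities can be checked on exponents. -/
theorem Bim.forget_lact {j m : Fin (N + 1)} (l : Fin (N + 1)) (f : H k) {x : Bim k N i}
    (hx : x ∈ Bim.part k N i j m) :
    Bim.forget k N i (Bim.lact k N i l f x) = comp k j m l f (Bim.forget k N i x) := by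
  induction f using Finsupp.induction_linear with
  | zero => simp
  | add a b ha hb => simp only [map_add, LinearMap.add_apply, ha, hb]
  | single γ c =>
    induction hx using Submodule.span_induction with
    | mem x h =>
      obtain ⟨D, rfl, rfl, rfl⟩ := h
      rw [Bim.lact_single, map_smul, Bim.forget_single, Bim.forget_single, comp,
        conv_single_single, Diag.dots_top, Nat.add_comm γ]
      simp
    | zero => simp
    | add x y _ _ hx hy => simp only [map_add, hx, hy]
    | smul c x _ hx => simp only [map_smul, hx]

theorem Bim.forget_ract {m l : Fin (N + 1)} (j : Fin (N + 1)) (f : H k) {x : Bim k N i}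
    (hx : x ∈ Bim.part k N i m l) :
    Bim.forget k N i (Bim.ract k N i j f x) = comp k j m l (Bim.forget k N i x) f := by
  induction f using Finsupp.induction_linear with
  | zero => simp
  | add a b ha hb => simp only [map_add, LinearMap.add_apply, ha, hb]
  | single γ c =>
    induction hx using Submodule.span_induction with
    | mem x h =>
      obtain ⟨D, rfl, rfl, rfl⟩ := h
      rw [Bim.ract_single, map_smul, Bim.forget_single, Bim.forget_single, comp,
        conv_single_single, Diag.dots_bot]
      simp
    | zero => simp
    | add x y _ _ hx hy => simp only [map_add, LinearMap.add_apply, hx, hy]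
    | smul c x _ hx => simp only [map_smul, LinearMap.smul_apply, hx]

end Bimodule

end
end KLRW

namespace KLRW
open Finsupp
noncomputable section

/-! ### Multilinear functions on chains of morphisms -/

section Multilinear

variable {k : Type*} [Field k] {W W' : Type*} [AddCommGroup W] [Module k W] [AddCommGroup W']
  [Module k W'] {N n : ℕ}

/-- The function `φ` is multilinear. -/
def IsMultilin (φ : (Fin n → H k) → W) : Prop :=
  ∃ m : MultilinearMap k (fun _ : Fin n => H k) W, ∀ a, φ a = m a

theorem isMultilin_iff {φ : (Fin n → H k) → W} :
    IsMultilin φ ↔ ∀ a s, ∃ l : H k →ₗ[k] W, ∀ x, φ (Function.update a s x) = l x := by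
  constructor
  · rintro ⟨m, hm⟩ a s
    exact ⟨m.toLinearMap a s, fun x => hm _⟩
  · intro h
    refine ⟨MultilinearMap.mk' φ ?_ ?_, fun a => rfl⟩
    · intro a s x y
      obtain ⟨l, hl⟩ := h a s
      simp only [hl, map_add]
    · intro a s c x
      obtain ⟨l, hl⟩ := h a s
      simp only [hl, map_smul]

theorem IsMultilin.add {φ ψ : (Fin n → H k) → W} (hφ : IsMultilin φ) (hψ : IsMultilin ψ) :
    IsMultilin fun a => φ a + ψ a := by
  obtain ⟨m, hm⟩ := hφ
  obtain ⟨m', hm'⟩ := hψ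
  exact ⟨m + m', fun a => by simp [hm, hm']⟩

theorem IsMultilin.smul {φ : (Fin n → H k) → W} (c : k) (hφ : IsMultilin φ) :
    IsMultilin fun a => c • φ a := by
  obtain ⟨m, hm⟩ := hφ
  exact ⟨c • m, fun a => by simp [hm]⟩

theorem IsMultilin.sum {ι : Type*} (s : Finset ι) {φ : ι → (Fin n → H k) → W}
    (hφ : ∀ t, IsMultilin (φ t)) : IsMultilin fun a => ∑ t ∈ s, φ t a := by
  choose m hm using hφ
  exact ⟨∑ t ∈ s, m t, fun a => by simp [hm]⟩

theorem IsMultilin.map (l : W →ₗ[k] W') {φ : (Fin n → H k) → W} (hφ : IsMultilin φ) :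
    IsMultilin fun a => l (φ a) := by
  obtain ⟨m, hm⟩ := hφ
  exact ⟨l.compMultilinearMap m, fun a => by simp [hm]⟩

theorem IsMultilin.tail (B : H k →ₗ[k] W →ₗ[k] W') {φ : (Fin n → H k) → W}
    (hφ : IsMultilin φ) : IsMultilin fun a : Fin (n + 1) → H k => B (a 0) (φ (Fin.tail a)) := by
  rw [isMultilin_iff] at hφ ⊢
  intro a s
  induction s using Fin.cases with
  | zero => exact ⟨B.flip (φ (Fin.tail a)), fun x => by simp⟩
  | succ s =>
    obtain ⟨l, hl⟩ := hφ (Fin.tail a) s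
    exact ⟨B (a 0) ∘ₗ l, fun x => by
      simp [Fin.tail_update_succ, hl, Function.update_of_ne (Fin.succ_ne_zero s).symm]⟩

theorem IsMultilin.init (B : H k →ₗ[k] W →ₗ[k] W') {φ : (Fin n → H k) → W}
    (hφ : IsMultilin φ) :
    IsMultilin fun a : Fin (n + 1) → H k => B (a (Fin.last n)) (φ (Fin.init a)) := by
  rw [isMultilin_iff] at hφ ⊢
  intro a s
  induction s using Fin.lastCases with
  | last => exact ⟨B.flip (φ (Fin.init a)), fun x => by simp⟩
  | cast s =>
    obtain ⟨l, hl⟩ := hφ (Fin.init a) s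
    exact ⟨B (a (Fin.last n)) ∘ₗ l, fun x => by
      simp [Fin.init_update_castSucc, hl, Function.update_of_ne (Fin.castSucc_ne_last s).symm]⟩

/-- The four cases are a slot before the merged pair, its first member, its second member, and a
slot after the pair. -/
theorem mergeHom_update (t : Fin n) (X : Fin (n + 2) → Fin (N + 1)) (a : Fin (n + 1) → H k)
    (s : Fin (n + 1)) : ∃ (s' : Fin n) (l : H k →ₗ[k] H k), ∀ x,
      mergeHom t X (Function.update a s x) = Function.update (mergeHom t X a) s' (l x) := by
  rcases lt_trichotomy (s : ℕ) t with h | h | h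
  · refine ⟨⟨s, by omega⟩, LinearMap.id, fun x => ?_⟩
    funext r
    rcases lt_trichotomy (r : ℕ) t with h' | h' | h' <;>
    simp [mergeHom, Fin.contractNth, Function.update_apply, Fin.ext_iff, h'] <;> grind
  · refine ⟨t, comp k (X t.castSucc.castSucc) (X t.succ.castSucc) (X t.succ.succ) (a t.succ),
      fun x => ?_⟩
    funext r
    rcases lt_trichotomy (r : ℕ) t with h' | h' | h' <;>
    simp [mergeHom, Fin.contractNth, Function.update_apply, Fin.ext_iff, h'] <;> grind
  · by_cases h1 : (s : ℕ) = t + 1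
    · refine ⟨t, (comp k (X t.castSucc.castSucc) (X t.succ.castSucc) (X t.succ.succ)).flip
        (a t.castSucc), fun x => ?_⟩
      funext r
      rcases lt_trichotomy (r : ℕ) t with h' | h' | h' <;>
      simp [mergeHom, Fin.contractNth, Function.update_apply, Fin.ext_iff, h'] <;> grind
    · refine ⟨⟨s - 1, by omega⟩, LinearMap.id, fun x => ?_⟩
      funext r
      rcases lt_trichotomy (r : ℕ) t with h' | h' | h' <;>
      simp [mergeHom, Fin.contractNth, Function.update_apply, Fin.ext_iff, h'] <;> grind

theorem IsMultilin.merge (t : Fin n) (X : Fin (n + 2) → Fin (N + 1)) {φ : (Fin n → H k) → W}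
    (hφ : IsMultilin φ) : IsMultilin fun a => φ (mergeHom t X a) := by
  rw [isMultilin_iff] at hφ ⊢
  intro a s
  obtain ⟨s', l, hl⟩ := mergeHom_update t X a s
  obtain ⟨l', hl'⟩ := hφ (mergeHom t X a) s'
  exact ⟨l' ∘ₗ l, fun x => by simp [hl, hl']⟩

/-- The chain of monomials with the exponents `e`. -/
def monomials (k : Type*) [Field k] (e : Fin n → ℕ) : Fin n → H k := fun t => single (e t) 1

theorem IsMultilin.ext {φ ψ : (Fin n → H k) → W} (hφ : IsMultilin φ) (hψ : IsMultilin ψ)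
    (h : ∀ e, φ (monomials k e) = ψ (monomials k e)) : φ = ψ := by
  obtain ⟨m, hm⟩ := hφ
  obtain ⟨m', hm'⟩ := hψ
  have : m = m' := by
    refine Module.Basis.ext_multilinear (fun _ => Finsupp.basisSingleOne) fun e => ?_
    have := h e
    rw [hm, hm'] at this
    unfold monomials at this
    simpa using this
  funext a
  rw [hm, hm', this]

/-- Multilinear maps on free modules may be prescribed on basis tuples; the induction curries the
first argument. -/
theorem exists_isMultilin (c : (Fin n → ℕ) → W) :
    ∃ φ : (Fin n → H k) → W, IsMultilin φ ∧ ∀ e, φ (monomials k e) = c e := by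
  suffices h : ∃ m : MultilinearMap k (fun _ : Fin n => H k) W, ∀ e, m (monomials k e) = c e by
    obtain ⟨m, hm⟩ := h
    exact ⟨m, ⟨m, fun _ => rfl⟩, hm⟩
  induction n with
  | zero =>
    refine ⟨MultilinearMap.constOfIsEmpty k _ (c Fin.elim0), fun e => ?_⟩
    simp [Subsingleton.elim e Fin.elim0]
  | succ n ih =>
    choose m hm using ih
    refine ⟨LinearMap.uncurryLeft (Finsupp.linearCombination k fun e₀ : ℕ =>
      m fun e => c (Fin.cons e₀ e)), fun e => ?_⟩
    rw [LinearMap.uncurryLeft_apply]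
    have : Fin.tail (monomials k e) = monomials k (Fin.tail e) := rfl
    rw [this]
    simp [monomials, Finsupp.linearCombination_single]
    have := hm (fun e' => c (Fin.cons (e 0) e')) (Fin.tail e)
    rw [Fin.cons_self_tail] at this
    exact this

end Multilinear

end
end KLRW

namespace KLRW
open Finsupp
noncomputable section

/-! ### Simplicial chains of lattice points -/

section Simplices

variable (k : Type*) [Field k]

/-- Simplicial chains on the lattice `ℤ²`, where `n` is the number of vertices of a simplex. -/
abbrev Simp (n : ℕ) : Type _ := (Fin n → ℤ × ℤ) →₀ k

/-- The (augmented) simplicial boundary. -/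
def bdry (n : ℕ) : Simp k (n + 1) →ₗ[k] Simp k n :=
  Finsupp.linearCombination k fun σ =>
    ∑ r : Fin (n + 1), (-1 : k) ^ (r : ℕ) • single (Fin.removeNth r σ) (1 : k)

/-- The cone with the vertex `p`. -/
def cone (n : ℕ) (p : ℤ × ℤ) : Simp k n →ₗ[k] Simp k (n + 1) :=
  Finsupp.lmapDomain k k fun σ => Fin.cons p σ

/-- The translation by `(1, 1)`. -/
def tau (p : ℤ × ℤ) : ℤ × ℤ := p + (1, 1)

variable {k}

theorem bdry_single {n : ℕ} (σ : Fin (n + 1) → ℤ × ℤ) :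
    bdry k n (single σ 1) =
      ∑ r : Fin (n + 1), (-1 : k) ^ (r : ℕ) • single (Fin.removeNth r σ) (1 : k) := by
  simp [bdry]

theorem cone_single {n : ℕ} (p : ℤ × ℤ) (σ : Fin n → ℤ × ℤ) (c : k) :
    cone k n p (single σ c) = single (Fin.cons p σ) c := by
  simp [cone]

theorem removeNth_succ_cons {α : Type*} {n : ℕ} (p : α) (σ : Fin (n + 1) → α) (r : Fin (n + 1)) :
    Fin.removeNth (α := fun _ => α) r.succ (Fin.cons p σ) =
      (Fin.cons p (Fin.removeNth (α := fun _ => α) r σ) : Fin (n + 1) → α) := by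
  funext t
  induction t using Fin.cases with
  | zero => simp [Fin.removeNth]
  | succ t => simp [Fin.removeNth]

/-- Omitting the vertex `p` gives back `x`; omitting any other vertex gives a cone over a face, with
the sign shifted by one. -/
theorem bdry_cone_add {n : ℕ} (p : ℤ × ℤ) (x : Simp k (n + 1)) :
    bdry k (n + 1) (cone k (n + 1) p x) + cone k n p (bdry k n x) = x := by
  induction x using Finsupp.induction_linear with
  | zero => simp
  | add x y hx hy =>
    simp only [map_add]
    rw [add_add_add_comm, hx, hy]
  | single σ c =>
    have : (single σ c : Simp k (n + 1)) = c • single σ 1 := by simp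
    rw [this]
    simp only [map_smul, ← smul_add]
    congr 1
    rw [cone_single, bdry_single, bdry_single, Fin.sum_univ_succ]
    simp only [map_sum, map_smul, cone_single, removeNth_succ_cons, Fin.val_succ, pow_succ]
    simp

theorem bdry_cone_zero (p : ℤ × ℤ) (x : Simp k 0) : bdry k 0 (cone k 0 p x) = x := by
  induction x using Finsupp.induction_linear with
  | zero => simp
  | add x y hx hy => simp only [map_add, hx, hy]
  | single σ c =>
    rw [cone_single, ← mul_one c, ← smul_eq_mul, ← Finsupp.smul_single, map_smul, bdry_single]
    simp [Subsingleton.elim _ σ]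

/-- A simplex is the cone over its remaining vertices from the first one, so `bdry_cone_add` reduces
the claim to one vertex fewer. -/
theorem bdry_bdry {n : ℕ} (x : Simp k (n + 2)) : bdry k n (bdry k (n + 1) x) = 0 := by
  induction n with
  | zero =>
    induction x using Finsupp.induction_linear with
    | zero => simp
    | add x y hx hy => simp only [map_add, hx, hy, add_zero]
    | single σ c =>
      rw [← Fin.cons_self_tail σ, ← cone_single]
      have h := bdry_cone_add (σ 0) (single (Fin.tail σ) c)
      rw [← eq_sub_iff_add_eq] at h
      rw [h, map_sub, bdry_cone_zero, sub_self]
  | succ n ih =>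
    induction x using Finsupp.induction_linear with
    | zero => simp
    | add x y hx hy => simp only [map_add, hx, hy, add_zero]
    | single σ c =>
      rw [← Fin.cons_self_tail σ, ← cone_single]
      have h := bdry_cone_add (σ 0) (single (Fin.tail σ) c)
      rw [← eq_sub_iff_add_eq] at h
      have h' := bdry_cone_add (σ 0) (bdry k (n + 1) (single (Fin.tail σ) c))
      rw [ih, map_zero, add_zero] at h'
      rw [h, map_sub, h', sub_self]

/-! ### Simplices in the strip -/

/-- The strip of the lattice points whose position `a - b` is one of `0, …, N`. -/
def Strip (N : ℕ) (p : ℤ × ℤ) : Prop := 0 ≤ p.1 - p.2 ∧ p.1 - p.2 ≤ N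

/-- The weakly increasing sequences of points of the strip. -/
def Good (N : ℕ) {n : ℕ} (σ : Fin n → ℤ × ℤ) : Prop := Monotone σ ∧ ∀ t, Strip N (σ t)

/-- The chains of increasing sequences of points in the strip between `p` and `q`. -/
def Car (k : Type*) [Field k] (N n : ℕ) (p q : ℤ × ℤ) : Submodule k (Simp k n) :=
  Finsupp.supported k k {σ | Good N σ ∧ ∀ t, p ≤ σ t ∧ σ t ≤ q}

theorem Car.single_mem {N n : ℕ} {p q : ℤ × ℤ} {σ : Fin n → ℤ × ℤ} (h : Good N σ)
    (hb : ∀ t, p ≤ σ t ∧ σ t ≤ q) (c : k) : single σ c ∈ Car k N n p q :=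
  Finsupp.single_mem_supported k c ⟨h, hb⟩

/-- To check that a linear map takes `Car` into a submodule, consider simplices. -/
theorem Car.map_mem {N n : ℕ} {p q : ℤ × ℤ} {W : Type*} [AddCommGroup W] [Module k W]
    (F : Simp k n →ₗ[k] W) (U : Submodule k W)
    (hF : ∀ σ, Good N σ → (∀ t, p ≤ σ t ∧ σ t ≤ q) → F (single σ 1) ∈ U)
    {x : Simp k n} (hx : x ∈ Car k N n p q) : F x ∈ U := by
  rw [Car, Finsupp.supported_eq_span_single] at hx
  induction hx using Submodule.span_induction with
  | mem x h =>
    obtain ⟨σ, ⟨h1, h2⟩, rfl⟩ := h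
    exact hF σ h1 h2
  | zero => simp
  | add x y _ _ hx hy => rw [map_add]; exact add_mem hx hy
  | smul c x _ hx => rw [map_smul]; exact Submodule.smul_mem _ _ hx

/-- Linear maps which agree on the simplices agree on `Car`. -/
theorem Car.congr {N n : ℕ} {p q : ℤ × ℤ} {W : Type*} [AddCommGroup W] [Module k W]
    (F F' : Simp k n →ₗ[k] W)
    (hF : ∀ σ, Good N σ → (∀ t, p ≤ σ t ∧ σ t ≤ q) → F (single σ 1) = F' (single σ 1))
    {x : Simp k n} (hx : x ∈ Car k N n p q) : F x = F' x := by
  have := Car.map_mem (F - F') ⊥ (fun σ h h' => by simp [hF σ h h']) hx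
  simpa [sub_eq_zero] using this

theorem Good.removeNth {N n : ℕ} {σ : Fin (n + 1) → ℤ × ℤ} (h : Good N σ) (r : Fin (n + 1)) :
    Good N (Fin.removeNth (α := fun _ => ℤ × ℤ) r σ) :=
  ⟨h.1.comp (Fin.strictMono_succAbove r).monotone, fun _ => h.2 _⟩

theorem Car.bdry_mem {N n : ℕ} {p q : ℤ × ℤ} {x : Simp k (n + 1)} (hx : x ∈ Car k N (n + 1) p q) :
    bdry k n x ∈ Car k N n p q := by
  refine Car.map_mem _ _ (fun σ h h' => ?_) hx
  rw [bdry_single]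
  exact sum_mem fun r _ => Submodule.smul_mem _ _
    (Car.single_mem (h.removeNth r) (fun t => h' _) _)

theorem Car.cone_mem {N n : ℕ} {p q : ℤ × ℤ} (hp : Strip N p) (hpq : p ≤ q) {x : Simp k n}
    (hx : x ∈ Car k N n p q) : cone k n p x ∈ Car k N (n + 1) p q := by
  refine Car.map_mem _ _ (fun σ h h' => ?_) hx
  rw [cone_single]
  refine Car.single_mem ⟨?_, ?_⟩ ?_ _
  · intro s t hst
    induction s using Fin.cases with
    | zero =>
      induction t using Fin.cases with
      | zero => simp
      | succ t => simpa using (h' t).1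
    | succ s =>
      induction t using Fin.cases with
      | zero => simp at hst
      | succ t => simpa using h.1 (Fin.succ_le_succ_iff.1 hst)
  · intro t
    induction t using Fin.cases with
    | zero => simpa using hp
    | succ t => simpa using h.2 t
  · intro t
    induction t using Fin.cases with
    | zero => simpa using hpq
    | succ t => simpa using h' t

theorem Car.mono {N n : ℕ} {p q p' q' : ℤ × ℤ} (hp : p' ≤ p) (hq : q ≤ q') :
    Car k N n p q ≤ Car k N n p' q' := by
  refine Finsupp.supported_mono fun σ h => ⟨h.1, fun t => ⟨hp.trans (h.2 t).1, (h.2 t).2.trans hq⟩⟩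

theorem Car.self_mem {N n : ℕ} {σ : Fin (n + 1) → ℤ × ℤ} (h : Good N σ) :
    (single σ 1 : Simp k (n + 1)) ∈ Car k N (n + 1) (σ 0) (σ (Fin.last n)) :=
  Car.single_mem h (fun t => ⟨h.1 (Fin.zero_le t), h.1 (Fin.le_last t)⟩) _

theorem Good.zero_le_last {N n : ℕ} {σ : Fin (n + 1) → ℤ × ℤ} (h : Good N σ) :
    σ 0 ≤ σ (Fin.last n) := h.1 (Fin.zero_le _)

/-- The translation of chains. -/
def shift (k : Type*) [Field k] (n : ℕ) : Simp k n →ₗ[k] Simp k n :=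
  Finsupp.lmapDomain k k (tau ∘ ·)

theorem shift_single {n : ℕ} (σ : Fin n → ℤ × ℤ) (c : k) :
    shift k n (single σ c) = single (tau ∘ σ) c := by
  simp [shift]

theorem bdry_shift {n : ℕ} (x : Simp k (n + 1)) :
    bdry k n (shift k (n + 1) x) = shift k n (bdry k n x) := by
  suffices h : bdry k n ∘ₗ shift k (n + 1) = shift k n ∘ₗ bdry k n from LinearMap.congr_fun h x
  ext1 σ
  ext1
  simp only [LinearMap.comp_apply, Finsupp.lsingle_apply, shift_single, bdry_single, map_sum,
    map_smul]
  rfl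

theorem cone_shift {n : ℕ} (p : ℤ × ℤ) (x : Simp k n) :
    cone k n (tau p) (shift k n x) = shift k (n + 1) (cone k n p x) := by
  suffices h : cone k n (tau p) ∘ₗ shift k n = shift k (n + 1) ∘ₗ cone k n p from
    LinearMap.congr_fun h x
  ext1 σ
  ext1
  simp only [LinearMap.comp_apply, Finsupp.lsingle_apply, shift_single, cone_single]
  congr 1
  funext t
  induction t using Fin.cases <;> simp

end Simplices

end
end KLRW

namespace KLRW
open Finsupp
noncomputable section

/-! ### Lattice paths and squares -/

section Paths

variable (k : Type*) [Field k] (N : ℕ)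

/-- The lattice point before `q` in the first direction. -/
def west (q : ℤ × ℤ) : ℤ × ℤ := (q.1 - 1, q.2)

/-- The lattice point before `q` in the second direction. -/
def south (q : ℤ × ℤ) : ℤ × ℤ := (q.1, q.2 - 1)

/-- The simplex with the vertices `r` and `q`. -/
def edge (r q : ℤ × ℤ) : Simp k 2 := single ![r, q] 1

/-- The lattice path in the strip from `p` to `q` (described from its end `q`), which takes steps
in the second direction as late as possible. -/
def path (p q : ℤ × ℤ) : Simp k 2 :=
  if p.2 < q.2 ∧ q.1 - q.2 < N then edge k (south q) q + path p (south q)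
  else if p.1 < q.1 then edge k (west q) q + path p (west q)
  else 0
termination_by (q.1 - p.1).toNat + (q.2 - p.2).toNat
decreasing_by
  all_goals simp only [south, west]; omega

/-- The squares between the lattice path from `p` to `west q`, continued to `q`, and the lattice
path from `p` to `q`; a square is represented by its largest vertex. -/
def fill (p q : ℤ × ℤ) : (ℤ × ℤ) →₀ k :=
  if p.2 < q.2 ∧ q.1 - q.2 < N then single q 1 + fill p (south q) else 0
termination_by (q.2 - p.2).toNat
decreasing_by
  simp only [south]; omega

/-- A square as a chain. -/
def square (q : ℤ × ℤ) : Simp k 3 :=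
  single ![south (west q), west q, q] 1 - single ![south (west q), south q, q] 1

/-- Squares as chains, linearly extended. -/
def triangulate : ((ℤ × ℤ) →₀ k) →ₗ[k] Simp k 3 := Finsupp.linearCombination k (square k)

/-- The contraction of lattice paths to the paths with the origin `p`. -/
def contract (p : ℤ × ℤ) : Simp k 2 →ₗ[k] ((ℤ × ℤ) →₀ k) :=
  Finsupp.linearCombination k fun σ => if σ 0 = west (σ 1) then fill k N p (σ 1) else 0

/-- The paths from `p`, as a linear map. -/
def pathFrom (p : ℤ × ℤ) : Simp k 1 →ₗ[k] Simp k 2 :=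
  Finsupp.linearCombination k fun σ => path k N p (σ 0)

/-- Replacing `1`-simplices by lattice paths. -/
def straighten : Simp k 2 →ₗ[k] Simp k 2 :=
  Finsupp.linearCombination k fun σ => path k N (σ 0) (σ 1)

/-- Replacing `2`-simplices by squares. -/
def tile : Simp k 3 →ₗ[k] ((ℤ × ℤ) →₀ k) :=
  Finsupp.linearCombination k fun σ =>
    contract k N (σ 0) (straighten k N (bdry k 2 (single σ 1)))

/-- The chains of lattice steps in the strip between `p` and `q`. -/
def EdgeCar (p q : ℤ × ℤ) : Submodule k (Simp k 2) :=
  Submodule.span k {z | ∃ r, Strip N r ∧ r ≤ q ∧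
    ((Strip N (west r) ∧ p ≤ west r ∧ z = edge k (west r) r) ∨
     (Strip N (south r) ∧ p ≤ south r ∧ z = edge k (south r) r))}

/-- The squares in the strip between `p` and `q`. -/
def SquareCar (p q : ℤ × ℤ) : Submodule k ((ℤ × ℤ) →₀ k) :=
  Finsupp.supported k k {r | Strip N r ∧ Strip N (west r) ∧ Strip N (south r) ∧
    p ≤ south (west r) ∧ r ≤ q}

variable {k N}

theorem le_iff {p q : ℤ × ℤ} : p ≤ q ↔ p.1 ≤ q.1 ∧ p.2 ≤ q.2 := Iff.rfl

theorem edge_mem_west {p q r : ℤ × ℤ} (h : Strip N r) (h' : Strip N (west r)) (hp : p ≤ west r)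
    (hq : r ≤ q) : edge k (west r) r ∈ EdgeCar k N p q :=
  Submodule.subset_span ⟨r, h, hq, Or.inl ⟨h', hp, rfl⟩⟩

theorem edge_mem_south {p q r : ℤ × ℤ} (h : Strip N r) (h' : Strip N (south r))
    (hp : p ≤ south r) (hq : r ≤ q) : edge k (south r) r ∈ EdgeCar k N p q :=
  Submodule.subset_span ⟨r, h, hq, Or.inr ⟨h', hp, rfl⟩⟩

theorem EdgeCar.mono {p q p' q' : ℤ × ℤ} (hp : p' ≤ p) (hq : q ≤ q') :
    EdgeCar k N p q ≤ EdgeCar k N p' q' := by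
  refine Submodule.span_mono ?_
  rintro z ⟨r, h1, h2, h3⟩
  refine ⟨r, h1, h2.trans hq, ?_⟩
  rcases h3 with ⟨h3, h4, h5⟩ | ⟨h3, h4, h5⟩
  · exact Or.inl ⟨h3, hp.trans h4, h5⟩
  · exact Or.inr ⟨h3, hp.trans h4, h5⟩

theorem bdry_edge (r q : ℤ × ℤ) :
    bdry k 1 (edge k r q) = single ![q] 1 - single ![r] 1 := by
  rw [edge, bdry_single, Fin.sum_univ_two]
  have h0 : Fin.removeNth (α := fun _ => ℤ × ℤ) 0 ![r, q] = ![q] := by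
    funext t; fin_cases t; rfl
  have h1 : Fin.removeNth (α := fun _ => ℤ × ℤ) 1 ![r, q] = ![r] := by
    funext t; fin_cases t; rfl
  rw [h0, h1]
  simp [sub_eq_add_neg]

theorem bdry_triangle (p q r : ℤ × ℤ) :
    bdry k 2 (single ![p, q, r] 1) = edge k q r - edge k p r + edge k p q := by
  rw [bdry_single, Fin.sum_univ_three]
  have h0 : Fin.removeNth (α := fun _ => ℤ × ℤ) 0 ![p, q, r] = ![q, r] := by
    funext t; fin_cases t <;> rfl
  have h1 : Fin.removeNth (α := fun _ => ℤ × ℤ) 1 ![p, q, r] = ![p, r] := by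
    funext t; fin_cases t <;> rfl
  have h2 : Fin.removeNth (α := fun _ => ℤ × ℤ) 2 ![p, q, r] = ![p, q] := by
    funext t; fin_cases t <;> rfl
  rw [h0, h1, h2]
  simp [edge, sub_eq_add_neg]

theorem bdry_square (q : ℤ × ℤ) : bdry k 2 (square k q) =
    edge k (west q) q + edge k (south (west q)) (west q) - edge k (south q) q
      - edge k (west (south q)) (south q) := by
  rw [square, map_sub, bdry_triangle, bdry_triangle]
  have : south (west q) = west (south q) := rfl
  rw [this]
  abel

theorem contract_edge_west (p q : ℤ × ℤ) :
    contract k N p (edge k (west q) q) = fill k N p q := by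
  simp [contract, edge]

theorem contract_edge_south (p q : ℤ × ℤ) :
    contract k N p (edge k (south q) q) = 0 := by
  have : south q ≠ west q := by
    intro h
    have := congrArg Prod.fst h
    simp only [south, west] at this
    omega
  simp [contract, edge, this]

/-- When no step in the second direction is left, `q` is either level with `p` or on the wall `q.1 -
q.2 = N`. In both cases a step in the first direction stays in the strip, on the wall because `N >
0`. -/
theorem path_mem {p q : ℤ × ℤ} (hN : 0 < N) (hp : Strip N p) (hq : Strip N q) (hpq : p ≤ q) :
    path k N p q ∈ EdgeCar k N p q := by
  induction hm : (q.1 - p.1).toNat + (q.2 - p.2).toNat using Nat.strong_induction_on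
    generalizing q with
  | _ m ih =>
    rw [path]
    simp only [Strip, le_iff] at hp hq hpq
    split_ifs with h1 h2
    · have h3 : Strip N (south q) := by simp only [Strip, south]; omega
      have h4 : p ≤ south q := by simp only [le_iff, south]; omega
      have h5 : south q ≤ q := by simp only [le_iff, south]; omega
      refine add_mem (edge_mem_south hq h3 h4 le_rfl) (EdgeCar.mono le_rfl h5 (ih _ ?_ h3 h4 rfl))
      simp only [south]
      omega
    · have h3 : Strip N (west q) := by simp only [Strip, west]; omega
      have h4 : p ≤ west q := by simp only [le_iff, west]; omega
      have h5 : west q ≤ q := by simp only [le_iff, west]; omega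
      refine add_mem (edge_mem_west hq h3 h4 le_rfl) (EdgeCar.mono le_rfl h5 (ih _ ?_ h3 h4 rfl))
      simp only [west]
      omega
    · exact zero_mem _

theorem bdry_path {p q : ℤ × ℤ} (hp : Strip N p) (hq : Strip N q) (hpq : p ≤ q) (hN : 0 < N) :
    bdry k 1 (path k N p q) = single ![q] 1 - single ![p] 1 := by
  induction hm : (q.1 - p.1).toNat + (q.2 - p.2).toNat using Nat.strong_induction_on
    generalizing q with
  | _ m ih =>
    rw [path]
    simp only [Strip, le_iff] at hp hq hpq
    split_ifs with h1 h2
    · have h3 : Strip N (south q) := by simp only [Strip, south]; omega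
      have h4 : p ≤ south q := by simp only [le_iff, south]; omega
      rw [map_add, bdry_edge, ih _ ?_ h3 h4 rfl]
      · abel
      · simp only [south]
        omega
    · have h3 : Strip N (west q) := by simp only [Strip, west]; omega
      have h4 : p ≤ west q := by simp only [le_iff, west]; omega
      rw [map_add, bdry_edge, ih _ ?_ h3 h4 rfl]
      · abel
      · simp only [west]
        omega
    · have : q = p := Prod.ext (by omega) (by omega)
      simp [this]

theorem path_of_south {p q : ℤ × ℤ} (h : p.2 < q.2 ∧ q.1 - q.2 < N) :
    path k N p q = edge k (south q) q + path k N p (south q) := by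
  rw [path, if_pos h]

/-- The contraction inverts the boundary up to the paths from the origin. -/
theorem bdry_fill {p q : ℤ × ℤ} (hq : Strip N q) (hq' : Strip N (west q))
    (hpq : p ≤ west q) :
    bdry k 2 (triangulate k (fill k N p q)) + (path k N p q - path k N p (west q)) =
      edge k (west q) q := by
  induction hm : (q.2 - p.2).toNat using Nat.strong_induction_on generalizing q with
  | _ m ih =>
    simp only [Strip, le_iff, west] at hq hq' hpq
    rw [fill]
    split_ifs with h1
    -- The position of `west q` is smaller than that of `q`, so its path also ends with a step in
    -- the second direction. Removing these parallel steps leaves the square with largest vertex `q`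
    -- and the same problem at `south q`.
    · have h2 : p.2 < (west q).2 ∧ (west q).1 - (west q).2 < N := by simp only [west]; omega
      rw [path_of_south h1, path_of_south h2]
      have h3 : south (west q) = west (south q) := rfl
      have := ih (q := south q) _ (by simp only [south]; omega) (by simp only [Strip, south]; omega)
        (by simp only [Strip, west, south]; omega) (by simp only [le_iff, west, south]; omega) rfl
      rw [map_add, map_add, triangulate, Finsupp.linearCombination_single, one_smul, bdry_square,
        h3, ← triangulate]
      rw [← sub_eq_zero] at this ⊢
      rw [← this]
      abel
    · rw [path, if_neg h1, if_pos (by omega)]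
      simp

/-- The contracting homotopy on lattice steps. A step in the second direction needs no filling,
because the chosen path to its end runs through it. -/
theorem bdry_contract_add {p q : ℤ × ℤ} {z : Simp k 2}
    (hz : z ∈ EdgeCar k N p q) :
    bdry k 2 (triangulate k (contract k N p z)) + pathFrom k N p (bdry k 1 z) = z := by
  induction hz using Submodule.span_induction with
  | mem z h =>
    obtain ⟨r, hr, -, ⟨h1, h2, rfl⟩ | ⟨h1, h2, rfl⟩⟩ := h
    · rw [contract_edge_west, bdry_edge, map_sub]
      simpa [pathFrom] using bdry_fill hr h1 h2
    · rw [contract_edge_south, bdry_edge, map_sub]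
      simp only [Strip, le_iff, south] at hr h1 h2
      simp [pathFrom, path_of_south (k := k) (N := N) (p := p) (q := r) (by omega)]
  | zero => simp
  | add x y _ _ hx hy =>
    simp only [map_add]
    rw [add_add_add_comm, hx, hy]
  | smul c x _ hx =>
    simp only [map_smul, ← smul_add, hx]

/-- Of the four sides of a square only the two in the first direction contribute, and `fill` at `r`
and at `south r` differ by exactly the square `r`. Hence a chain of squares is determined by its
boundary. -/
theorem contract_bdry {p q : ℤ × ℤ} {z : (ℤ × ℤ) →₀ k} (hz : z ∈ SquareCar k N p q) :
    contract k N p (bdry k 2 (triangulate k z)) = z := by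
  rw [SquareCar, Finsupp.supported_eq_span_single] at hz
  induction hz using Submodule.span_induction with
  | mem x h =>
    obtain ⟨r, ⟨h1, h2, h3, h4, h5⟩, rfl⟩ := h
    simp only [triangulate, Finsupp.linearCombination_single, one_smul, bdry_square, map_add,
      map_sub, contract_edge_west, contract_edge_south]
    simp only [Strip, le_iff, west, south] at h1 h2 h3 h4 h5
    rw [fill, if_pos (by omega)]
    simp
  | zero => simp
  | add x y _ _ hx hy => simp only [map_add, hx, hy]
  | smul c x _ hx => simp only [map_smul, hx]

theorem fill_mem {p q : ℤ × ℤ} (hq : Strip N q) (hq' : Strip N (west q))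
    (hpq : p ≤ west q) : fill k N p q ∈ SquareCar k N p q := by
  induction hm : (q.2 - p.2).toNat using Nat.strong_induction_on generalizing q with
  | _ m ih =>
    simp only [Strip, le_iff, west] at hq hq' hpq
    rw [fill]
    split_ifs with h1
    · refine add_mem (Finsupp.single_mem_supported k _ ⟨hq, hq', ?_, ?_, le_rfl⟩) ?_
      · simp only [Strip, south]; omega
      · simp only [le_iff, west, south]; omega
      · have := ih (q := south q) _ (by simp only [south]; omega)
          (by simp only [Strip, south]; omega)
          (by simp only [Strip, west, south]; omega) (by simp only [le_iff, west, south]; omega) rfl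
        refine Finsupp.supported_mono ?_ this
        rintro r ⟨h2, h3, h4, h5, h6⟩
        refine ⟨h2, h3, h4, h5, h6.trans ?_⟩
        simp only [le_iff, south]; omega
    · exact zero_mem _

theorem contract_mem {p q : ℤ × ℤ} {z : Simp k 2} (hz : z ∈ EdgeCar k N p q) :
    contract k N p z ∈ SquareCar k N p q := by
  induction hz using Submodule.span_induction with
  | mem z h =>
    obtain ⟨r, hr, h0, ⟨h1, h2, rfl⟩ | ⟨h1, h2, rfl⟩⟩ := h
    · rw [contract_edge_west]
      refine Finsupp.supported_mono ?_ (fill_mem hr h1 h2)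
      rintro r ⟨h2, h3, h4, h5, h6⟩
      exact ⟨h2, h3, h4, h5, h6.trans h0⟩
    · rw [contract_edge_south]
      exact zero_mem _
  | zero => simp
  | add x y _ _ hx hy => rw [map_add]; exact add_mem hx hy
  | smul c x _ hx => rw [map_smul]; exact Submodule.smul_mem _ _ hx

theorem EdgeCar.le_car {p q : ℤ × ℤ} : EdgeCar k N p q ≤ Car k N 2 p q := by
  refine Submodule.span_le.2 ?_
  rintro z ⟨r, h1, h2, h3⟩
  have key : ∀ r', Strip N r' → r' ≤ r → p ≤ r' → edge k r' r ∈ Car k N 2 p q := by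
    intro r' h4 h5 h6
    refine Car.single_mem ⟨?_, ?_⟩ ?_ _
    · intro s t hst
      fin_cases s <;> fin_cases t <;> simp_all
    · intro t
      fin_cases t <;> simp_all
    · intro t
      fin_cases t
      · exact ⟨h6, h5.trans h2⟩
      · exact ⟨h6.trans h5, h2⟩
  rcases h3 with ⟨h3, h4, rfl⟩ | ⟨h3, h4, rfl⟩
  · exact key _ h3 (by simp only [le_iff, west]; omega) h4
  · exact key _ h3 (by simp only [le_iff, south]; omega) h4

theorem triangulate_mem {p q : ℤ × ℤ} {z : (ℤ × ℤ) →₀ k} (hz : z ∈ SquareCar k N p q) :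
    triangulate k z ∈ Car k N 3 p q := by
  rw [SquareCar, Finsupp.supported_eq_span_single] at hz
  induction hz using Submodule.span_induction with
  | mem x h =>
    obtain ⟨r, ⟨h1, h2, h3, h4, h5⟩, rfl⟩ := h
    have key : ∀ r', Strip N r' → r' ≤ r → south (west r) ≤ r' →
        (single ![south (west r), r', r] 1 : Simp k 3) ∈ Car k N 3 p q := by
      intro r' h6 h7 h8
      have h9 : Strip N (south (west r)) := by
        simp only [Strip, south, west] at h1 ⊢
        omega
      refine Car.single_mem ⟨?_, ?_⟩ ?_ _
      · intro s t hst
        fin_cases s <;> fin_cases t <;> first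
          | exact le_rfl
          | exact h7
          | exact h8
          | exact h8.trans h7
          | simp at hst
      · intro t
        fin_cases t
        · exact h9
        · exact h6
        · exact h1
      · intro t
        fin_cases t
        · exact ⟨h4, (h8.trans h7).trans h5⟩
        · exact ⟨h4.trans h8, h7.trans h5⟩
        · exact ⟨(h4.trans h8).trans h7, h5⟩
    rw [triangulate, Finsupp.linearCombination_single, one_smul, square]
    refine sub_mem (key _ h2 ?_ ?_) (key _ h3 ?_ ?_) <;> simp only [le_iff, south, west] <;> omega
  | zero => simp
  | add x y _ _ hx hy => rw [map_add]; exact add_mem hx hy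
  | smul c x _ hx => rw [map_smul]; exact Submodule.smul_mem _ _ hx

theorem straighten_edge (p q : ℤ × ℤ) : straighten k N (edge k p q) = path k N p q := by
  simp [straighten, edge]

theorem straighten_mem (hN : 0 < N) {p q : ℤ × ℤ} {x : Simp k 2} (hx : x ∈ Car k N 2 p q) :
    straighten k N x ∈ EdgeCar k N p q := by
  refine Car.map_mem _ _ (fun σ h h' => ?_) hx
  rw [straighten, Finsupp.linearCombination_single, one_smul]
  exact EdgeCar.mono (h' 0).1 (h' 1).2
    (path_mem hN (h.2 0) (h.2 1) (h.1 (by decide : (0 : Fin 2) ≤ 1)))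

theorem bdry_straighten (hN : 0 < N) {p q : ℤ × ℤ} {x : Simp k 2} (hx : x ∈ Car k N 2 p q) :
    bdry k 1 (straighten k N x) = bdry k 1 x := by
  refine Car.congr (bdry k 1 ∘ₗ straighten k N) (bdry k 1) (fun σ h h' => ?_) hx
  have hσ : σ = ![σ 0, σ 1] := by
    funext t; fin_cases t <;> rfl
  rw [hσ, LinearMap.comp_apply, ← edge, straighten_edge, bdry_edge,
    bdry_path (h.2 0) (h.2 1) (h.1 (by decide : (0 : Fin 2) ≤ 1)) hN]

theorem SquareCar.mono {p q p' q' : ℤ × ℤ} (hp : p' ≤ p) (hq : q ≤ q') :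
    SquareCar k N p q ≤ SquareCar k N p' q' := by
  refine Finsupp.supported_mono ?_
  rintro r ⟨h1, h2, h3, h4, h5⟩
  exact ⟨h1, h2, h3, hp.trans h4, h5.trans hq⟩

theorem tile_mem (hN : 0 < N) {p q : ℤ × ℤ} {x : Simp k 3} (hx : x ∈ Car k N 3 p q) :
    tile k N x ∈ SquareCar k N p q := by
  refine Car.map_mem _ _ (fun σ h h' => ?_) hx
  rw [tile, Finsupp.linearCombination_single, one_smul]
  exact SquareCar.mono (h' 0).1 (h' (Fin.last 2)).2
    (contract_mem (straighten_mem hN (Car.bdry_mem (Car.self_mem h))))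

/-- The straightened boundary of a triangle is a cycle, so the path term in `bdry_contract_add`
vanishes. -/
theorem bdry_tile (hN : 0 < N) {p q : ℤ × ℤ} {x : Simp k 3} (hx : x ∈ Car k N 3 p q) :
    bdry k 2 (triangulate k (tile k N x)) = straighten k N (bdry k 2 x) := by
  refine Car.congr (bdry k 2 ∘ₗ triangulate k ∘ₗ tile k N) (straighten k N ∘ₗ bdry k 2)
    (fun σ h h' => ?_) hx
  have h1 := Car.bdry_mem (Car.self_mem (k := k) h)
  have := bdry_contract_add (straighten_mem hN h1)
  rw [bdry_straighten hN h1, bdry_bdry, map_zero, add_zero] at this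
  simpa [tile] using this

/-- The squares that tile the boundary of a tetrahedron form a cycle, and by `contract_bdry` a cycle
of squares is zero. Thus `cellular` may vanish in all higher degrees. -/
theorem tile_bdry (hN : 0 < N) {p q : ℤ × ℤ} {x : Simp k 4} (hx : x ∈ Car k N 4 p q) :
    tile k N (bdry k 3 x) = 0 := by
  have h := Car.bdry_mem hx
  rw [← contract_bdry (tile_mem hN h), bdry_tile hN h, bdry_bdry, map_zero, map_zero]

end Paths

end
end KLRW

namespace KLRW
open Finsupp
noncomputable section

/-! ### The homotopy between simplices and lattice cells -/

section Homotopy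

variable (k : Type*) [Field k] (N : ℕ)

/-- Translation of squares. -/
def shiftSquare : ((ℤ × ℤ) →₀ k) →ₗ[k] ((ℤ × ℤ) →₀ k) := Finsupp.lmapDomain k k tau

/-- Replacing simplices by lattice cells. -/
def cellular : (n : ℕ) → Simp k n →ₗ[k] Simp k n
  | 0 => LinearMap.id
  | 1 => LinearMap.id
  | 2 => straighten k N
  | 3 => triangulate k ∘ₗ tile k N
  | _ + 4 => 0

/-- The homotopy between the identity and `cellular`. -/
def homotopy : (n : ℕ) → Simp k n →ₗ[k] Simp k (n + 1)
  | 0 => 0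
  | n + 1 => Finsupp.linearCombination k fun σ =>
      cone k (n + 1) (σ 0) (single σ 1 - cellular k N (n + 1) (single σ 1)
        - homotopy n (bdry k n (single σ 1)))

variable {k N}

theorem tau_west (q : ℤ × ℤ) : tau (west q) = west (tau q) := by
  ext <;> simp [tau, west]

theorem tau_south (q : ℤ × ℤ) : tau (south q) = south (tau q) := by
  ext <;> simp [tau, south]

theorem tau_injective : Function.Injective tau := fun _ _ h => add_right_cancel h

theorem shift_edge (r q : ℤ × ℤ) : shift k 2 (edge k r q) = edge k (tau r) (tau q) := by
  rw [edge, shift_single, edge]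
  congr 1
  funext t
  fin_cases t <;> rfl

theorem path_tau (p q : ℤ × ℤ) : path k N (tau p) (tau q) = shift k 2 (path k N p q) := by
  induction hm : (q.1 - p.1).toNat + (q.2 - p.2).toNat using Nat.strong_induction_on
    generalizing q with
  | _ m ih =>
    rw [path, path.eq_1 k N p q]
    have e1 : ((tau p).2 < (tau q).2 ∧ (tau q).1 - (tau q).2 < N) ↔
        (p.2 < q.2 ∧ q.1 - q.2 < N) := by simp [tau]
    have e2 : (tau p).1 < (tau q).1 ↔ p.1 < q.1 := by simp [tau]
    simp only [e1, e2]
    split_ifs with h1 h2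
    · rw [map_add, shift_edge, tau_south, ← tau_south, ih _ ?_ (south q) rfl]
      simp only [south]
      omega
    · rw [map_add, shift_edge, tau_west, ← tau_west, ih _ ?_ (west q) rfl]
      simp only [west]
      omega
    · simp

theorem fill_tau (p q : ℤ × ℤ) : fill k N (tau p) (tau q) = shiftSquare k (fill k N p q) := by
  induction hm : (q.2 - p.2).toNat using Nat.strong_induction_on generalizing q with
  | _ m ih =>
    rw [fill, fill.eq_1 k N p q]
    have e1 : ((tau p).2 < (tau q).2 ∧ (tau q).1 - (tau q).2 < N) ↔
        (p.2 < q.2 ∧ q.1 - q.2 < N) := by simp [tau]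
    simp only [e1]
    split_ifs with h1
    · rw [map_add, ← tau_south, ih _ ?_ (south q) rfl]
      · simp [shiftSquare]
      · simp only [south]
        omega
    · simp

theorem triangulate_shift (z : (ℤ × ℤ) →₀ k) :
    triangulate k (shiftSquare k z) = shift k 3 (triangulate k z) := by
  suffices h : triangulate k ∘ₗ shiftSquare k = shift k 3 ∘ₗ triangulate k from
    LinearMap.congr_fun h z
  ext1 q
  ext1
  simp only [LinearMap.comp_apply, Finsupp.lsingle_apply, shiftSquare, Finsupp.lmapDomain_apply,
    Finsupp.mapDomain_single, triangulate, Finsupp.linearCombination_single, one_smul, square,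
    map_sub, shift_single, ← tau_west, ← tau_south]
  congr 2 <;> · funext t; fin_cases t <;> rfl

theorem contract_shift (p : ℤ × ℤ) (z : Simp k 2) :
    contract k N (tau p) (shift k 2 z) = shiftSquare k (contract k N p z) := by
  suffices h : contract k N (tau p) ∘ₗ shift k 2 = shiftSquare k ∘ₗ contract k N p from
    LinearMap.congr_fun h z
  ext1 σ
  ext1
  simp only [LinearMap.comp_apply, Finsupp.lsingle_apply, contract, shift_single,
    Finsupp.linearCombination_single, one_smul, Function.comp, ← tau_west, tau_injective.eq_iff,
    fill_tau]
  split_ifs <;> simp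

theorem straighten_shift (z : Simp k 2) :
    straighten k N (shift k 2 z) = shift k 2 (straighten k N z) := by
  suffices h : straighten k N ∘ₗ shift k 2 = shift k 2 ∘ₗ straighten k N from
    LinearMap.congr_fun h z
  ext1 σ
  ext1
  simp only [LinearMap.comp_apply, Finsupp.lsingle_apply, straighten, shift_single,
    Finsupp.linearCombination_single, one_smul, Function.comp, path_tau]

theorem tile_shift (z : Simp k 3) : tile k N (shift k 3 z) = shiftSquare k (tile k N z) := by
  suffices h : tile k N ∘ₗ shift k 3 = shiftSquare k ∘ₗ tile k N from LinearMap.congr_fun h z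
  ext1 σ
  ext1
  simp only [LinearMap.comp_apply, Finsupp.lsingle_apply, tile, shift_single,
    Finsupp.linearCombination_single, one_smul]
  rw [← shift_single, bdry_shift, straighten_shift, Function.comp_apply, contract_shift]

theorem cellular_shift {n : ℕ} (x : Simp k n) :
    cellular k N n (shift k n x) = shift k n (cellular k N n x) := by
  match n with
  | 0 => rfl
  | 1 => rfl
  | 2 => exact straighten_shift x
  | 3 =>
    simp only [cellular, LinearMap.comp_apply]
    rw [tile_shift, triangulate_shift]
  | n + 4 => simp [cellular]

/-- Cochains are functions on `tau`-orbits, so the homotopy acts on them only because it is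
equivariant: the vertex of each cone is translated along with the simplex. -/
theorem homotopy_shift {n : ℕ} (x : Simp k n) :
    homotopy k N n (shift k n x) = shift k (n + 1) (homotopy k N n x) := by
  induction n with
  | zero => simp [homotopy]
  | succ n ih =>
    suffices h : homotopy k N (n + 1) ∘ₗ shift k (n + 1) =
        shift k (n + 2) ∘ₗ homotopy k N (n + 1) from LinearMap.congr_fun h x
    ext1 σ
    ext1
    simp only [LinearMap.comp_apply, Finsupp.lsingle_apply, homotopy, shift_single,
      Finsupp.linearCombination_single, one_smul]
    rw [← shift_single, bdry_shift, cellular_shift, ih, Function.comp_apply, ← map_sub, ← map_sub,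
      cone_shift]

theorem cellular_mem (hN : 0 < N) {n : ℕ} {p q : ℤ × ℤ} {x : Simp k n} (hx : x ∈ Car k N n p q) :
    cellular k N n x ∈ Car k N n p q := by
  match n with
  | 0 => exact hx
  | 1 => exact hx
  | 2 => exact EdgeCar.le_car (straighten_mem hN hx)
  | 3 => exact triangulate_mem (tile_mem hN hx)
  | n + 4 => simp [cellular]

theorem bdry_cellular (hN : 0 < N) {n : ℕ} {p q : ℤ × ℤ} {x : Simp k (n + 1)}
    (hx : x ∈ Car k N (n + 1) p q) :
    bdry k n (cellular k N (n + 1) x) = cellular k N n (bdry k n x) := by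
  match n with
  | 0 => rfl
  | 1 => exact bdry_straighten hN hx
  | 2 => exact bdry_tile hN hx
  | 3 => simp [cellular, tile_bdry hN hx]
  | n + 4 => simp [cellular]

/-- The vertex of the cone is the first vertex of the simplex itself, so the construction never
leaves the interval spanned by the simplex. This keeps the allowed relative exponents under control.
-/
theorem homotopy_mem (hN : 0 < N) {n : ℕ} {p q : ℤ × ℤ} {x : Simp k n} (hx : x ∈ Car k N n p q) :
    homotopy k N n x ∈ Car k N (n + 1) p q := by
  induction n generalizing p q with
  | zero => simp [homotopy]
  | succ n ih =>
    refine Car.map_mem _ _ (fun σ h h' => ?_) hx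
    rw [homotopy, Finsupp.linearCombination_single, one_smul]
    refine Car.mono (h' 0).1 (h' (Fin.last n)).2 (Car.cone_mem (h.2 0) h.zero_le_last ?_)
    have := Car.self_mem (k := k) h
    exact sub_mem (sub_mem this (cellular_mem hN this)) (ih (Car.bdry_mem this))

/-- The chain that is coned off is a cycle, by induction and because `cellular` is a chain map, so
the boundary of its cone is the chain itself. -/
theorem bdry_homotopy (hN : 0 < N) {n : ℕ} {p q : ℤ × ℤ} {x : Simp k (n + 1)}
    (hx : x ∈ Car k N (n + 1) p q) :
    bdry k (n + 1) (homotopy k N (n + 1) x) =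
      x - cellular k N (n + 1) x - homotopy k N n (bdry k n x) := by
  induction n generalizing p q with
  | zero =>
    refine Car.congr (bdry k 1 ∘ₗ homotopy k N 1)
      (LinearMap.id - cellular k N 1 - homotopy k N 0 ∘ₗ bdry k 0) (fun σ h h' => ?_) hx
    simp [homotopy, cellular]
  | succ n ih =>
    refine Car.congr (bdry k (n + 2) ∘ₗ homotopy k N (n + 2))
      (LinearMap.id - cellular k N (n + 2) - homotopy k N (n + 1) ∘ₗ bdry k (n + 1))
      (fun σ h h' => ?_) hx
    simp only [LinearMap.comp_apply, LinearMap.sub_apply, LinearMap.id_apply]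
    rw [homotopy, Finsupp.linearCombination_single, one_smul]
    have hc := bdry_cone_add (σ 0) (single σ 1 - cellular k N (n + 2) (single σ 1)
      - homotopy k N (n + 1) (bdry k (n + 1) (single σ 1)))
    have hσ := Car.self_mem (k := k) h
    have h0 : bdry k (n + 1) (single σ 1 - cellular k N (n + 2) (single σ 1)
        - homotopy k N (n + 1) (bdry k (n + 1) (single σ 1))) = 0 := by
      rw [map_sub, map_sub, bdry_cellular hN hσ, ih (Car.bdry_mem hσ), bdry_bdry]
      simp
    rw [h0, map_zero, add_zero] at hc
    exact hc

end Homotopy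

end
end KLRW

namespace KLRW
open Finsupp
noncomputable section

/-! ### Hochschild cochains as functions on simplices -/

section Evaluation

variable {k : Type*} [Field k] {N : ℕ} {i : Fin (N + 1)}

/-- The position of a point of the strip. -/
def pos (N : ℕ) (p : ℤ × ℤ) : Fin (N + 1) := ⟨min (p.1 - p.2).toNat N, by omega⟩

theorem pos_val {p : ℤ × ℤ} (h : Strip N p) : ((pos N p : ℕ) : ℤ) = p.1 - p.2 := by
  unfold Strip at h
  simp only [pos]
  omega

/-- The number of dots of the morphism which corresponds to `p ≤ q`. -/
def wt (p q : ℤ × ℤ) : ℤ := min (q.1 - p.1) (q.2 - p.2)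

theorem wt_nonneg {p q : ℤ × ℤ} (h : p ≤ q) : 0 ≤ wt p q := by
  rw [le_iff] at h
  unfold wt
  omega

/-- Twice a minimum is the sum minus the distance of its two entries. The sums are additive, and the
distances are differences of positions, whose triangle defect is twice `delta`. -/
theorem wt_add {p q r : ℤ × ℤ} (hp : Strip N p) (hq : Strip N q) (hr : Strip N r) :
    wt p r = wt p q + wt q r + delta (pos N p) (pos N q) (pos N r) := by
  have h := two_mul_delta (pos N p) (pos N q) (pos N r)
  rw [pos_val hp, pos_val hq, pos_val hr] at h
  unfold wt
  omega

/-- The objects of the chain of morphisms which corresponds to a simplex. -/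
def objs (N : ℕ) {n : ℕ} (σ : Fin (n + 1) → ℤ × ℤ) : Fin (n + 1) → Fin (N + 1) :=
  fun t => pos N (σ t)

/-- The exponents of the chain of morphisms which corresponds to a simplex. -/
def exps {n : ℕ} (σ : Fin (n + 1) → ℤ × ℤ) : Fin n → ℕ :=
  fun t => (wt (σ t.castSucc) (σ t.succ)).toNat

/-- The value of a cochain on a simplex, relative to the composite of the chain. -/
def value {n : ℕ} (φ : HFun k N i n) (σ : Fin (n + 1) → ℤ × ℤ) : ℤ →₀ k :=
  mapDomain (fun e : ℕ => (e : ℤ) - wt (σ 0) (σ (Fin.last n)))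
    (Bim.forget k N i (φ (objs N σ) (monomials k (exps σ))))

/-- The evaluation of a cochain on simplices, linearly extended. -/
def eval {n : ℕ} (φ : HFun k N i n) : Simp k (n + 1) →ₗ[k] (ℤ →₀ k) :=
  Finsupp.linearCombination k (value φ)

theorem eval_single {n : ℕ} (φ : HFun k N i n) (σ : Fin (n + 1) → ℤ × ℤ) :
    eval φ (single σ 1) = value φ σ := by
  simp [eval]

theorem eval_add {n : ℕ} (φ ψ : HFun k N i n) (x : Simp k (n + 1)) :
    eval (φ + ψ) x = eval φ x + eval ψ x := by
  suffices h : eval (φ + ψ) = eval φ + eval ψ from LinearMap.congr_fun h x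
  ext1 σ
  ext1
  simp [eval_single, value, Finsupp.mapDomain_add]

/-- The relative values which are possible for chains from `p` to `q`. -/
def Filt (k : Type*) [Field k] (i : Fin (N + 1)) (p q : ℤ × ℤ) : Submodule k (ℤ →₀ k) :=
  Finsupp.supported k k {r | p ≤ q + (r, r) ∧ (p.1 - p.2 = i → p ≠ q + (r, r))}

/-- The excluded exponent causes no trouble: if `p' = q' + (r, r)`, then `p' ≤ p ≤ q + (r, r) ≤ q' +
(r, r)` are all equalities, so `r` was already excluded for the smaller interval. In terms of `C`,
the image of the bimodule is an ideal. -/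
theorem Filt.mono {p q p' q' : ℤ × ℤ} (hp : p' ≤ p) (hq : q ≤ q') :
    Filt k i p q ≤ Filt k i p' q' := by
  refine Finsupp.supported_mono ?_
  rintro r ⟨h1, h2⟩
  simp only [le_iff, Prod.fst_add, Prod.snd_add, Set.mem_ofPred_eq, ne_eq, Prod.ext_iff] at *
  omega

theorem forget_hDiff {n : ℕ} {φ : HFun k N i n}
    (hφ : ∀ X a, φ X a ∈ Bim.part k N i (X 0) (X (Fin.last n)))
    (X : Fin (n + 2) → Fin (N + 1)) (a : Fin (n + 1) → H k) :
    Bim.forget k N i (hDiff k N i n φ X a) =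
      comp k (X 0) (X 1) (X (Fin.last (n + 1)))
        (Bim.forget k N i (φ (Fin.tail X) (Fin.tail a))) (a 0)
      + ∑ t : Fin n, (-1 : k) ^ ((t : ℕ) + 1) •
          Bim.forget k N i (φ (mergeObj t X) (mergeHom t X a))
      + (-1 : k) ^ (n + 1) • comp k (X 0) (X (Fin.last n).castSucc) (X (Fin.last (n + 1)))
          (a (Fin.last n)) (Bim.forget k N i (φ (Fin.init X) (Fin.init a))) := by
  have h1 := Bim.forget_ract (X 0) (a 0) (hφ (Fin.tail X) (Fin.tail a))
  have h2 := Bim.forget_lact (X (Fin.last (n + 1))) (a (Fin.last n))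
    (hφ (Fin.init X) (Fin.init a))
  have h3 : hDiff k N i n φ X a = Bim.ract k N i (X 0) (a 0) (φ (Fin.tail X) (Fin.tail a))
    + ∑ t : Fin n, (-1 : k) ^ ((t : ℕ) + 1) • φ (mergeObj t X) (mergeHom t X a)
    + (-1 : k) ^ (n + 1) •
        Bim.lact k N i (X (Fin.last (n + 1))) (a (Fin.last n)) (φ (Fin.init X) (Fin.init a)) := rfl
  rw [h3, map_add, map_add, map_sum, map_smul, h1, h2]
  simp only [map_smul]
  rfl

theorem mergeObj_zero {n : ℕ} (t : Fin n) (X : Fin (n + 2) → Fin (N + 1)) :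
    mergeObj t X 0 = X 0 := by
  simp only [mergeObj]
  congr 1

theorem mergeObj_last {n : ℕ} (t : Fin n) (X : Fin (n + 2) → Fin (N + 1)) :
    mergeObj t X (Fin.last n) = X (Fin.last (n + 1)) := by
  simp only [mergeObj]
  rw [Fin.succAbove_of_le_castSucc _ _ (by
      simp only [Fin.le_def, Fin.val_castSucc, Fin.val_succ, Fin.val_last]
      omega), Fin.succ_last]

theorem HCochain.apply_mem {n : ℕ} {φ : HFun k N i n} (hφ : φ ∈ HCochain k N i n)
    (X : Fin (n + 1) → Fin (N + 1)) (a : Fin n → H k) :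
    φ X a ∈ Bim.part k N i (X 0) (X (Fin.last n)) := (hφ X).2 a

theorem hDiff_mem {n : ℕ} {φ : HFun k N i n} (hφ : φ ∈ HCochain k N i n) :
    hDiff k N i n φ ∈ HCochain k N i (n + 1) := by
  intro X
  constructor
  · have h : ∀ X, IsMultilin (φ X) := fun X => (hφ X).1
    exact ((IsMultilin.tail (Bim.ract k N i (X 0)) (h (Fin.tail X))).add
      (IsMultilin.sum _ fun t => ((h (mergeObj t X)).merge t X).smul _)).add
      ((IsMultilin.init (Bim.lact k N i (X (Fin.last (n + 1)))) (h (Fin.init X))).smul _)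
  · intro a
    refine add_mem (add_mem ?_ (sum_mem fun t _ => Submodule.smul_mem _ _ ?_))
      (Submodule.smul_mem _ _ ?_)
    · exact Bim.ract_mem _ _ (HCochain.apply_mem hφ (Fin.tail X) (Fin.tail a))
    · have := HCochain.apply_mem hφ (mergeObj t X) (mergeHom t X a)
      rwa [mergeObj_zero, mergeObj_last] at this
    · exact Bim.lact_mem _ _ (HCochain.apply_mem hφ (Fin.init X) (Fin.init a))

theorem monomials_merge {n : ℕ} (t : Fin n) {σ : Fin (n + 2) → ℤ × ℤ} (h : Good N σ) :
    mergeHom t (objs N σ) (monomials k (exps σ)) =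
      monomials k (exps (Fin.removeNth (α := fun _ => ℤ × ℤ) t.succ.castSucc σ)) := by
  funext r
  simp only [mergeHom, Fin.contractNth, monomials, exps, Fin.removeNth, Fin.val_castSucc]
  rcases lt_trichotomy (r : ℕ) t with h' | h' | h'
  · rw [if_pos h', Fin.succAbove_of_castSucc_lt _ _ (by
        simp only [Fin.lt_def, Fin.val_castSucc, Fin.val_succ]
        omega),
      Fin.succAbove_of_castSucc_lt _ _ (by
          simp only [Fin.lt_def, Fin.val_castSucc, Fin.val_succ]
          omega)]
    rfl
  · obtain rfl : r = t := Fin.ext h'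
    rw [if_neg (lt_irrefl _), if_pos rfl,
      Fin.succAbove_of_castSucc_lt _ _ (by
          simp only [Fin.lt_def, Fin.val_castSucc, Fin.val_succ]
          omega),
      Fin.succAbove_of_le_castSucc _ _ (by
          simp only [Fin.le_def, Fin.val_castSucc, Fin.val_succ]
          omega)]
    rw [comp, conv_single_single, mul_one]
    congr 1
    have h1 := wt_add (h.2 r.castSucc.castSucc) (h.2 r.succ.castSucc) (h.2 r.succ.succ)
    have h2 : σ r.castSucc.castSucc ≤ σ r.succ.castSucc := h.1 (by
        simp only [Fin.le_def, Fin.val_castSucc, Fin.val_succ]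
        omega)
    have h3 : σ r.succ.castSucc ≤ σ r.succ.succ := h.1 (by
        simp only [Fin.le_def, Fin.val_castSucc, Fin.val_succ]
        omega)
    have h4 := wt_nonneg h2
    have h5 := wt_nonneg h3
    simp only [objs, Fin.succ_castSucc] at *
    omega
  · rw [if_neg (by omega), if_neg (by omega),
      Fin.succAbove_of_le_castSucc _ _ (by
          simp only [Fin.le_def, Fin.val_castSucc, Fin.val_succ]
          omega),
      Fin.succAbove_of_le_castSucc _ _ (by
          simp only [Fin.le_def, Fin.val_castSucc, Fin.val_succ]
          omega)]
    rfl

/-- For an outer face, acting by the omitted morphism raises the exponent by exactly the difference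
of the weights of the two composites, by `wt_add`, so the relative exponent does not change. The
inner faces are compositions. -/
theorem value_hDiff {n : ℕ} {φ : HFun k N i n}
    (hφ : φ ∈ HCochain k N i n) {σ : Fin (n + 2) → ℤ × ℤ} (h : Good N σ) :
    value (hDiff k N i n φ) σ = eval φ (bdry k (n + 1) (single σ 1)) := by
  rw [bdry_single, map_sum, Fin.sum_univ_succ, Fin.sum_univ_castSucc]
  simp only [map_smul, eval_single]
  rw [value, forget_hDiff (HCochain.apply_mem hφ)]
  rw [Finsupp.mapDomain_add, Finsupp.mapDomain_add, add_assoc]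
  have hfirst : mapDomain (fun e : ℕ => (e : ℤ) - wt (σ 0) (σ (Fin.last (n + 1))))
      (comp k (objs N σ 0) (objs N σ 1) (objs N σ (Fin.last (n + 1)))
        (Bim.forget k N i (φ (Fin.tail (objs N σ)) (Fin.tail (monomials k (exps σ)))))
        (monomials k (exps σ) 0)) = value φ (Fin.removeNth (α := fun _ => ℤ × ℤ) 0 σ) := by
    rw [comp, conv_comm, monomials, conv_single_left, ← Finsupp.mapDomain_comp, value]
    refine congrArg₂ _ ?_ rfl
    funext α
    have h1 := wt_add (h.2 0) (h.2 1) (h.2 (Fin.last (n + 1)))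
    have h2 := wt_nonneg (h.1 (Fin.zero_le 1))
    simp only [Function.comp, Fin.removeNth_zero, exps, objs] at *
    have e1 : Fin.tail σ (0 : Fin (n + 1)) = σ 1 := rfl
    have e2 : Fin.tail σ (Fin.last n) = σ (Fin.last (n + 1)) := rfl
    have e3 : σ (Fin.castSucc 0) = σ 0 := rfl
    have e4 : σ (Fin.succ 0) = σ 1 := rfl
    rw [e1, e2, e3, e4]
    omega
  have hlast : mapDomain (fun e : ℕ => (e : ℤ) - wt (σ 0) (σ (Fin.last (n + 1))))
      (comp k (objs N σ 0) (objs N σ (Fin.last n).castSucc) (objs N σ (Fin.last (n + 1)))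
        (monomials k (exps σ) (Fin.last n))
        (Bim.forget k N i (φ (Fin.init (objs N σ)) (Fin.init (monomials k (exps σ)))))) =
        value φ (Fin.removeNth (α := fun _ => ℤ × ℤ) (Fin.last (n + 1)) σ) := by
    rw [comp, monomials, conv_single_left, ← Finsupp.mapDomain_comp, value]
    rw [Fin.removeNth_last]
    refine congrArg₂ _ ?_ rfl
    funext α
    have h1 := wt_add (h.2 0) (h.2 (Fin.last n).castSucc) (h.2 (Fin.last (n + 1)))
    have h2 : 0 ≤ wt (σ (Fin.last n).castSucc) (σ (Fin.last (n + 1))) :=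
      wt_nonneg (h.1 (Fin.castSucc_le_succ (Fin.last n)))
    simp only [Function.comp, exps, objs] at *
    have e1 : Fin.init σ (0 : Fin (n + 1)) = σ 0 := rfl
    have e2 : Fin.init σ (Fin.last n) = σ (Fin.last n).castSucc := rfl
    have e3 : σ (Fin.last n).succ = σ (Fin.last (n + 1)) := rfl
    rw [e1, e2, e3] at *
    omega
  rw [hfirst, Finsupp.mapDomain_smul, hlast, Finsupp.mapDomain_finsetSum]
  refine congrArg₂ _ (by simp) (congrArg₂ _ ?_ (by simp))
  refine Finset.sum_congr rfl fun t _ => ?_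
  rw [Finsupp.mapDomain_smul, monomials_merge t h]
  have e0 : t.castSucc.succ = t.succ.castSucc := rfl
  simp only [Fin.val_succ, Fin.val_castSucc, e0]
  refine congrArg _ ?_
  have e1 : Fin.removeNth (α := fun _ => ℤ × ℤ) t.succ.castSucc σ 0 = σ 0 := by
    simp only [Fin.removeNth]
    congr 1
  have e2 : Fin.removeNth (α := fun _ => ℤ × ℤ) t.succ.castSucc σ (Fin.last n) =
      σ (Fin.last (n + 1)) := by
    simp only [Fin.removeNth]
    rw [Fin.succAbove_of_le_castSucc _ _ (by
        simp only [Fin.le_def, Fin.val_castSucc, Fin.val_succ, Fin.val_last]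
        omega), Fin.succ_last]
  rw [value, e1, e2]
  rfl

theorem eval_hDiff {n : ℕ} {φ : HFun k N i n} (hφ : φ ∈ HCochain k N i n) {p q : ℤ × ℤ}
    {x : Simp k (n + 2)} (hx : x ∈ Car k N (n + 2) p q) :
    eval (hDiff k N i n φ) x = eval φ (bdry k (n + 1) x) :=
  Car.congr (eval (hDiff k N i n φ)) (eval φ ∘ₗ bdry k (n + 1))
    (fun σ h _ => by rw [eval_single, value_hDiff hφ h]; rfl) hx

/-- For `e = r + wt p q` the condition `p ≤ q + (r, r)` says that `e` is nonnegative, and `p = q +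
(r, r)` says that `e` is zero and both ends have the same position. -/
theorem value_mem {n : ℕ} {φ : HFun k N i n} (hφ : φ ∈ HCochain k N i n)
    {σ : Fin (n + 1) → ℤ × ℤ} (h : Good N σ) :
    value φ σ ∈ Filt k i (σ 0) (σ (Fin.last n)) := by
  have h0 := Bim.forget_mem (HCochain.apply_mem hφ (objs N σ) (monomials k (exps σ)))
  rw [Filt, Finsupp.mem_supported]
  intro r hr
  obtain ⟨e, he, rfl⟩ := Finset.mem_image.1 (Finsupp.mapDomain_support hr)
  have h1 := h.2 0
  have h2 := h.2 (Fin.last n)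
  have h3 := pos_val h1
  have h4 := pos_val h2
  have h5 : e = 0 → pos N (σ 0) = i → pos N (σ (Fin.last n)) = i → False := by
    intro e0 e1 e2
    rw [Finsupp.mem_support_iff, e0] at he
    exact he (h0 e1 e2)
  rw [Fin.ext_iff, Fin.ext_iff] at h5
  simp only [le_iff, Prod.fst_add, Prod.snd_add, Set.mem_ofPred_eq, ne_eq, Prod.ext_iff, wt]
  exact ⟨by omega, fun e1 e2 => h5 (by omega) (by omega) (by omega)⟩

theorem eval_mem {n : ℕ} {φ : HFun k N i n} (hφ : φ ∈ HCochain k N i n) {p q : ℤ × ℤ}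
    {x : Simp k (n + 1)} (hx : x ∈ Car k N (n + 1) p q) : eval φ x ∈ Filt k i p q :=
  Car.map_mem _ _ (fun σ h h' => by
    rw [eval_single]
    exact Filt.mono (h' 0).1 (h' (Fin.last n)).2 (value_mem hφ h)) hx

theorem eval_shift {n : ℕ} {φ : HFun k N i n} (x : Simp k (n + 1)) :
    eval φ (shift k (n + 1) x) = eval φ x := by
  suffices h : eval φ ∘ₗ shift k (n + 1) = eval φ from LinearMap.congr_fun h x
  ext1 σ
  ext1
  have h1 : objs N (tau ∘ σ) = objs N σ := by
    funext t
    simp [objs, pos, tau]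
  have h2 : ∀ p q, wt (tau p) (tau q) = wt p q := fun p q => by simp [wt, tau]
  have h3 : exps (tau ∘ σ) = exps σ := by
    funext t
    simp [exps, h2]
  simp only [LinearMap.comp_apply, Finsupp.lsingle_apply, shift_single, eval_single, value, h1, h3,
    Function.comp, h2]

/-- The simplex which corresponds to a chain of monomials. -/
def lift {n : ℕ} (X : Fin (n + 1) → Fin (N + 1)) (e : Fin n → ℕ) : Fin (n + 1) → ℤ × ℤ :=
  fun t =>
    let b : ℕ := Fin.partialSum (fun s : Fin n => e s + ((X s.castSucc : ℕ) - (X s.succ : ℕ))) t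
    ((X t : ℤ) + b, (b : ℤ))

theorem lift_strip {n : ℕ} (X : Fin (n + 1) → Fin (N + 1)) (e : Fin n → ℕ) (t : Fin (n + 1)) :
    Strip N (lift X e t) := by
  simp only [Strip, lift]
  omega

/-- The truncated difference in `lift` raises the second coordinate just enough when the position
falls. One of the two coordinates then grows by `e t` and the other by at least that much. -/
theorem lift_step {n : ℕ} (X : Fin (n + 1) → Fin (N + 1)) (e : Fin n → ℕ) (t : Fin n) :
    lift X e t.castSucc ≤ lift X e t.succ ∧ wt (lift X e t.castSucc) (lift X e t.succ) = e t := by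
  simp only [le_iff, wt, lift, Fin.partialSum_succ]
  push_cast
  omega

theorem lift_good {n : ℕ} (X : Fin (n + 1) → Fin (N + 1)) (e : Fin n → ℕ) : Good N (lift X e) :=
  ⟨Fin.monotone_iff_le_succ.2 fun t => (lift_step X e t).1, lift_strip X e⟩

theorem objs_lift {n : ℕ} (X : Fin (n + 1) → Fin (N + 1)) (e : Fin n → ℕ) :
    objs N (lift X e) = X := by
  funext t
  have := pos_val (lift_strip X e t)
  simp only [objs, Fin.ext_iff]
  simp only [lift] at this ⊢
  omega

theorem exps_lift {n : ℕ} (X : Fin (n + 1) → Fin (N + 1)) (e : Fin n → ℕ) :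
    exps (lift X e) = e := by
  funext t
  have := (lift_step X e t).2
  simp only [exps, this, Int.toNat_natCast]

/-- A simplex is recovered from its chain of monomials up to a diagonal translation; `lift` picks
the representative whose first vertex has second coordinate zero. -/
theorem lift_objs {n : ℕ} {σ : Fin (n + 1) → ℤ × ℤ} (h : Good N σ) (t : Fin (n + 1)) :
    σ t = lift (objs N σ) (exps σ) t + ((σ 0).2, (σ 0).2) := by
  induction t using Fin.induction with
  | zero =>
    have := pos_val (h.2 0)
    simp only [lift, Prod.ext_iff, Prod.fst_add, Prod.snd_add, Fin.partialSum_zero, objs] at *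
    omega
  | succ t ih =>
    have h1 := pos_val (h.2 t.castSucc)
    have h2 := pos_val (h.2 t.succ)
    have h3 : σ t.castSucc ≤ σ t.succ := h.1 (Fin.castSucc_le_succ t)
    simp only [lift, Prod.ext_iff, Prod.fst_add, Prod.snd_add, Fin.partialSum_succ, objs, exps,
      le_iff, wt] at *
    push_cast at *
    omega

/-- A cochain is determined by its values on the increasing sequences of points of the strip. -/
theorem HCochain.ext {n : ℕ} (hi : 0 < (i : ℕ)) {φ ψ : HFun k N i n} (hφ : φ ∈ HCochain k N i n)
    (hψ : ψ ∈ HCochain k N i n)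
    (h : ∀ σ, Good N σ → eval φ (single σ 1) = eval ψ (single σ 1)) : φ = ψ := by
  funext X
  refine IsMultilin.ext (hφ X).1 (hψ X).1 fun e => ?_
  have := h _ (lift_good X e)
  rw [eval_single, eval_single, value, value, objs_lift, exps_lift] at this
  refine Bim.forget_inj hi (HCochain.apply_mem hφ X _) (HCochain.apply_mem hψ X _)
    (Finsupp.mapDomain_injective ?_ this)
  intro a b hab
  simp only at hab
  omega

theorem shift_invariant {n : ℕ} {F : Simp k (n + 1) →ₗ[k] (ℤ →₀ k)}
    (hinv : ∀ σ, Good N σ → F (single (tau ∘ σ) 1) = F (single σ 1))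
    {σ : Fin (n + 1) → ℤ × ℤ} (h : Good N σ) (c : ℤ) :
    F (single (fun t => σ t + (c, c)) 1) = F (single σ 1) := by
  have good : ∀ c : ℤ, Good N fun t => σ t + (c, c) := by
    refine fun c => ⟨fun _ _ hst => add_le_add_left (h.1 hst) _, fun t => ?_⟩
    have := h.2 t
    simp only [Strip, Prod.fst_add, Prod.snd_add] at *
    omega
  have step : ∀ c : ℤ, tau ∘ (fun t => σ t + (c, c)) = fun t => σ t + (c + 1, c + 1) := by
    intro c
    funext t
    simp only [Function.comp, tau, add_assoc, Prod.mk_add_mk]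
  induction c using Int.induction_on with
  | zero => simp [← Prod.zero_eq_mk]
  | succ c ih => rw [← ih, ← hinv _ (good c), step]
  | pred c ih =>
    rw [← ih, ← hinv _ (good (-c - 1)), step]
    simp

/-- Local, translation invariant functions on simplices come from cochains. -/
theorem HCochain.exists_eval {n : ℕ} (hi : 0 < (i : ℕ)) (F : Simp k (n + 1) →ₗ[k] (ℤ →₀ k))
    (hloc : ∀ σ, Good N σ → F (single σ 1) ∈ Filt k i (σ 0) (σ (Fin.last n)))
    (hinv : ∀ σ, Good N σ → F (single (tau ∘ σ) 1) = F (single σ 1)) :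
    ∃ φ ∈ HCochain k N i n, ∀ p q, ∀ x ∈ Car k N (n + 1) p q, eval φ x = F x := by
  -- The relative exponent is converted back to an exponent. Locality of `F` makes it nonnegative,
  -- so `toNat` loses nothing.
  have ex : ∀ X : Fin (n + 1) → Fin (N + 1), ∃ φ : (Fin n → H k) → H k, IsMultilin φ ∧
      ∀ e, φ (monomials k e) = mapDomain
        (fun r : ℤ => (r + wt (lift X e 0) (lift X e (Fin.last n))).toNat)
        (F (single (lift X e) 1)) := fun X => exists_isMultilin _
  choose φ hφ hφe using ex
  refine ⟨fun X a => Bim.insert k hi (X 0) (X (Fin.last n)) (φ X a), fun X =>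
    ⟨(hφ X).map (Bim.insert k hi (X 0) (X (Fin.last n))), fun a => Bim.insert_mem _ _ _ _⟩,
    fun p q x hx => Car.congr _ F (fun σ h _ => ?_) hx⟩
  rw [eval_single, value, hφe]
  set X := objs N σ with hX
  set e := exps σ with he
  have hσ : σ = fun t => lift X e t + ((σ 0).2, (σ 0).2) := funext (lift_objs h)
  have hF : F (single (lift X e) 1) = F (single σ 1) := by
    conv_rhs => rw [hσ]
    exact (shift_invariant hinv (lift_good X e) _).symm
  have hw : wt (lift X e 0) (lift X e (Fin.last n)) = wt (σ 0) (σ (Fin.last n)) := by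
    rw [lift_objs h 0, lift_objs h (Fin.last n), ← hX, ← he]
    simp [wt]
  have hm := hloc σ h
  rw [Filt, Finsupp.mem_supported] at hm
  have h1 := pos_val (h.2 0)
  have h2 := pos_val (h.2 (Fin.last n))
  rw [hF, hw, Bim.forget_insert hi, ← Finsupp.mapDomain_comp]
  · conv_rhs => rw [← Finsupp.mapDomain_id (v := F (single σ 1))]
    refine Finsupp.mapDomain_congr fun r hr => ?_
    have := (hm hr).1
    simp only [le_iff, Prod.fst_add, Prod.snd_add, Function.comp, wt, id] at *
    omega
  · intro e0 e1
    by_contra hne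
    obtain ⟨r, hr, hr'⟩ := Finset.mem_image.1
      (Finsupp.mapDomain_support (Finsupp.mem_support_iff.2 hne))
    have := hm hr
    rw [hX] at e0 e1
    simp only [objs, Fin.ext_iff] at e0 e1
    simp only [le_iff, Prod.fst_add, Prod.snd_add, Set.mem_ofPred_eq, ne_eq, Prod.ext_iff, wt] at *
    omega

end Evaluation

end
end KLRW

namespace KLRW
open Finsupp
noncomputable section

/-! ### The Hochschild cohomology of the bimodule -/

section Cohomology

variable {k : Type*} [Field k] {N : ℕ} {i : Fin (N + 1)}

theorem eval_zero {n : ℕ} (x : Simp k (n + 1)) : eval (0 : HFun k N i n) x = 0 := by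
  have := eval_add (0 : HFun k N i n) 0 x
  simpa using this

/-- The evaluation of cochains on a given chain of simplices. -/
def evalAt (i : Fin (N + 1)) {n : ℕ} (x : Simp k (n + 1)) : HFun k N i n →ₗ[k] (ℤ →₀ k) where
  toFun φ := eval φ x
  map_add' φ ψ := eval_add φ ψ x
  map_smul' c φ := by
    suffices h : eval (c • φ) = c • eval φ from LinearMap.congr_fun h x
    ext1 σ
    ext1
    simp [eval_single, value, Finsupp.mapDomain_smul]

theorem eval_translate {n : ℕ} (φ : HFun k N i n) (σ : Fin (n + 1) → ℤ × ℤ) (c : ℤ) :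
    eval φ (single (fun t => σ t + (c, c)) 1) = eval φ (single σ 1) := by
  have h1 : objs N (fun t => σ t + (c, c)) = objs N σ := by
    funext t
    simp [objs, pos]
  have h2 : ∀ p q : ℤ × ℤ, wt (p + (c, c)) (q + (c, c)) = wt p q := fun p q => by simp [wt]
  have h3 : exps (fun t => σ t + (c, c)) = exps σ := by
    funext t
    simp [exps, h2]
  simp only [eval_single, value, h1, h3, h2]

theorem eval_bdry_of_cocycle {n : ℕ} {φ : HFun k N i n} (hφ : φ ∈ HCocycle k N i n)
    {p q : ℤ × ℤ} {x : Simp k (n + 2)} (hx : x ∈ Car k N (n + 2) p q) :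
    eval φ (bdry k (n + 1) x) = 0 := by
  rw [← eval_hDiff hφ.1 hx, LinearMap.mem_ker.1 hφ.2, eval_zero]

theorem cocycle_of_eval_bdry {n : ℕ} (hi : 0 < (i : ℕ)) {φ : HFun k N i n}
    (hφ : φ ∈ HCochain k N i n)
    (h : ∀ σ, Good N σ → eval φ (bdry k (n + 1) (single σ 1)) = 0) : φ ∈ HCocycle k N i n := by
  refine ⟨hφ, LinearMap.mem_ker.2 ?_⟩
  refine HCochain.ext hi (hDiff_mem hφ) (Submodule.zero_mem _) fun σ hσ => ?_
  rw [eval_hDiff hφ (Car.self_mem hσ), h σ hσ, eval_zero]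

/-- Up to coboundaries, a cocycle is determined by its values on lattice cells. -/
theorem exists_cellular {n : ℕ} (hi : 0 < (i : ℕ)) (hN : 0 < N) {φ : HFun k N i (n + 1)}
    (hφ : φ ∈ HCocycle k N i (n + 1)) :
    ∃ ψ ∈ HCochain k N i n, ∀ p q, ∀ x ∈ Car k N (n + 2) p q,
      eval φ x = eval φ (cellular k N (n + 2) x) + eval (hDiff k N i n ψ) x := by
  -- The primitive is the composite of `φ` with the homotopy; locality and equivariance of the
  -- homotopy make it a cochain.
  obtain ⟨ψ, hψ, h⟩ := HCochain.exists_eval hi (eval φ ∘ₗ homotopy k N (n + 1))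
    (fun σ hσ => eval_mem hφ.1 (homotopy_mem hN (Car.self_mem hσ)))
    (fun σ _ => by
      rw [← shift_single, LinearMap.comp_apply, homotopy_shift, eval_shift]; rfl)
  refine ⟨ψ, hψ, fun p q x hx => ?_⟩
  rw [eval_hDiff hψ hx, h _ _ _ (Car.bdry_mem hx), LinearMap.comp_apply]
  have h1 := eval_bdry_of_cocycle hφ (homotopy_mem hN hx)
  rw [bdry_homotopy hN hx, map_sub, map_sub, sub_sub, sub_eq_zero] at h1
  exact h1

/-- A primitive of the cellular part and the correction from `exists_cellular` add up to a primitive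
of the cocycle. -/
theorem mem_cobound_of_cellular {n : ℕ} (hi : 0 < (i : ℕ)) (hN : 0 < N) {φ : HFun k N i (n + 1)}
    (hφ : φ ∈ HCocycle k N i (n + 1)) {ψ : HFun k N i n} (hψ : ψ ∈ HCochain k N i n)
    (h : ∀ p q, ∀ x ∈ Car k N (n + 2) p q,
      eval φ (cellular k N (n + 2) x) = eval ψ (bdry k (n + 1) x)) :
    φ ∈ HCobound k N i (n + 1) := by
  obtain ⟨ψ', hψ', h'⟩ := exists_cellular hi hN hφ
  refine ⟨ψ + ψ', add_mem hψ hψ', ?_⟩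
  refine HCochain.ext hi (hDiff_mem (add_mem hψ hψ')) hφ.1 fun σ hσ => ?_
  rw [h' _ _ _ (Car.self_mem hσ), h _ _ _ (Car.self_mem hσ), ← eval_hDiff hψ (Car.self_mem hσ),
    map_add, eval_add]

/-- The strip has no lattice cells of dimension three or more, so the cellular part of the cocycle
is zero. -/
theorem HH.subsingleton (hi : 0 < (i : ℕ)) (hN : 0 < N) (n : ℕ) (hn : 3 ≤ n) :
    Subsingleton (HH k N i n) := by
  obtain ⟨m, rfl⟩ := Nat.exists_eq_add_of_le' hn
  rw [Submodule.Quotient.subsingleton_iff, eq_top_iff]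
  rintro ⟨φ, hφ⟩ -
  refine mem_cobound_of_cellular (n := m + 2) hi hN hφ (zero_mem _) fun p q x _ => ?_
  rw [eval_zero]
  simp [cellular]

/-- The quotient by coboundaries is computed by a linear map on cocycles. -/
theorem HH.equiv {n : ℕ} {W : Type*} [AddCommGroup W] [Module k W] (f : HFun k N i n →ₗ[k] W)
    (hs : ∀ w, ∃ φ ∈ HCocycle k N i n, f φ = w)
    (hk : ∀ φ ∈ HCocycle k N i n, f φ = 0 ↔ φ ∈ HCobound k N i n) :
    Nonempty (HH k N i n ≃ₗ[k] W) := by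
  let g : HCocycle k N i n →ₗ[k] W := f ∘ₗ (HCocycle k N i n).subtype
  have hg : Function.Surjective g := fun w => by
    obtain ⟨φ, hφ, h⟩ := hs w
    exact ⟨⟨φ, hφ⟩, h⟩
  have h : (HCobound k N i n).comap (HCocycle k N i n).subtype = LinearMap.ker g := by
    ext φ
    exact (hk φ φ.2).symm
  exact ⟨(Submodule.quotEquivOfEq _ _ h).trans (g.quotKerEquivOfSurjective hg)⟩

/-! #### Cochains given by functions of the position -/

/-- Elements supported on the nonnegative integers. -/
def NonnegPart (k : Type*) [Field k] : Submodule k (ℤ →₀ k) := Finsupp.supported k k {r | 0 ≤ r}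

/-- The exclusion at position `i` affects relative exponent zero only when the interval is a single
point; a proper interval allows every nonnegative exponent. -/
theorem nonneg_le_filt {p q : ℤ × ℤ} (h : p ≤ q) (hne : p ≠ q) : NonnegPart k ≤ Filt k i p q := by
  refine Finsupp.supported_mono fun r hr => ?_
  simp only [Set.mem_ofPred_eq, le_iff, ne_eq, Prod.ext_iff, Prod.fst_add, Prod.snd_add] at *
  omega

theorem filt_le_nonneg {p q : ℤ × ℤ} (h : wt p q ≤ 0) : Filt k i p q ≤ NonnegPart k := by
  refine Finsupp.supported_mono fun r hr => ?_
  simp only [Set.mem_ofPred_eq, le_iff, Prod.fst_add, Prod.snd_add, wt] at *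
  omega

/-- The inclusion of exponents into the relative exponents. -/
def ofH (k : Type*) [Field k] : H k →ₗ[k] (ℤ →₀ k) := Finsupp.lmapDomain k k Nat.cast

/-- The restriction to the nonnegative integers. -/
def toH (k : Type*) [Field k] : (ℤ →₀ k) →ₗ[k] H k :=
  Finsupp.lcomapDomain Nat.cast Nat.cast_injective

theorem toH_apply (v : ℤ →₀ k) (n : ℕ) : toH k v n = v n := rfl

theorem toH_ofH (v : H k) : toH k (ofH k v) = v := by
  ext n
  rw [toH_apply]
  exact Finsupp.mapDomain_apply Nat.cast_injective v n

theorem ofH_mem (v : H k) : ofH k v ∈ NonnegPart k := by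
  intro r hr
  obtain ⟨e, -, rfl⟩ := Finset.mem_image.1 (Finsupp.mapDomain_support hr)
  simp

theorem eq_zero_of_toH {v : ℤ →₀ k} (hv : v ∈ NonnegPart k) (h : toH k v = 0) : v = 0 := by
  ext r
  by_cases hr : 0 ≤ r
  · obtain ⟨n, rfl⟩ := Int.eq_ofNat_of_zero_le hr
    exact DFunLike.congr_fun h n
  · by_contra hne
    exact hr (hv (Finsupp.mem_support_iff.2 hne))

/-- The function on points which depends on the position. -/
def pointFun (C : ℤ → ℤ →₀ k) : Simp k 1 →ₗ[k] (ℤ →₀ k) :=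
  Finsupp.linearCombination k fun σ => C ((σ 0).1 - (σ 0).2)

theorem pointFun_single (C : ℤ → ℤ →₀ k) (p : ℤ × ℤ) :
    pointFun C (single ![p] 1) = C (p.1 - p.2) := by
  simp [pointFun]

/-- The function on lattice steps which depends on the position. -/
def edgeFun (A B : ℤ → ℤ →₀ k) : Simp k 2 →ₗ[k] (ℤ →₀ k) :=
  Finsupp.linearCombination k fun σ =>
    if σ 0 = west (σ 1) then A ((σ 1).1 - (σ 1).2) else B ((σ 1).1 - (σ 1).2)

theorem edgeFun_west (A B : ℤ → ℤ →₀ k) (q : ℤ × ℤ) :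
    edgeFun A B (edge k (west q) q) = A (q.1 - q.2) := by
  simp [edgeFun, edge]

theorem edgeFun_south (A B : ℤ → ℤ →₀ k) (q : ℤ × ℤ) :
    edgeFun A B (edge k (south q) q) = B (q.1 - q.2) := by
  have : south q ≠ west q := by
    intro h
    have := congrArg Prod.fst h
    simp only [south, west] at this
    omega
  simp [edgeFun, edge, this]

theorem exists_pointFun (hi : 0 < (i : ℕ)) (C : ℤ → ℤ →₀ k)
    (hC : ∀ x : ℤ, 0 ≤ x → x ≤ N → C x ∈ NonnegPart k) (hCi : C i 0 = 0) :
    ∃ φ ∈ HCochain k N i 0, ∀ p q, ∀ x ∈ Car k N 1 p q, eval φ x = pointFun C x := by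
  refine HCochain.exists_eval hi _ (fun σ hσ => ?_) (fun σ _ => ?_)
  · rw [pointFun, Finsupp.linearCombination_single, one_smul, Filt, Finsupp.mem_supported]
    have h := hσ.2 0
    have h1 := hC _ h.1 h.2
    intro r hr
    have h2 : 0 ≤ r := h1 hr
    have e : σ (Fin.last 0) = σ 0 := rfl
    rw [e]
    simp only [Set.mem_ofPred_eq, le_iff, ne_eq, Prod.ext_iff, Prod.fst_add, Prod.snd_add]
    refine ⟨by omega, fun e1 e2 => ?_⟩
    obtain rfl : r = 0 := by omega
    rw [e1, SetLike.mem_coe, Finsupp.mem_support_iff] at hr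
    exact hr hCi
  · simp [pointFun, tau]

theorem edgeFun_mem {A B : ℤ → ℤ →₀ k} (hA : ∀ x : ℤ, 1 ≤ x → x ≤ N → A x ∈ NonnegPart k)
    (hB : ∀ x : ℤ, 0 ≤ x → x + 1 ≤ N → B x ∈ NonnegPart k) {p q : ℤ × ℤ} {z : Simp k 2}
    (hz : z ∈ EdgeCar k N p q) : edgeFun A B z ∈ Filt k i p q := by
  induction hz using Submodule.span_induction with
  | mem z h =>
    obtain ⟨r, hr, hq, ⟨h1, hp, rfl⟩ | ⟨h1, hp, rfl⟩⟩ := h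
    · rw [edgeFun_west]
      simp only [Strip, west, le_iff] at *
      refine nonneg_le_filt (p := p) (q := q) (by rw [le_iff]; omega)
        (by rw [ne_eq, Prod.ext_iff]; omega) (hA _ (by omega) (by omega))
    · rw [edgeFun_south]
      simp only [Strip, south, le_iff] at *
      refine nonneg_le_filt (p := p) (q := q) (by rw [le_iff]; omega)
        (by rw [ne_eq, Prod.ext_iff]; omega) (hB _ (by omega) (by omega))
  | zero => simp
  | add x y _ _ hx hy => rw [map_add]; exact add_mem hx hy
  | smul c x _ hx => rw [map_smul]; exact Submodule.smul_mem _ _ hx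

theorem edgeFun_tau {A B : ℤ → ℤ →₀ k} {p q : ℤ × ℤ} {z : Simp k 2}
    (hz : z ∈ EdgeCar k N p q) : edgeFun A B (shift k 2 z) = edgeFun A B z := by
  induction hz using Submodule.span_induction with
  | mem z h =>
    obtain ⟨r, hr, hq, ⟨h1, hp, rfl⟩ | ⟨h1, hp, rfl⟩⟩ := h
    · rw [shift_edge, tau_west, edgeFun_west, edgeFun_west]
      simp [tau]
    · rw [shift_edge, tau_south, edgeFun_south, edgeFun_south]
      simp [tau]
  | zero => simp
  | add x y _ _ hx hy => simp only [map_add, hx, hy]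
  | smul c x _ hx => simp only [map_smul, hx]

/-- A function on lattice steps extends to all relations `p ≤ q` by summation along the chosen
lattice path. -/
theorem exists_edgeFun (hi : 0 < (i : ℕ)) (hN : 0 < N) {A B : ℤ → ℤ →₀ k}
    (hA : ∀ x : ℤ, 1 ≤ x → x ≤ N → A x ∈ NonnegPart k)
    (hB : ∀ x : ℤ, 0 ≤ x → x + 1 ≤ N → B x ∈ NonnegPart k) :
    ∃ φ ∈ HCochain k N i 1, ∀ p q, ∀ x ∈ Car k N 2 p q,
      eval φ x = edgeFun A B (straighten k N x) := by
  refine HCochain.exists_eval hi (edgeFun A B ∘ₗ straighten k N) (fun σ hσ => ?_) (fun σ hσ => ?_)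
  · exact edgeFun_mem hA hB (straighten_mem hN (Car.self_mem hσ))
  · rw [← shift_single, LinearMap.comp_apply, straighten_shift,
      edgeFun_tau (straighten_mem hN (Car.self_mem hσ))]
    rfl

theorem path_self (p : ℤ × ℤ) : path k N p p = 0 := by
  rw [path, if_neg (by omega), if_neg (by omega)]

theorem path_west (q : ℤ × ℤ) : path k N (west q) q = edge k (west q) q := by
  rw [path, if_neg (by simp [west]), if_pos (by simp [west]), path_self, add_zero]

theorem path_south {q : ℤ × ℤ} (h : Strip N (south q)) :
    path k N (south q) q = edge k (south q) q := by
  simp only [Strip, south] at h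
  rw [path_of_south (by simp only [south]; omega), path_self, add_zero]

theorem straighten_eq_self {p q : ℤ × ℤ} {z : Simp k 2} (hz : z ∈ EdgeCar k N p q) :
    straighten k N z = z := by
  induction hz using Submodule.span_induction with
  | mem z h =>
    obtain ⟨r, hr, hq, ⟨h1, hp, rfl⟩ | ⟨h1, hp, rfl⟩⟩ := h
    · rw [straighten_edge, path_west]
    · rw [straighten_edge, path_south h1]
  | zero => simp
  | add x y _ _ hx hy => simp only [map_add, hx, hy]
  | smul c x _ hx => simp only [map_smul, hx]

theorem edgeFun_bdry_square (A B : ℤ → ℤ →₀ k) (q : ℤ × ℤ) :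
    edgeFun A B (bdry k 2 (square k q)) =
      A (q.1 - q.2) + B (q.1 - q.2 - 1) - B (q.1 - q.2) - A (q.1 - q.2 + 1) := by
  rw [bdry_square]
  simp only [map_add, map_sub, edgeFun_west, edgeFun_south]
  congr 3
  · congr 1
    simp only [west]
    omega
  · simp only [south]
    omega

/-- Linear functions on the squares agree if they agree on single squares. -/
theorem SquareCar.congr {W : Type*} [AddCommGroup W] [Module k W]
    (F F' : ((ℤ × ℤ) →₀ k) →ₗ[k] W) {p q : ℤ × ℤ}
    (h : ∀ r, Strip N r → Strip N (west r) → Strip N (south r) → p ≤ south (west r) → r ≤ q →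
      F (single r 1) = F' (single r 1))
    {z : (ℤ × ℤ) →₀ k} (hz : z ∈ SquareCar k N p q) : F z = F' z := by
  rw [SquareCar, Finsupp.supported_eq_span_single] at hz
  induction hz using Submodule.span_induction with
  | mem x hx =>
    obtain ⟨r, ⟨h1, h2, h3, h4, h5⟩, rfl⟩ := hx
    exact h r h1 h2 h3 h4 h5
  | zero => simp
  | add x y _ _ hx hy => simp only [map_add, hx, hy]
  | smul c x _ hx => simp only [map_smul, hx]

theorem eval_edge_west (φ : HFun k N i 1) (q : ℤ × ℤ) :
    eval φ (edge k (west q) q) = eval φ (edge k (q.1 - q.2 - 1, 0) (q.1 - q.2, 0)) := by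
  rw [edge, edge, ← eval_translate φ ![(q.1 - q.2 - 1, 0), (q.1 - q.2, 0)] q.2]
  congr 2
  funext t
  fin_cases t <;> ext <;> simp [west]
  ring

theorem eval_edge_south (φ : HFun k N i 1) (q : ℤ × ℤ) :
    eval φ (edge k (south q) q) = eval φ (edge k (q.1 - q.2 + 1, 0) (q.1 - q.2 + 1, 1)) := by
  rw [edge, edge, ← eval_translate φ ![(q.1 - q.2 + 1, 0), (q.1 - q.2 + 1, 1)] (q.2 - 1)]
  congr 2
  funext t
  fin_cases t <;> ext <;> simp [south]

theorem eval_square (φ : HFun k N i 2) (q : ℤ × ℤ) :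
    eval φ (square k q) = eval φ (square k (q.1 - q.2 + 1, 1)) := by
  rw [square, square, map_sub, map_sub]
  rw [← eval_translate φ ![south (west (q.1 - q.2 + 1, 1)), west (q.1 - q.2 + 1, 1),
    (q.1 - q.2 + 1, 1)] (q.2 - 1), ← eval_translate φ ![south (west (q.1 - q.2 + 1, 1)),
    south (q.1 - q.2 + 1, 1), (q.1 - q.2 + 1, 1)] (q.2 - 1)]
  congr 3
  all_goals
    funext t
    fin_cases t <;> ext <;> simp [west, south]

theorem square_mem {q : ℤ × ℤ} (h : Strip N q) (h1 : Strip N (west q)) (h2 : Strip N (south q)) :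
    square k q ∈ Car k N 3 (south (west q)) q := by
  have := triangulate_mem (k := k) (N := N) (p := south (west q)) (q := q) (z := single q 1)
    (Finsupp.single_mem_supported k _ ⟨h, h1, h2, le_rfl, le_rfl⟩)
  simpa [triangulate] using this

/-- The boundary of a square already consists of lattice steps, so straightening fixes it and
`contract_bdry` recovers the square. -/
theorem tile_square (hN : 0 < N) {q : ℤ × ℤ} (h : Strip N q) (h1 : Strip N (west q))
    (h2 : Strip N (south q)) : tile k N (square k q) = single q 1 := by
  have hs := square_mem (k := k) h h1 h2
  have hz : (single q 1 : (ℤ × ℤ) →₀ k) ∈ SquareCar k N (south (west q)) q :=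
    Finsupp.single_mem_supported k _ ⟨h, h1, h2, le_rfl, le_rfl⟩
  rw [← contract_bdry (tile_mem hN hs), bdry_tile hN hs]
  conv_rhs => rw [← contract_bdry hz]
  have e : triangulate k (single q 1) = square k q := by simp [triangulate]
  rw [e]
  congr 1
  refine straighten_eq_self (p := south (west q)) (q := q) ?_
  have h3 : Strip N (south (west q)) := by
    simp only [Strip, south, west] at *
    omega
  rw [bdry_square]
  refine sub_mem (sub_mem (add_mem (edge_mem_west h h1 ?_ le_rfl) (edge_mem_south h1 h3 le_rfl ?_))
    (edge_mem_south h h2 ?_ le_rfl)) (edge_mem_west h2 h3 le_rfl ?_) <;>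
  simp only [le_iff, south, west] <;> omega

/-! #### Degree zero -/

theorem eval_point_eq {φ : HFun k N i 0} (hφ : φ ∈ HCocycle k N i 0) {p : ℤ × ℤ}
    (hp : Strip N p) : eval φ (single ![p] 1) = eval φ (single ![((i : ℤ), 0)] 1) := by
  have hi : Strip N ((i : ℤ), 0) := by
    simp only [Strip]
    omega
  -- Large enough for the translate of `p` by `(c, c)` to lie above `(i, 0)`; a cocycle takes the
  -- same value at both ends of this relation.
  let c : ℤ := |(i : ℤ) - p.1| + |p.2|
  have h1 : ((i : ℤ), (0 : ℤ)) ≤ p + (c, c) := by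
    rw [le_iff]
    simp only [Prod.fst_add, Prod.snd_add, c]
    have := le_abs_self ((i : ℤ) - p.1)
    have := neg_abs_le p.2
    have := abs_nonneg ((i : ℤ) - p.1)
    have := abs_nonneg p.2
    omega
  have h2 : Strip N (p + (c, c)) := by
    simp only [Strip, Prod.fst_add, Prod.snd_add] at *
    omega
  have h3 : edge k ((i : ℤ), 0) (p + (c, c)) ∈ Car k N 2 ((i : ℤ), 0) (p + (c, c)) := by
    refine Car.single_mem ⟨?_, ?_⟩ ?_ _
    · intro s t hst
      fin_cases s <;> fin_cases t <;> first
        | exact le_rfl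
        | exact h1
        | simp at hst
    · intro t
      fin_cases t
      · exact hi
      · exact h2
    · intro t
      fin_cases t
      · exact ⟨le_rfl, h1⟩
      · exact ⟨h1, le_rfl⟩
  have h4 := eval_bdry_of_cocycle hφ h3
  rw [bdry_edge, map_sub, sub_eq_zero] at h4
  rw [← h4, ← eval_translate φ ![p] c]
  congr 2
  funext t
  fin_cases t
  rfl

/-- A cocycle is a single value common to all positions. Position `i` excludes relative exponent
zero and nothing positive, hence the index set `1 ≤ l`. -/
theorem HH.zero (hi : 0 < (i : ℕ)) :
    Nonempty (HH k N i 0 ≃ₗ[k] ({l : ℕ // 1 ≤ l} →₀ k)) := by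
  have hstrip : Strip N ((i : ℤ), 0) := by
    simp only [Strip]
    omega
  have hmem : (single ![((i : ℤ), (0 : ℤ))] 1 : Simp k 1) ∈ Car k N 1 ((i : ℤ), 0) ((i : ℤ), 0) := by
    refine Car.single_mem ⟨?_, ?_⟩ ?_ _
    · intro s t _
      fin_cases s; fin_cases t; exact le_rfl
    · intro t
      fin_cases t
      exact hstrip
    · intro t
      fin_cases t
      exact ⟨le_rfl, le_rfl⟩
  refine HH.equiv (Finsupp.lsubtypeDomain {l : ℕ | 1 ≤ l} ∘ₗ toH k ∘ₗ
    evalAt i (single ![((i : ℤ), 0)] 1)) (fun w => ?_) (fun φ hφ => ⟨fun h => ?_, fun h => ?_⟩)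
  · let v : H k := Finsupp.mapDomain Subtype.val w
    obtain ⟨φ, hφ, h⟩ := exists_pointFun (k := k) hi (fun _ => ofH k v) (fun _ _ _ => ofH_mem v) (by
      have : toH k (ofH k v) 0 = 0 := by
        rw [toH_ofH]
        exact Finsupp.mapDomain_of_notMem_range _ _ (by rintro ⟨⟨l, hl⟩, rfl⟩; omega)
      exact this)
    refine ⟨φ, cocycle_of_eval_bdry hi hφ fun σ hσ => ?_, ?_⟩
    · rw [h _ _ _ (Car.bdry_mem (Car.self_mem hσ))]
      have e : σ = ![σ 0, σ 1] := by
        funext t; fin_cases t <;> rfl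
      rw [e, ← edge, bdry_edge, map_sub, pointFun_single, pointFun_single, sub_self]
    · have e : evalAt i (single ![((i : ℤ), 0)] 1) φ = ofH k v := by
        refine (h _ _ _ hmem).trans ?_
        rw [pointFun_single]
      rw [LinearMap.comp_apply, LinearMap.comp_apply, e, toH_ofH]
      ext l
      exact Finsupp.mapDomain_apply Subtype.val_injective w l
  · have h1 : eval φ (single ![((i : ℤ), 0)] 1) ∈ Filt k i ((i : ℤ), 0) ((i : ℤ), 0) :=
      eval_mem hφ.1 hmem
    have h2 : eval φ (single ![((i : ℤ), 0)] 1) = 0 := by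
      refine eq_zero_of_toH (filt_le_nonneg (by simp [wt]) h1) ?_
      ext l
      by_cases hl : 1 ≤ l
      · exact DFunLike.congr_fun h ⟨l, hl⟩
      · obtain rfl : l = 0 := by omega
        rw [toH_apply]
        by_contra hne
        have := (h1 (Finsupp.mem_support_iff.2 hne)).2
        simp at this
    rw [HCobound, Submodule.mem_bot]
    refine HCochain.ext hi hφ.1 (zero_mem _) fun σ hσ => ?_
    have e : σ = ![σ 0] := by
      funext t; fin_cases t; rfl
    rw [e, eval_zero, eval_point_eq hφ (hσ.2 0), h2]
  · rw [HCobound, Submodule.mem_bot] at h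
    rw [h, map_zero]

/-! #### Degree one -/

theorem strip_iff {x y : ℤ} : Strip N (x, y) ↔ 0 ≤ x - y ∧ x - y ≤ N := Iff.rfl

/-- A single step has weight zero, so its relative exponents are actual numbers of dots. -/
theorem edge_west_mem_nonneg {φ : HFun k N i 1} (hφ : φ ∈ HCochain k N i 1) {x : ℤ} (h1 : 1 ≤ x)
    (h2 : x ≤ N) : eval φ (edge k (x - 1, 0) (x, 0)) ∈ NonnegPart k := by
  have := edge_mem_west (k := k) (N := N) (p := (x - 1, 0)) (q := (x, 0)) (r := (x, 0))
    (by rw [strip_iff]; omega) (by rw [west, strip_iff]; omega) le_rfl le_rfl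
  refine filt_le_nonneg ?_ (eval_mem hφ (EdgeCar.le_car this))
  simp [wt]

theorem edge_south_mem_nonneg {φ : HFun k N i 1} (hφ : φ ∈ HCochain k N i 1) {x : ℤ} (h1 : 0 ≤ x)
    (h2 : x + 1 ≤ N) : eval φ (edge k (x + 1, 0) (x + 1, 1)) ∈ NonnegPart k := by
  have := edge_mem_south (k := k) (N := N) (p := (x + 1, 0)) (q := (x + 1, 1)) (r := (x + 1, 1))
    (by rw [strip_iff]; omega) (by rw [south, strip_iff]; omega) (by simp [south]) le_rfl
  refine filt_le_nonneg ?_ (eval_mem hφ (EdgeCar.le_car this))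
  simp [wt]

/-- The value of a `1`-cocycle on the closed path between neighbouring positions does not depend on
the positions. -/
theorem eval_loop {φ : HFun k N i 1} (hφ : φ ∈ HCocycle k N i 1) (x : ℕ) (hx : x + 1 ≤ N) :
    eval φ (edge k ((x : ℤ) + 1 - 1, 0) ((x : ℤ) + 1, 0)) +
        eval φ (edge k ((x : ℤ) + 1, 0) ((x : ℤ) + 1, 1)) =
      eval φ (edge k (0, 0) (1, 0)) + eval φ (edge k (1, 0) (1, 1)) := by
  induction x with
  | zero => simp
  | succ x ih =>
    -- The loops at neighbouring positions differ by the boundary of one square, on which a cocycle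
    -- vanishes.
    rw [← ih (by omega)]
    have hs := square_mem (k := k) (N := N) (q := ((x : ℤ) + 1, 0))
      (by rw [strip_iff]; omega) (by rw [west, strip_iff]; omega) (by rw [south, strip_iff]; omega)
    have h := eval_bdry_of_cocycle hφ hs
    rw [bdry_square] at h
    simp only [map_add, map_sub, eval_edge_west, eval_edge_south] at h
    simp only [west, south, sub_zero, sub_neg_eq_add, zero_sub] at h
    rw [sub_sub, sub_eq_zero] at h
    push_cast
    rw [add_comm, ← sub_eq_zero] at h ⊢
    rw [← neg_eq_zero, ← h]
    simp only [add_sub_cancel_right]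
    abel

/-- Modulo `tau` the path `(0, 0), (1, 0), (1, 1)` is closed and generates the first homology of the
annulus; the class of a cocycle is its value on this loop. Exponent zero is excluded at one point
but on no step, so it survives here. -/
theorem HH.one (hi : 0 < (i : ℕ)) (hi' : (i : ℕ) < N) :
    Nonempty (HH k N i 1 ≃ₗ[k] (ℕ →₀ k)) := by
  have hN : 0 < N := by omega
  have hloop : edge k (0, 0) (1, 0) + edge k (1, 0) (1, 1) ∈ EdgeCar k N (0, 0) (1, 1) := by
    have h1 := edge_mem_west (k := k) (N := N) (p := (0, 0)) (q := (1, 1)) (r := (1, 0))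
      (by rw [strip_iff]; omega) (by rw [west, strip_iff]; omega) le_rfl (by simp)
    have h2 := edge_mem_south (k := k) (N := N) (p := (0, 0)) (q := (1, 1)) (r := (1, 1))
      (by rw [strip_iff]; omega) (by rw [south, strip_iff]; omega) (by simp [south]) le_rfl
    exact add_mem h1 h2
  refine HH.equiv (toH k ∘ₗ evalAt i (edge k (0, 0) (1, 0) + edge k (1, 0) (1, 1)))
    (fun v => ?_) (fun φ hφ => ⟨fun h => ?_, fun h => ?_⟩)
  -- A constant on the steps in the second direction and zero on the others: opposite sides of a
  -- square cancel, and the loop has the value `v`.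
  · obtain ⟨φ, hφ, h⟩ := exists_edgeFun (k := k) (A := fun _ => 0) (B := fun _ => ofH k v) hi hN
      (fun _ _ _ => zero_mem _) (fun _ _ _ => ofH_mem v)
    refine ⟨φ, cocycle_of_eval_bdry hi hφ fun σ hσ => ?_, ?_⟩
    · have hσ' := Car.self_mem (k := k) hσ
      rw [h _ _ _ (Car.bdry_mem hσ'), ← bdry_tile hN hσ']
      refine SquareCar.congr (edgeFun (fun _ => 0) (fun _ => ofH k v) ∘ₗ bdry k 2 ∘ₗ triangulate k)
        0 (fun r _ _ _ _ _ => ?_) (tile_mem hN hσ')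
      simp only [LinearMap.comp_apply, triangulate, Finsupp.linearCombination_single, one_smul,
        edgeFun_bdry_square]
      simp
    · rw [LinearMap.comp_apply]
      have e : evalAt i (edge k (0, 0) (1, 0) + edge k (1, 0) (1, 1)) φ = ofH k v := by
        refine (h _ _ _ (EdgeCar.le_car hloop)).trans ?_
        rw [straighten_eq_self hloop, map_add]
        have e1 := edgeFun_west (k := k) (fun _ => 0) (fun _ => ofH k v) (1, 0)
        have e2 := edgeFun_south (k := k) (fun _ => 0) (fun _ => ofH k v) (1, 1)
        simp only [west, south, sub_self] at e1 e2
        rw [e1, e2, zero_add]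
      rw [e, toH_ofH]
  · have h0 : eval φ (edge k (0, 0) (1, 0)) + eval φ (edge k (1, 0) (1, 1)) = 0 := by
      rw [← map_add]
      refine eq_zero_of_toH ?_ h
      rw [map_add]
      exact add_mem (edge_west_mem_nonneg hφ.1 (x := 1) le_rfl (by omega))
        (edge_south_mem_nonneg hφ.1 (x := 0) le_rfl (by omega))
    let U : ℤ → ℤ →₀ k := fun x => eval φ (edge k (x - 1, 0) (x, 0))
    -- The sum of the values along the steps from position `i` to position `x`. Starting at `i`
    -- gives `C i = 0`, as required by the excluded exponent there.
    let C : ℤ → ℤ →₀ k := fun x =>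
      ∑ y ∈ Finset.range x.toNat, U (y + 1) - ∑ y ∈ Finset.range i, U (y + 1)
    have hC : ∀ x, 1 ≤ x → C x - C (x - 1) = U x := by
      intro x hx
      have e : x.toNat = (x - 1).toNat + 1 := by omega
      simp only [C, e, Finset.sum_range_succ]
      have e' : ((x - 1).toNat : ℤ) + 1 = x := by omega
      rw [e']
      abel
    have hU : ∀ y : ℕ, y + 1 ≤ N → U (y + 1) ∈ NonnegPart k := fun y hy =>
      edge_west_mem_nonneg hφ.1 (by omega) (by omega)
    obtain ⟨ψ, hψ, hψe⟩ := exists_pointFun (k := k) (N := N) hi C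
      (fun x h1 h2 => sub_mem
        (sum_mem fun y hy => hU y (by rw [Finset.mem_range] at hy; omega))
        (sum_mem fun y hy => hU y (by rw [Finset.mem_range] at hy; omega)))
      (by simp [C])
    refine mem_cobound_of_cellular hi hN hφ hψ fun p q x hx => ?_
    rw [hψe _ _ _ (Car.bdry_mem hx), ← bdry_straighten hN hx]
    change eval φ (straighten k N x) = _
    have hz := straighten_mem hN hx
    generalize straighten k N x = z at hz
    induction hz using Submodule.span_induction with
    | mem z h =>
      obtain ⟨r, hr, -, ⟨h1, -, rfl⟩ | ⟨h1, -, rfl⟩⟩ := h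
      · rw [eval_edge_west, bdry_edge, map_sub, pointFun_single, pointFun_single]
        simp only [Strip, west] at hr h1
        have e : (west r).1 - (west r).2 = r.1 - r.2 - 1 := by
          simp only [west]
          omega
        rw [e, hC _ (by omega)]
      · rw [eval_edge_south, bdry_edge, map_sub, pointFun_single, pointFun_single]
        simp only [Strip, south] at hr h1
        have e : (south r).1 - (south r).2 = r.1 - r.2 + 1 := by
          simp only [south]
          omega
        obtain ⟨y, hy⟩ := Int.eq_ofNat_of_zero_le hr.1
        -- The vanishing of the loop makes the value on a step in the second direction the negative
        -- of that on the opposite step in the first direction.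
        have h2 := eval_loop hφ y (by omega)
        rw [h0] at h2
        have h3 := hC (y + 1) (by omega)
        rw [e, hy]
        rw [add_sub_cancel_right] at h3
        rw [eq_neg_of_add_eq_zero_right h2, ← neg_sub (C (y + 1)) (C y), h3]
    | zero => simp
    | add x y _ _ hx hy => simp only [map_add, hx, hy]
    | smul c x _ hx => simp only [map_smul, hx]
  · obtain ⟨ψ, hψ, rfl⟩ := h
    have e : eval (hDiff k N i 0 ψ) (edge k (0, 0) (1, 0) + edge k (1, 0) (1, 1)) = 0 := by
      rw [eval_hDiff hψ (EdgeCar.le_car hloop)]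
      -- The two ends of the loop are translates of each other, so a cochain of degree zero takes
      -- the same value on them.
      have e1 : bdry k 1 (edge k (0, 0) (1, 0) + edge k (1, 0) (1, 1)) =
          single ![(1, 1)] 1 - single ![(0, 0)] 1 := by
        rw [map_add, bdry_edge, bdry_edge]
        abel
      refine (congrArg (eval ψ) e1).trans ?_
      rw [map_sub, sub_eq_zero]
      refine Eq.trans ?_ (eval_translate ψ ![(0, 0)] 1)
      congr 2
      funext t
      fin_cases t
      rfl
    have e' : evalAt i (edge k (0, 0) (1, 0) + edge k (1, 0) (1, 1)) (hDiff k N i 0 ψ) = 0 := e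
    rw [LinearMap.comp_apply, e', map_zero]

end Cohomology

end
end KLRW

namespace KLRW
open Finsupp
noncomputable section

section CohomologyTwo

variable {k : Type*} [Field k] {N : ℕ} {i : Fin (N + 1)}

/-! #### Degree two -/

/-- The function on squares which depends on the position. -/
def squareFun (C : ℤ → ℤ →₀ k) : ((ℤ × ℤ) →₀ k) →ₗ[k] (ℤ →₀ k) :=
  Finsupp.linearCombination k fun q => C (q.1 - q.2)

theorem squareFun_single (C : ℤ → ℤ →₀ k) (q : ℤ × ℤ) :
    squareFun C (single q 1) = C (q.1 - q.2) := by
  simp [squareFun]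

theorem squareFun_shift (C : ℤ → ℤ →₀ k) (z : (ℤ × ℤ) →₀ k) :
    squareFun C (shiftSquare k z) = squareFun C z := by
  suffices h : squareFun C ∘ₗ shiftSquare k = squareFun C from LinearMap.congr_fun h z
  ext1 q
  ext1
  simp [squareFun, shiftSquare, tau]

/-- A square joins `(a - 1, b - 1)` to `(a, b)`, so its weight is one and the relative exponent `-1`
becomes possible, except over position `i`. -/
theorem squareFun_mem {C : ℤ → ℤ →₀ k}
    (hC : ∀ x, C x ∈ Finsupp.supported k k {r : ℤ | -1 ≤ r}) (hCi : C i (-1) = 0)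
    {p q : ℤ × ℤ} {z : (ℤ × ℤ) →₀ k} (hz : z ∈ SquareCar k N p q) :
    squareFun C z ∈ Filt k i p q := by
  rw [SquareCar, Finsupp.supported_eq_span_single] at hz
  induction hz using Submodule.span_induction with
  | mem x hx =>
    obtain ⟨r, ⟨-, -, -, h4, h5⟩, rfl⟩ := hx
    rw [squareFun_single, Filt, Finsupp.mem_supported]
    intro s hs
    have h6 : -1 ≤ s := hC _ hs
    have h7 : s = -1 → r.1 - r.2 ≠ i := by
      rintro rfl h
      rw [h, SetLike.mem_coe, Finsupp.mem_support_iff] at hs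
      exact hs hCi
    simp only [Set.mem_ofPred_eq, le_iff, ne_eq, Prod.ext_iff, Prod.fst_add, Prod.snd_add, south,
      west] at *
    exact ⟨by omega, fun e1 e2 => h7 (by omega) (by omega)⟩
  | zero => simp
  | add x y _ _ hx hy => rw [map_add]; exact add_mem hx hy
  | smul c x _ hx => rw [map_smul]; exact Submodule.smul_mem _ _ hx

/-- The enumeration of the inner positions other than `i`. -/
def inner (i : Fin (N + 1)) (m : Fin (N - 2)) : ℤ :=
  if (m : ℕ) + 1 < i then (m : ℤ) + 1 else (m : ℤ) + 2

theorem inner_injective (i : Fin (N + 1)) : Function.Injective (inner i) := by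
  intro m m' h
  simp only [inner] at h
  rw [Fin.ext_iff]
  split_ifs at h <;> omega

theorem inner_range (hi : 0 < (i : ℕ)) (hi' : (i : ℕ) < N) (m : Fin (N - 2)) :
    1 ≤ inner i m ∧ inner i m + 1 ≤ N ∧ inner i m ≠ i := by
  simp only [inner]
  split_ifs <;> omega

theorem exists_inner (hi : 0 < (i : ℕ)) (hi' : (i : ℕ) < N) {x : ℤ} (h1 : 1 ≤ x) (h2 : x + 1 ≤ N)
    (h3 : x ≠ i) : ∃ m, inner i m = x := by
  by_cases h : x < i
  · refine ⟨⟨(x - 1).toNat, by omega⟩, ?_⟩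
    simp only [inner]
    rw [if_pos (by omega)]
    omega
  · refine ⟨⟨(x - 2).toNat, by omega⟩, ?_⟩
    simp only [inner]
    rw [if_neg (by omega)]
    omega

theorem square_at_mem {x : ℤ} (h1 : 1 ≤ x) (h2 : x + 1 ≤ N) :
    square k (x + 1, 1) ∈ Car k N 3 (x, 0) (x + 1, 1) := by
  have := square_mem (k := k) (N := N) (q := (x + 1, 1)) (by rw [strip_iff]; omega)
    (by rw [west, strip_iff]; omega) (by rw [south, strip_iff]; omega)
  simpa [south, west] using this

/-- Steps carry only nonnegative relative exponents, so the coefficients at `-1` on squares are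
unaffected by coboundaries. The nonnegative part can always be killed by summing over the squares
between the two walls. -/
theorem HH.two (hi : 0 < (i : ℕ)) (hi' : (i : ℕ) < N) :
    Nonempty (HH k N i 2 ≃ₗ[k] (Fin (N - 2) → k)) := by
  have hN : 0 < N := by omega
  let f : HFun k N i 2 →ₗ[k] (Fin (N - 2) → k) :=
    LinearMap.pi fun m => Finsupp.lapply (-1) ∘ₗ evalAt i (square k (inner i m + 1, 1))
  have hf : ∀ φ m, f φ m = eval φ (square k (inner i m + 1, 1)) (-1) := fun φ m => rfl
  refine HH.equiv f (fun w => ?_) (fun φ hφ => ⟨fun h => ?_, fun h => ?_⟩)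
  · let C : ℤ → ℤ →₀ k := fun x => ∑ m, if x = inner i m then single (-1) (w m) else 0
    have hC : ∀ x, C x ∈ Finsupp.supported k k {r : ℤ | -1 ≤ r} := by
      intro x
      refine sum_mem fun m _ => ?_
      split_ifs
      · exact Finsupp.single_mem_supported k _ (le_refl (-1 : ℤ))
      · exact zero_mem _
    have hCm : ∀ m, C (inner i m) = single (-1) (w m) := by
      intro m
      simp [C, (inner_injective i).eq_iff]
    have hCi : C i = 0 := Finset.sum_eq_zero fun m _ =>
      if_neg fun h => (inner_range hi hi' m).2.2 h.symm
    obtain ⟨φ, hφ, h⟩ := HCochain.exists_eval (k := k) (N := N) (n := 2) hi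
      (squareFun C ∘ₗ tile k N)
      (fun σ hσ => squareFun_mem hC (by rw [hCi]; rfl) (tile_mem hN (Car.self_mem hσ)))
      (fun σ hσ => by
        rw [← shift_single, LinearMap.comp_apply, tile_shift, squareFun_shift]; rfl)
    refine ⟨φ, cocycle_of_eval_bdry hi hφ fun σ hσ => ?_, ?_⟩
    · have hσ' := Car.self_mem (k := k) hσ
      rw [h _ _ _ (Car.bdry_mem hσ'), LinearMap.comp_apply, tile_bdry hN hσ', map_zero]
    · funext m
      obtain ⟨h1, h2, h3⟩ := inner_range hi hi' m
      rw [hf, h _ _ _ (square_at_mem h1 h2), LinearMap.comp_apply, tile_square hN, squareFun_single]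
      · simp [hCm]
      · rw [strip_iff]; omega
      · rw [west, strip_iff]; omega
      · rw [south, strip_iff]; omega
  · let s : ℤ → ℤ →₀ k := fun x => eval φ (square k (x + 1, 1))
    have hs : ∀ x : ℤ, 1 ≤ x → x + 1 ≤ N → s x ∈ NonnegPart k := by
      intro x h1 h2
      have h3 := eval_mem hφ.1 (square_at_mem (k := k) h1 h2)
      intro r hr
      have h4 := h3 hr
      simp only [Set.mem_ofPred_eq, le_iff, ne_eq, Prod.ext_iff, Prod.fst_add, Prod.snd_add] at h4 ⊢
      by_contra h5
      obtain rfl : r = -1 := by omega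
      -- At position `i` the exponent `-1` is already excluded by `Filt`; elsewhere its coefficient
      -- vanishes by `h`.
      have h6 : x ≠ i := fun h6 => h4.2 (by omega) (by omega)
      obtain ⟨m, rfl⟩ := exists_inner hi hi' h1 h2 h6
      rw [SetLike.mem_coe, Finsupp.mem_support_iff] at hr
      exact hr (congrFun h m)
    -- With `B = 0` the coboundary on the square at position `x` is `A x - A (x + 1)`, which partial
    -- sums from the wall solve. All terms are nonnegative in exponent, as a function on steps
    -- requires.
    let A : ℤ → ℤ →₀ k := fun x => -∑ y ∈ Finset.range (x - 1).toNat, s (y + 1)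
    have hA : ∀ x, 1 ≤ x → A x - A (x + 1) = s x := by
      intro x hx
      have e : (x + 1 - 1).toNat = (x - 1).toNat + 1 := by omega
      simp only [A, e, Finset.sum_range_succ]
      have e' : ((x - 1).toNat : ℤ) + 1 = x := by omega
      rw [e']
      abel
    obtain ⟨ψ, hψ, hψe⟩ := exists_edgeFun (k := k) (N := N) (A := A) (B := fun _ => 0) hi hN
      (fun x h1 h2 => neg_mem (sum_mem fun y hy =>
        hs _ (by omega) (by rw [Finset.mem_range] at hy; omega))) (fun _ _ _ => zero_mem _)
    refine mem_cobound_of_cellular hi hN hφ hψ fun p q x hx => ?_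
    rw [hψe _ _ _ (Car.bdry_mem hx), ← bdry_tile hN hx]
    refine SquareCar.congr (eval φ ∘ₗ triangulate k)
      (edgeFun A (fun _ => 0) ∘ₗ bdry k 2 ∘ₗ triangulate k) (fun r h1 h2 h3 _ _ => ?_)
      (tile_mem hN hx)
    simp only [LinearMap.comp_apply, triangulate, Finsupp.linearCombination_single, one_smul,
      edgeFun_bdry_square]
    simp only [Strip, west, south] at h1 h2 h3
    rw [eval_square, add_zero, sub_zero, hA _ (by omega)]
  · obtain ⟨ψ, hψ, rfl⟩ := h
    funext m
    obtain ⟨h1, h2, h3⟩ := inner_range hi hi' m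
    rw [hf, eval_hDiff hψ (square_at_mem h1 h2), bdry_square]
    simp only [map_add, map_sub, eval_edge_west, eval_edge_south]
    have key : ∀ v ∈ NonnegPart k, v (-1) = 0 := fun v hv => by
      by_contra hne
      have : (0 : ℤ) ≤ -1 := hv (Finsupp.mem_support_iff.2 hne)
      omega
    refine key _ (sub_mem (sub_mem (add_mem ?_ ?_) ?_) ?_)
    · exact edge_west_mem_nonneg hψ (by simp; omega) (by simp; omega)
    · exact edge_south_mem_nonneg hψ (by simp [west]; omega) (by simp [west]; omega)
    · exact edge_south_mem_nonneg hψ (by simp; omega) (by simp; omega)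
    · exact edge_west_mem_nonneg hψ (by simp [south]; omega) (by simp [south]; omega)

end CohomologyTwo

end
end KLRW

namespace KLRW
open Finsupp
noncomputable section

/-! ### Morphisms as polynomials, and matrices of morphisms -/

section Matrices

variable {k : Type*} [Field k] {N : ℕ}

/-- A morphism as a polynomial in the dot. -/
def toPoly (k : Type*) [Field k] : H k →ₗ[k] Polynomial k :=
  Finsupp.linearCombination k fun n => Polynomial.X ^ n

theorem toPoly_single (n : ℕ) (c : k) :
    toPoly k (single n c) = Polynomial.C c * Polynomial.X ^ n := by
  simp [toPoly, Polynomial.smul_eq_C_mul]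

theorem coeff_toPoly (f : H k) (n : ℕ) : (toPoly k f).coeff n = f n := by
  induction f using Finsupp.induction_linear with
  | zero => simp
  | add f g hf hg => simp [hf, hg]
  | single m c =>
    rw [toPoly_single, Polynomial.coeff_C_mul_X_pow, Finsupp.single_apply]
    simp only [eq_comm]

theorem toPoly_injective : Function.Injective (toPoly k) := by
  intro f g h
  ext n
  rw [← coeff_toPoly, h, coeff_toPoly]

theorem toPoly_conv (c : ℕ) (g f : H k) :
    toPoly k (conv k c g f) = toPoly k g * toPoly k f * Polynomial.X ^ c := by
  induction g using Finsupp.induction_linear with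
  | zero => simp
  | add a b ha hb => simp only [map_add, LinearMap.add_apply, ha, hb, add_mul]
  | single β r =>
    induction f using Finsupp.induction_linear with
    | zero => simp
    | add a b ha hb => simp only [map_add, ha, hb, add_mul, mul_add]
    | single α r' =>
      rw [conv_single_single, toPoly_single, toPoly_single, toPoly_single, map_mul]
      ring

theorem toPoly_comp (i j l : Fin (N + 1)) (g f : H k) :
    toPoly k (comp k i j l g f) = toPoly k g * toPoly k f * Polynomial.X ^ delta i j l :=
  toPoly_conv _ _ _

theorem toPoly_mapDomain_succ (f : H k) :
    toPoly k (mapDomain (fun α => α + 1) f) = toPoly k f * Polynomial.X := by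
  induction f using Finsupp.induction_linear with
  | zero => simp
  | add f g hf hg => simp only [Finsupp.mapDomain_add, map_add, hf, hg, add_mul]
  | single m c => rw [Finsupp.mapDomain_single, toPoly_single, toPoly_single, pow_succ, mul_assoc]

theorem Mat.mul_assoc (h g f : Mat k N) : Mat.mul (Mat.mul h g) f = Mat.mul h (Mat.mul g f) := by
  funext m'' m
  simp only [Mat.mul, map_sum, LinearMap.sum_apply]
  rw [Finset.sum_comm]
  refine Finset.sum_congr rfl fun l _ => Finset.sum_congr rfl fun l' _ => ?_
  rw [comp_assoc]

theorem Mat.mul_sum {ι : Type*} (s : Finset ι) (g : Mat k N) (f : ι → Mat k N) :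
    Mat.mul g (∑ t ∈ s, f t) = ∑ t ∈ s, Mat.mul g (f t) := by
  funext m'' m
  simp only [Mat.mul, Finset.sum_apply, map_sum]
  rw [Finset.sum_comm]

theorem Mat.mul_zero (g : Mat k N) : Mat.mul g 0 = 0 := by
  funext m'' m
  simp [Mat.mul]

theorem Mat.mul_incl (f : Mat k N) (j l : Fin (N + 1)) (a : H k) (m'' m : Fin (N + 1)) :
    Mat.mul f (incl k j l a) m'' m = if m = j then comp k j l m'' (f m'' l) a else 0 := by
  simp only [Mat.mul, incl]
  rw [Finset.sum_eq_single l]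
  · by_cases h : m = j
    · subst h
      simp
    · simp [h]
  · intro b _ hb
    simp [hb]
  · simp

theorem Mat.mul_incl_incl (f : Mat k N) (x j l : Fin (N + 1)) (a b : H k) :
    Mat.mul (Mat.mul f (incl k j l a)) (incl k x j b) =
      Mat.mul f (incl k x l (comp k x j l a b)) := by
  funext m'' m
  rw [Mat.mul_incl, Mat.mul_incl, Mat.mul_incl]
  by_cases h : m = x
  · rw [if_pos h, if_pos h, if_pos rfl, comp_assoc]
  · rw [if_neg h, if_neg h]

end Matrices

/-! ### The part of the Hochschild differential without left action -/

section RightDifferential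

universe u

variable {k : Type u} [Field k] {N : ℕ}

/-- The Hochschild differential without the left action, for a right action `r`. -/
def rightDiff {W : Type u} [AddCommGroup W] [Module k W]
    (r : Fin (N + 1) → Fin (N + 1) → H k → W →ₗ[k] W) (n : ℕ)
    (φ : (Fin (n + 1) → Fin (N + 1)) → (Fin n → H k) → W)
    (X : Fin (n + 2) → Fin (N + 1)) (a : Fin (n + 1) → H k) : W :=
  r (X 0) (X 1) (a 0) (φ (Fin.tail X) (Fin.tail a))
    + ∑ t : Fin n, (-1 : k) ^ ((t : ℕ) + 1) • φ (mergeObj t X) (mergeHom t X a)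

theorem mergeObj_zero_cons {n : ℕ} (x : Fin (N + 1)) (X : Fin (n + 2) → Fin (N + 1)) :
    mergeObj (0 : Fin (n + 1)) (Fin.cons x X : Fin (n + 3) → Fin (N + 1)) =
      Fin.cons x (Fin.tail X) := by
  have := removeNth_succ_cons x X 0
  rw [Fin.removeNth_zero] at this
  exact this

theorem mergeObj_succ_cons {n : ℕ} (t : Fin n) (x : Fin (N + 1))
    (X : Fin (n + 2) → Fin (N + 1)) :
    mergeObj t.succ (Fin.cons x X : Fin (n + 3) → Fin (N + 1)) = Fin.cons x (mergeObj t X) :=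
  removeNth_succ_cons x X t.succ.castSucc

theorem mergeHom_zero_cons {n : ℕ} (x : Fin (N + 1)) (X : Fin (n + 2) → Fin (N + 1)) (b : H k)
    (a : Fin (n + 1) → H k) :
    mergeHom (0 : Fin (n + 1)) (Fin.cons x X : Fin (n + 3) → Fin (N + 1))
      (Fin.cons b a : Fin (n + 2) → H k) =
      Fin.cons (comp k x (X 0) (X 1) (a 0) b) (Fin.tail a) := by
  funext s
  induction s using Fin.cases with
  | zero =>
    simp [mergeHom, Fin.contractNth]
    rfl
  | succ s => simp [mergeHom, Fin.contractNth, Fin.tail]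

theorem mergeHom_succ_cons {n : ℕ} (t : Fin n) (x : Fin (N + 1)) (X : Fin (n + 2) → Fin (N + 1))
    (b : H k) (a : Fin (n + 1) → H k) :
    mergeHom t.succ (Fin.cons x X : Fin (n + 3) → Fin (N + 1))
      (Fin.cons b a : Fin (n + 2) → H k) = Fin.cons b (mergeHom t X a) := by
  funext s
  induction s using Fin.cases with
  | zero => simp [mergeHom, Fin.contractNth]
  | succ s =>
    simp only [mergeHom, Fin.contractNth, Fin.cons_succ, Fin.val_succ, Fin.val_castSucc,
      add_lt_add_iff_right, add_left_inj, ← Fin.succ_castSucc]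

/-- The right action on functions of a further morphism. -/
def actFirst {W : Type u} [AddCommGroup W] [Module k W] (j m : Fin (N + 1)) (a : H k) :
    (Fin (N + 1) → H k → W) →ₗ[k] (Fin (N + 1) → H k → W) where
  toFun w := fun x b => w x (comp k x j m a b)
  map_add' _ _ := rfl
  map_smul' _ _ := rfl

/-- Currying the first argument leaves a differential of the same kind with coefficients in
functions, on which the next morphism acts by precomposition. The index shift accounts for the minus
sign. -/
theorem rightDiff_cons {W : Type u} [AddCommGroup W] [Module k W]
    (r : Fin (N + 1) → Fin (N + 1) → H k → W →ₗ[k] W) (n : ℕ)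
    (φ : (Fin (n + 2) → Fin (N + 1)) → (Fin (n + 1) → H k) → W) (x : Fin (N + 1))
    (X : Fin (n + 2) → Fin (N + 1)) (b : H k) (a : Fin (n + 1) → H k) :
    rightDiff r (n + 1) φ (Fin.cons x X) (Fin.cons b a) =
      r x (X 0) b (φ X a) -
        rightDiff actFirst n (fun X a x b => φ (Fin.cons x X) (Fin.cons b a)) X a x b := by
  rw [rightDiff, rightDiff, Fin.sum_univ_succ]
  simp only [mergeObj_zero_cons, mergeHom_zero_cons, mergeObj_succ_cons, mergeHom_succ_cons,
    Fin.tail_cons, Fin.cons_zero, Pi.add_apply, Finset.sum_apply, Pi.smul_apply]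
  have e : (Fin.cons x X : Fin (n + 3) → Fin (N + 1)) 1 = X 0 := rfl
  rw [e]
  have e2 : actFirst (W := W) (X 0) (X 1) (a 0)
      (fun x b => φ (Fin.cons x (Fin.tail X)) (Fin.cons b (Fin.tail a))) x b =
      φ (Fin.cons x (Fin.tail X)) (Fin.cons (comp k x (X 0) (X 1) (a 0) b) (Fin.tail a)) := rfl
  rw [e2, sub_eq_add_neg, neg_add, ← Finset.sum_neg_distrib]
  simp [pow_succ]

/-- The induction passes from `W` to the functions `Fin (N + 1) → H k → W`, so `W` is generalised
and shares its universe with `k`. -/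
theorem rightDiff_rightDiff {W : Type u} [AddCommGroup W] [Module k W]
    (r : Fin (N + 1) → Fin (N + 1) → H k → W →ₗ[k] W)
    (hr : ∀ x j m a b w, r x j b (r j m a w) = r x m (comp k x j m a b) w) (n : ℕ)
    (φ : (Fin (n + 1) → Fin (N + 1)) → (Fin n → H k) → W) :
    rightDiff r (n + 1) (rightDiff r n φ) = 0 := by
  induction n generalizing W with
  | zero =>
    funext X a
    rw [← Fin.cons_self_tail X, ← Fin.cons_self_tail a, rightDiff_cons]
    simp only [rightDiff, Finset.univ_eq_empty, Finset.sum_empty, add_zero, hr]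
    simp [actFirst, sub_eq_zero]
    rfl
  | succ n ih =>
    funext X a
    rw [← Fin.cons_self_tail X, ← Fin.cons_self_tail a, rightDiff_cons]
    generalize X 0 = x
    generalize Fin.tail X = X
    generalize a 0 = b
    generalize Fin.tail a = a
    simp only [rightDiff_cons]
    have h1 : (fun (X : Fin (n + 2) → Fin (N + 1)) (a : Fin (n + 1) → H k) (x : Fin (N + 1))
          (b : H k) => r x (X 0) b (φ X a) -
          rightDiff actFirst n (fun X a x b => φ (Fin.cons x X) (Fin.cons b a)) X a x b) =
        (fun X a x b => r x (X 0) b (φ X a)) -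
          rightDiff actFirst n (fun X a x b => φ (Fin.cons x X) (Fin.cons b a)) := rfl
    have h2 : ∀ ψ ψ' : (Fin (n + 2) → Fin (N + 1)) → (Fin (n + 1) → H k) →
        (Fin (N + 1) → H k → W), rightDiff actFirst (n + 1) (ψ - ψ') =
        rightDiff actFirst (n + 1) ψ - rightDiff actFirst (n + 1) ψ' := by
      intro ψ ψ'
      funext X a
      simp only [rightDiff, Pi.sub_apply, map_sub, smul_sub, Finset.sum_sub_distrib]
      abel
    have h4 := ih (W := Fin (N + 1) → H k → W) actFirst (fun x j m a b w => by
      funext y c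
      simp [actFirst, comp_assoc]) (fun X a x b => φ (Fin.cons x X) (Fin.cons b a))
    rw [h1, h2, h4]
    have h3 : rightDiff actFirst (n + 1) (fun X a x b => r x (X 0) b (φ X a)) X a x b =
        r x (X 0) b (rightDiff r (n + 1) φ X a) := by
      simp only [rightDiff, map_add, map_sum, map_smul, Pi.add_apply, Finset.sum_apply,
        Pi.smul_apply, mergeObj_zero, hr]
      rfl
    rw [sub_zero, h3, sub_self]
    rfl

end RightDifferential

end
end KLRW

namespace KLRW
open Finsupp
noncomputable section

/-! ### Morphisms to the complexes `β T_l` -/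

section Braiding

variable {k : Type*} [Field k] {N : ℕ} {i im ip : Fin (N + 1)}

/-- Matrices of morphisms from `T_j` to the part of degree `0` of `β T_l`. -/
def IsTop (i j l : Fin (N + 1)) (f : Mat k N) : Prop :=
  ∀ r m, f r m ≠ 0 → m = j ∧ (l ≠ i → r = l) ∧ (l = i → (r : ℕ) + 1 = i ∨ (i : ℕ) + 1 = r)

/-- Matrices of morphisms from `T_j` to the part of degree `-1` of `β T_l`. -/
def IsBot (i j l : Fin (N + 1)) (f : Mat k N) : Prop :=
  ∀ m' m, f m' m ≠ 0 → m = j ∧ l = i ∧ m' = i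

theorem mem_hom_gen {j : Fin (N + 1)} {Q : Tw k N} {r : ℤ} {f : Mat k N} :
    f ∈ Tw.hom (gen k j) Q r ↔ ∀ m' m, f m' m ≠ 0 → m = j ∧ Q.deg m' = some r := by
  refine forall_congr' fun m' => forall_congr' fun m => imp_congr_right fun _ => ?_
  constructor
  · rintro ⟨p, q, h1, h2, h3⟩
    simp only [gen] at h1
    split_ifs at h1 with h
    simp only [Option.some.injEq] at h1
    exact ⟨h, by rw [h2, ← h3, ← h1, sub_zero]⟩
  · rintro ⟨rfl, h⟩
    exact ⟨0, r, by simp [gen], h, sub_zero r⟩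

theorem braidObj_deg (l m : Fin (N + 1)) : (braidObj k i l).deg m =
    if l = i then if m = i then some (-1)
      else if (m : ℕ) + 1 = i ∨ (i : ℕ) + 1 = m then some 0 else none
    else if m = l then some 0 else none := by
  unfold braidObj
  split_ifs <;> simp_all [gen]

theorem mem_hom_zero {j l : Fin (N + 1)} {f : Mat k N} :
    f ∈ Tw.hom (gen k j) (braidObj k i l) 0 ↔ IsTop i j l f := by
  rw [mem_hom_gen]
  refine forall_congr' fun m' => forall_congr' fun m => imp_congr_right fun _ =>
    and_congr_right fun _ => ?_
  rw [braidObj_deg]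
  split_ifs with h1 h2 h3 h4
  · subst h2
    simp [h1]
  · simp [h1, h3]
  · simp [h1, h3]
  · simp [h1, h4]
  · simp [h1, h4]

theorem mem_hom_neg_one {j l : Fin (N + 1)} {f : Mat k N} :
    f ∈ Tw.hom (gen k j) (braidObj k i l) (-1) ↔ IsBot i j l f := by
  rw [mem_hom_gen]
  refine forall_congr' fun m' => forall_congr' fun m => imp_congr_right fun _ =>
    and_congr_right fun _ => ?_
  rw [braidObj_deg]
  split_ifs <;> simp_all

theorem eq_zero_of_mem_hom {j l : Fin (N + 1)} {r : ℤ} (h0 : r ≠ 0) (h1 : r ≠ -1) {f : Mat k N}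
    (hf : f ∈ Tw.hom (gen k j) (braidObj k i l) r) : f = 0 := by
  rw [mem_hom_gen] at hf
  funext m' m
  by_contra h
  have := (hf m' m h).2
  rw [braidObj_deg] at this
  split_ifs at this <;> simp_all

theorem IsTop.add {j l : Fin (N + 1)} {f g : Mat k N} (hf : IsTop i j l f) (hg : IsTop i j l g) :
    IsTop i j l (f + g) := by
  rw [← mem_hom_zero] at *
  exact add_mem hf hg

theorem IsTop.smul {j l : Fin (N + 1)} {f : Mat k N} (c : k) (hf : IsTop i j l f) :
    IsTop i j l (c • f) := by
  rw [← mem_hom_zero] at *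
  exact Submodule.smul_mem _ _ hf

theorem IsTop.sum {ι : Type*} (s : Finset ι) {j l : Fin (N + 1)} {f : ι → Mat k N}
    (hf : ∀ t, IsTop i j l (f t)) : IsTop i j l (∑ t ∈ s, f t) := by
  simp only [← mem_hom_zero] at *
  exact sum_mem fun t _ => hf t

theorem IsBot.add {j l : Fin (N + 1)} {f g : Mat k N} (hf : IsBot i j l f) (hg : IsBot i j l g) :
    IsBot i j l (f + g) := by
  rw [← mem_hom_neg_one] at *
  exact add_mem hf hg

theorem IsBot.smul {j l : Fin (N + 1)} {f : Mat k N} (c : k) (hf : IsBot i j l f) :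
    IsBot i j l (c • f) := by
  rw [← mem_hom_neg_one] at *
  exact Submodule.smul_mem _ _ hf

theorem IsBot.sum {ι : Type*} (s : Finset ι) {j l : Fin (N + 1)} {f : ι → Mat k N}
    (hf : ∀ t, IsBot i j l (f t)) : IsBot i j l (∑ t ∈ s, f t) := by
  simp only [← mem_hom_neg_one] at *
  exact sum_mem fun t _ => hf t

theorem IsTop.mul_incl {j l : Fin (N + 1)} {f : Mat k N} (hf : IsTop i j l f) (x : Fin (N + 1))
    (b : H k) : IsTop i x l (Mat.mul f (incl k x j b)) := by
  intro m' m h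
  rw [Mat.mul_incl] at h
  split_ifs at h with h1
  · exact ⟨h1, (hf m' j fun h0 => h (by simp [h0])).2⟩
  · exact absurd rfl h

theorem IsBot.mul_incl {j l : Fin (N + 1)} {f : Mat k N} (hf : IsBot i j l f) (x : Fin (N + 1))
    (b : H k) : IsBot i x l (Mat.mul f (incl k x j b)) := by
  intro m' m h
  rw [Mat.mul_incl] at h
  split_ifs at h with h1
  · exact ⟨h1, (hf m' j fun h0 => h (by simp [h0])).2⟩
  · exact absurd rfl h

theorem Mat.exists_of_mul_ne_zero {g f : Mat k N} {m'' m : Fin (N + 1)}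
    (h : Mat.mul g f m'' m ≠ 0) : ∃ m', g m'' m' ≠ 0 ∧ f m' m ≠ 0 := by
  by_contra! h'
  refine h (Finset.sum_eq_zero fun m' _ => ?_)
  by_cases hg : g m'' m' = 0
  · simp [hg]
  · simp [h' m' hg]

theorem IsTop.braid1_mul {j l : Fin (N + 1)} {f : Mat k N} (hf : IsTop i j l f) (q : Fin (N + 1))
    (b : H k) : IsTop i j q (Mat.mul (braid1 i l q b) f) := by
  intro m'' m h
  obtain ⟨m', h1, h2⟩ := Mat.exists_of_mul_ne_zero h
  have h3 := hf m' m h2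
  refine ⟨h3.1, ?_⟩
  unfold braid1 at h1
  simp only [Fin.ext_iff] at *
  split_ifs at h1 <;> first | exact absurd rfl h1 | omega

theorem IsBot.braid1_mul {j l : Fin (N + 1)} {f : Mat k N} (hf : IsBot i j l f) (q : Fin (N + 1))
    (b : H k) : IsBot i j q (Mat.mul (braid1 i l q b) f) := by
  intro m'' m h
  obtain ⟨m', h1, h2⟩ := Mat.exists_of_mul_ne_zero h
  have h3 := hf m' m h2
  refine ⟨h3.1, ?_⟩
  unfold braid1 at h1
  simp only [Fin.ext_iff] at *
  split_ifs at h1 <;> first | exact absurd rfl h1 | omega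

theorem IsTop.braid2_mul {x j : Fin (N + 1)} {f : Mat k N} (hf : IsTop i x j f)
    (l q : Fin (N + 1)) (b a : H k) : IsBot i x q (Mat.mul (braid2 i j l q b a) f) := by
  intro m'' m h
  obtain ⟨m', h1, h2⟩ := Mat.exists_of_mul_ne_zero h
  have h3 := hf m' m h2
  refine ⟨h3.1, ?_⟩
  unfold braid2 at h1
  split_ifs at h1 with h4
  · exact ⟨h4.1, h4.2.2.1⟩
  · exact absurd rfl h1

/-- The only nonzero columns of `β^2` are `j ≠ i` and a neighbour of `i`, never `T_i` itself. -/
theorem IsBot.braid2_mul {x j : Fin (N + 1)} {f : Mat k N} (hf : IsBot i x j f)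
    (l q : Fin (N + 1)) (b a : H k) : Mat.mul (braid2 i j l q b a) f = 0 := by
  funext m'' m
  by_contra h
  obtain ⟨m', h1, h2⟩ := Mat.exists_of_mul_ne_zero h
  have h3 := hf m' m h2
  unfold braid2 at h1
  split_ifs at h1 with h4
  · rcases h4.2.2.2 with h5 | h5
    · exact h5.1 h3.2.1
    · rw [h3.2.2, left_eq_add, Int.sign_eq_zero_iff_zero] at h5
      exact h4.2.1 (Fin.ext (by omega))
  · exact absurd rfl h1

/-! #### The differential of `β T_l` -/

theorem diff_mul (l : Fin (N + 1)) (f : Mat k N) (m'' m : Fin (N + 1)) :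
    Mat.mul (braidObj k i l).diff f m'' m =
      if l = i then
        if (m'' : ℕ) + 1 = i then comp k m i m'' (single 0 1) (f i m)
        else if (i : ℕ) + 1 = m'' then -comp k m i m'' (single 0 1) (f i m) else 0
      else 0 := by
  unfold braidObj
  split_ifs with h1 h2 h3
  · rw [Mat.mul, Finset.sum_eq_single i]
    · simp [h2]
    · intro b _ hb
      simp [hb]
    · simp
  · rw [Mat.mul, Finset.sum_eq_single i]
    · simp [h2, h3]
    · intro b _ hb
      simp [hb]
    · simp
  · simp [Mat.mul, h2, h3]
  · simp [Mat.mul, gen]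

theorem IsTop.diff_mul {j l : Fin (N + 1)} {f : Mat k N} (hf : IsTop i j l f) :
    Mat.mul (braidObj k i l).diff f = 0 := by
  funext m'' m
  rw [KLRW.diff_mul]
  by_cases hl : l = i
  · have : f i m = 0 := by
      by_contra h
      have := (hf i m h).2.2 hl
      omega
    simp [this]
  · rw [if_neg hl]
    rfl

theorem IsBot.diff_mul {j l : Fin (N + 1)} {f : Mat k N} (hf : IsBot i j l f) :
    IsTop i j l (Mat.mul (braidObj k i l).diff f) := by
  intro m'' m h
  rw [KLRW.diff_mul] at h
  split_ifs at h with h1 h2 h3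
  · exact ⟨(hf i m fun h0 => h (by simp [h0])).1, fun h => absurd h1 h, fun _ => Or.inl h2⟩
  · exact ⟨(hf i m fun h0 => h (by simp [h0])).1, fun h => absurd h1 h, fun _ => Or.inr h3⟩
  · exact absurd rfl h
  · exact absurd rfl h

/-! #### The left action through `β^1` -/

theorem braid1_mul_of_ne {l q : Fin (N + 1)} (hl : l ≠ i) (hq : q ≠ i) (b : H k) (f : Mat k N)
    (m'' m : Fin (N + 1)) :
    Mat.mul (braid1 i l q b) f m'' m = if m'' = q then comp k m l q b (f l m) else 0 := by
  rw [Mat.mul, Finset.sum_eq_single l]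
  · by_cases h : m'' = q
    · subst h
      simp [braid1, hl, hq]
    · simp [braid1, hl, hq, h]
  · intro m' _ h
    simp [braid1, hl, hq, h]
  · simp

theorem braid1_mul_to {l : Fin (N + 1)} (hl : l ≠ i) (b : H k) (f : Mat k N)
    (m'' m : Fin (N + 1)) :
    Mat.mul (braid1 i l i b) f m'' m =
      if (l < i ∧ (m'' : ℕ) + 1 = i) ∨ (i < l ∧ (i : ℕ) + 1 = m'')
      then comp k m l m'' b (f l m) else 0 := by
  rw [Mat.mul, Finset.sum_eq_single l]
  · simp only [braid1, hl, ne_eq, not_true, not_false_iff, and_false, and_true, if_false, if_true,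
      true_and]
    split_ifs <;> simp
  · intro m' _ h
    simp [braid1, hl, h]
  · simp

theorem braid1_mul_from (him : (im : ℕ) + 1 = i) (hip : (i : ℕ) + 1 = ip) {q : Fin (N + 1)}
    (hq : q ≠ i) (b : H k) (f : Mat k N) (m'' m : Fin (N + 1)) :
    Mat.mul (braid1 i i q b) f m'' m =
      if m'' = q then
        comp k m im q (if i < q then b else mapDomain (fun α => α + 1) b) (f im m) +
        comp k m ip q (if i < q then mapDomain (fun α => α + 1) b else b) (f ip m)
      else 0 := by
  by_cases h : m'' = q
  · subst h
    have hne : im ≠ ip := by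
      rw [ne_eq, Fin.ext_iff]
      omega
    have h0 : ¬ ((ip : ℕ) + 1 = i) := by omega
    rw [Mat.mul, if_pos rfl, ← Finset.sum_subset (Finset.subset_univ {im, ip}),
      Finset.sum_pair hne]
    · simp only [braid1, hq, ne_eq, not_true, not_false_iff, and_false, and_true,
        if_false, if_true, true_and, him, hip, h0]
    · intro x _ hx
      simp only [Finset.mem_insert, Finset.mem_singleton, not_or, Fin.ext_iff] at hx
      have h1 : ¬ ((x : ℕ) + 1 = i) := by omega
      have h2 : ¬ ((i : ℕ) + 1 = x) := by omega
      simp [braid1, hq, h1, h2]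
  · rw [if_neg h]
    simp [Mat.mul, braid1, hq, h]

theorem braid1_mul_self (b : H k) (f : Mat k N) (m'' m : Fin (N + 1)) :
    Mat.mul (braid1 i i i b) f m'' m =
      if m'' = i ∨ (m'' : ℕ) + 1 = i ∨ (i : ℕ) + 1 = m'' then comp k m m'' m'' b (f m'' m)
      else 0 := by
  rw [Mat.mul, Finset.sum_eq_single m'']
  · simp only [braid1, ne_eq, not_true, false_and, and_false, if_false, true_and]
    split_ifs <;> simp
  · intro m' _ h
    simp [braid1, h.symm]
  · simp

end Braiding

end
end KLRW

namespace KLRW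
open Finsupp
noncomputable section

/-! ### The projection of `β` onto the bimodule -/

section Projection

variable {k : Type*} [Field k] {N : ℕ} {i im ip : Fin (N + 1)}

theorem toPoly_single_zero_one : toPoly k (single 0 1) = 1 := by
  simp [toPoly_single]

/-- The map from the part of degree `0` of the morphisms from `T_j` to `β T_l` onto
`𝔅_{i^-}(T_j, T_l)`, viewed in the morphisms from `T_j` to `T_l`. -/
def proj (k : Type*) [Field k] (i im ip j l : Fin (N + 1)) : Mat k N →ₗ[k] H k where
  toFun f := if l = i then comp k j im i (single 0 1) (f im j) + comp k j ip i (single 0 1) (f ip j)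
    else f l j
  map_add' f g := by
    split_ifs
    · simp only [Pi.add_apply, map_add]
      abel
    · rfl
  map_smul' c f := by
    split_ifs
    · simp only [Pi.smul_apply, map_smul, smul_add, RingHom.id_apply]
    · rfl

theorem proj_apply (j l : Fin (N + 1)) (f : Mat k N) : proj k i im ip j l f =
    if l = i then comp k j im i (single 0 1) (f im j) + comp k j ip i (single 0 1) (f ip j)
    else f l j := rfl

/-- Going from `T_i` to a neighbour and back costs one dot on either side, and the two components of
the differential have opposite signs. -/
theorem proj_diff_mul (him : (im : ℕ) + 1 = i) (hip : (i : ℕ) + 1 = ip) (j l : Fin (N + 1))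
    (f : Mat k N) : proj k i im ip j l (Mat.mul (braidObj k i l).diff f) = 0 := by
  rw [proj_apply]
  by_cases hl : l = i
  · have h0 : ¬ ((ip : ℕ) + 1 = i) := by omega
    simp only [hl, if_true, diff_mul, him, hip, h0, if_false]
    apply toPoly_injective
    simp only [map_add, map_neg, toPoly_comp, toPoly_single_zero_one, map_zero]
    have h1 := two_mul_delta j i im
    have h2 := two_mul_delta j im i
    have h3 := two_mul_delta j i ip
    have h4 := two_mul_delta j ip i
    have h5 : delta j i im + delta j im i = 1 := by omega
    have h6 : delta j i ip + delta j ip i = 1 := by omega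
    simp only [one_mul, _root_.mul_assoc, ← pow_add, h5, h6, add_neg_cancel]
  · rw [if_neg hl, diff_mul, if_neg hl]

theorem proj_mul_incl (x j l : Fin (N + 1)) (f : Mat k N) (b : H k) :
    proj k i im ip x l (Mat.mul f (incl k x j b)) =
      comp k x j l (proj k i im ip j l f) b := by
  rw [proj_apply, proj_apply]
  simp only [Mat.mul_incl, if_true]
  split_ifs with hl
  · subst hl
    rw [comp_assoc, comp_assoc, map_add, LinearMap.add_apply]
  · rfl

/-- The additional dot in `β^1 (a_{li})` is the one created by the composite of `a_{li}` with
`a_{i,i+1}` or `a_{i,i-1}` when the strand turns back. So the projection respects the left action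
strictly, although `β^1` is not multiplicative. -/
theorem proj_braid1_mul (him : (im : ℕ) + 1 = i) (hip : (i : ℕ) + 1 = ip) (j l q : Fin (N + 1))
    (b : H k) (f : Mat k N) :
    proj k i im ip j q (Mat.mul (braid1 i l q b) f) =
      comp k j l q b (proj k i im ip j l f) := by
  rw [proj_apply, proj_apply]
  by_cases hl : l = i <;> by_cases hq : q = i
  · subst hl hq
    have h1 := two_mul_delta j im q
    have h2 := two_mul_delta j ip q
    simp only [if_true, braid1_mul_self, him, hip, true_or, or_true]
    apply toPoly_injective
    simp only [map_add, toPoly_comp, toPoly_single_zero_one, delta_self_right]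
    ring
  · subst hl
    rw [if_neg hq, if_pos rfl, braid1_mul_from him hip hq, if_pos rfl]
    have hq' : (q : ℕ) ≠ l := fun h => hq (Fin.ext h)
    have h1 := two_mul_delta j im q
    have h2 := two_mul_delta j ip q
    have h3 := two_mul_delta j im l
    have h4 := two_mul_delta j ip l
    have h5 := two_mul_delta j l q
    apply toPoly_injective
    by_cases h : l < q
    · have h' : (l : ℕ) < q := h
      have e1 : delta j im q = delta j im l + delta j l q := by omega
      have e2 : delta j ip q + 1 = delta j ip l + delta j l q := by omega
      simp only [h, if_true, map_add, toPoly_comp, toPoly_single_zero_one, toPoly_mapDomain_succ]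
      have e3 : ∀ P : Polynomial k, toPoly k b * Polynomial.X * P * Polynomial.X ^ delta j ip q =
          toPoly k b * P * Polynomial.X ^ (delta j ip q + 1) := by
        intro P
        ring
      rw [e3, e1, e2]
      ring
    · have h' : ¬ (l : ℕ) < q := h
      have e1 : delta j im q + 1 = delta j im l + delta j l q := by omega
      have e2 : delta j ip q = delta j ip l + delta j l q := by omega
      simp only [h, if_false, map_add, toPoly_comp, toPoly_single_zero_one, toPoly_mapDomain_succ]
      have e3 : ∀ P : Polynomial k, toPoly k b * Polynomial.X * P * Polynomial.X ^ delta j im q =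
          toPoly k b * P * Polynomial.X ^ (delta j im q + 1) := by
        intro P
        ring
      rw [e3, e1, e2]
      ring
  · subst hq
    rw [if_neg hl, if_pos rfl, braid1_mul_to hl, braid1_mul_to hl]
    have hl' : (l : ℕ) ≠ q := fun h => hl (Fin.ext h)
    have h1 := two_mul_delta j l im
    have h2 := two_mul_delta j l ip
    have h3 := two_mul_delta j im q
    have h4 := two_mul_delta j ip q
    have h5 := two_mul_delta j l q
    have h0 : ¬ ((ip : ℕ) + 1 = q) := by omega
    have h0' : ¬ ((ip : ℕ) = im) := by omega
    apply toPoly_injective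
    by_cases h : l < q
    · have h' : (l : ℕ) < q := h
      have h'' : ¬ (q < l) := not_lt_of_gt h
      simp only [h, h'', h0, him, true_and, false_and, or_false, if_true, if_false, map_add,
        map_zero, toPoly_comp, toPoly_single_zero_one]
      have e1 : delta j l q = delta j l im + delta j im q := by omega
      rw [e1]
      ring
    · have h'' : q < l := lt_of_le_of_ne (not_lt.1 h) (Ne.symm hl)
      have h' : (q : ℕ) < l := h''
      simp only [h, h'', h0', hip, true_and, false_and, or_self, or_true, if_true, if_false, map_add,
        map_zero, toPoly_comp, toPoly_single_zero_one]
      have e1 : delta j l q = delta j l ip + delta j ip q := by omega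
      rw [e1]
      ring
  · rw [if_neg hl, if_neg hq, braid1_mul_of_ne hl hq, if_pos rfl]

theorem proj_mem (him : (im : ℕ) + 1 = i) (hip : (i : ℕ) + 1 = ip) (j l : Fin (N + 1))
    (f : Mat k N) : proj k i im ip j l f ∈ Bim.image k i j l := by
  intro hj hl
  subst hj hl
  have h1 := two_mul_delta l im l
  have h2 := two_mul_delta l ip l
  have e1 : delta l im l = 1 := by omega
  have e2 : delta l ip l = 1 := by omega
  rw [proj_apply, if_pos rfl, ← coeff_toPoly]
  simp only [map_add, toPoly_comp, toPoly_single_zero_one, e1, e2, pow_one, Polynomial.coeff_add,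
    Polynomial.coeff_mul_X_zero, add_zero]

/-- Division by the dot. -/
def divDot (k : Type*) [Field k] : H k →ₗ[k] H k :=
  Finsupp.lcomapDomain (fun α => α + 1) (add_left_injective 1)

theorem toPoly_divDot {z : H k} (hz : z 0 = 0) : toPoly k (divDot k z) * Polynomial.X = toPoly k z := by
  ext n
  cases n with
  | zero => rw [Polynomial.coeff_mul_X_zero, coeff_toPoly, hz]
  | succ n =>
    rw [Polynomial.coeff_mul_X, coeff_toPoly, coeff_toPoly]
    rfl

/-- A section of the projection. -/
def sect (k : Type*) [Field k] (i im ip j l : Fin (N + 1)) : H k →ₗ[k] Mat k N :=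
  LinearMap.pi fun m' => LinearMap.pi fun m =>
    if m = j then
      if l = i then
        if j = i then if m' = im then divDot k else 0
        else if (j < i ∧ m' = im) ∨ (i < j ∧ m' = ip) then LinearMap.id else 0
      else if m' = l then LinearMap.id else 0
    else 0

theorem sect_isTop (him : (im : ℕ) + 1 = i) (hip : (i : ℕ) + 1 = ip) (j l : Fin (N + 1))
    (z : H k) : IsTop i j l (sect k i im ip j l z) := by
  intro m' m h
  simp only [sect, LinearMap.pi_apply] at h
  simp only [Fin.ext_iff] at *
  split_ifs at h <;> first | exact absurd rfl h | omega

/-- For `j ≠ i` the neighbour of `i` on the side of `j` lies on the way to `i`, so no dot is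
created. For `j = i` the detour creates a dot, which `divDot` removes in advance. -/
theorem proj_sect (him : (im : ℕ) + 1 = i) (hip : (i : ℕ) + 1 = ip) {j l : Fin (N + 1)}
    {z : H k} (hz : z ∈ Bim.image k i j l) :
    proj k i im ip j l (sect k i im ip j l z) = z := by
  have hne : im ≠ ip := by
    rw [ne_eq, Fin.ext_iff]
    omega
  rw [proj_apply]
  simp only [sect, LinearMap.pi_apply, if_true]
  by_cases hl : l = i
  · subst hl
    have h1 := two_mul_delta j im l
    have h2 := two_mul_delta j ip l
    by_cases hj : j = l
    · subst hj
      have e1 : delta j im j = 1 := by omega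
      simp only [if_true, hne.symm, if_false]
      apply toPoly_injective
      simp only [toPoly_comp, toPoly_single_zero_one, e1, pow_one, LinearMap.zero_apply,
        map_zero, add_zero, one_mul]
      exact toPoly_divDot (hz rfl rfl)
    · have hj' : (j : ℕ) ≠ l := fun h => hj (Fin.ext h)
      simp only [if_true, hj, if_false, hne, hne.symm, and_true, and_false, or_false, false_or]
      apply toPoly_injective
      by_cases h : j < l
      · have h' : (j : ℕ) < l := h
        have e1 : delta j im l = 0 := by omega
        simp [h, not_lt_of_gt h, toPoly_comp, toPoly_single_zero_one, e1]
      · have h'' : l < j := lt_of_le_of_ne (not_lt.1 h) (Ne.symm hj)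
        have h' : (l : ℕ) < j := h''
        have e1 : delta j ip l = 0 := by omega
        simp [h, h'', toPoly_comp, toPoly_single_zero_one, e1]
  · simp [hl]

/-- A homotopy which contracts the kernel of the projection. -/
def lower (k : Type*) [Field k] (i im ip j l : Fin (N + 1)) : Mat k N →ₗ[k] Mat k N where
  toFun f := fun m' m => if m = j ∧ l = i ∧ m' = i then if j < i then -f ip j else f im j else 0
  map_add' f g := by
    funext m' m
    simp only [Pi.add_apply]
    split_ifs
    · exact neg_add _ _
    · rfl
    · exact (add_zero _).symm
  map_smul' c f := by
    funext m' m
    simp only [Pi.smul_apply, RingHom.id_apply]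
    split_ifs
    · exact (smul_neg _ _).symm
    · rfl
    · exact (smul_zero _).symm

theorem lower_isBot (j l : Fin (N + 1)) (f : Mat k N) :
    IsBot i j l (lower k i im ip j l f) := by
  intro m' m h
  simp only [lower, LinearMap.coe_mk, AddHom.coe_mk] at h
  by_contra h'
  exact h (if_neg h')

/-- For `j ≠ i`, `lower` reads the component at the neighbour of `i` on the side away from `j`, for
`j = i` at the left one. There the differential creates no dot and can be undone, up to its sign. -/
theorem lower_diff_mul (him : (im : ℕ) + 1 = i) (hip : (i : ℕ) + 1 = ip) {j l : Fin (N + 1)}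
    {f : Mat k N} (hf : IsBot i j l f) :
    lower k i im ip j l (Mat.mul (braidObj k i l).diff f) = f := by
  funext m' m
  simp only [lower, LinearMap.coe_mk, AddHom.coe_mk]
  by_cases h : m = j ∧ l = i ∧ m' = i
  · rw [if_pos h]
    obtain ⟨rfl, rfl, rfl⟩ := h
    have h0 : ¬ ((ip : ℕ) + 1 = m') := by omega
    have h1 := two_mul_delta m m' im
    have h2 := two_mul_delta m m' ip
    simp only [diff_mul, if_true, h0, him, hip, if_false, neg_neg]
    apply toPoly_injective
    by_cases h : m < m'
    · have h' : (m : ℕ) < m' := h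
      have e1 : delta m m' ip = 0 := by omega
      simp [h, toPoly_comp, toPoly_single_zero_one, e1]
    · have h' : ¬ (m : ℕ) < m' := h
      have e1 : delta m m' im = 0 := by omega
      simp [h, toPoly_comp, toPoly_single_zero_one, e1]
  · rw [if_neg h]
    by_contra h'
    exact h (hf m' m (Ne.symm h'))

/-- Exactness in the middle: one component is right by the construction of `lower`, the other is
forced by the vanishing of the projection. -/
theorem diff_mul_lower (him : (im : ℕ) + 1 = i) (hip : (i : ℕ) + 1 = ip) {j l : Fin (N + 1)}
    {f : Mat k N} (hf : IsTop i j l f) (h0 : proj k i im ip j l f = 0) :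
    Mat.mul (braidObj k i l).diff (lower k i im ip j l f) = f := by
  have hne : ¬ ((ip : ℕ) + 1 = i) := by omega
  funext m'' m
  rw [diff_mul]
  by_cases hm : m = j
  swap
  · have h1 : f m'' m = 0 := by
      by_contra h
      exact hm (hf _ _ h).1
    simp [lower, hm, h1]
  subst hm
  rw [proj_apply] at h0
  by_cases hl : l = i
  swap
  · rw [if_neg hl] at h0 ⊢
    by_contra h
    have h1 := (hf m'' m (Ne.symm h)).2.1 hl
    rw [h1] at h
    exact h h0.symm
  subst hl
  rw [if_pos rfl] at h0 ⊢
  simp only [lower, LinearMap.coe_mk, AddHom.coe_mk, and_true, if_true]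
  replace h0 := congrArg (toPoly k) h0
  simp only [map_add, toPoly_comp, toPoly_single_zero_one, one_mul, map_zero] at h0
  have h1 := two_mul_delta m im l
  have h2 := two_mul_delta m ip l
  have h3 := two_mul_delta m l im
  have h4 := two_mul_delta m l ip
  by_cases h5 : (m'' : ℕ) + 1 = l
  · obtain rfl : m'' = im := Fin.ext (by omega)
    rw [if_pos h5]
    apply toPoly_injective
    by_cases h : m < l
    · have h' : (m : ℕ) < l := h
      have e1 : delta m m'' l = 0 := by omega
      have e2 : delta m ip l = 1 := by omega
      have e3 : delta m l m'' = 1 := by omega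
      rw [e1, e2, pow_zero, mul_one, pow_one] at h0
      simp only [h, if_true, toPoly_comp, toPoly_single_zero_one, map_neg, e3]
      linear_combination -h0
    · have h' : ¬ (m : ℕ) < l := h
      have e1 : delta m l m'' = 0 := by omega
      simp [h, toPoly_comp, toPoly_single_zero_one, e1]
  · rw [if_neg h5]
    by_cases h6 : (l : ℕ) + 1 = m''
    · obtain rfl : m'' = ip := Fin.ext (by omega)
      rw [if_pos h6]
      apply toPoly_injective
      by_cases h : m < l
      · have h' : (m : ℕ) < l := h
        have e1 : delta m l m'' = 0 := by omega
        simp [h, toPoly_comp, toPoly_single_zero_one, e1]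
      · simp only [h, if_false, toPoly_comp, toPoly_single_zero_one, map_neg]
        by_cases h7 : l = m
        · subst h7
          have e1 : delta l im l = 1 := by omega
          have e2 : delta l m'' l = 1 := by omega
          have e3 : delta l l m'' = 0 := by omega
          rw [e1, e2, ← add_mul, pow_one] at h0
          -- When both ends are at `T_i` the hypothesis only bounds the sum of the components after
          -- multiplication by the dot; polynomials have no zero divisors.
          have h8 := (mul_eq_zero.1 h0).resolve_right Polynomial.X_ne_zero
          rw [e3]
          linear_combination -h8
        · have h' : (l : ℕ) < m := lt_of_le_of_ne (not_lt.1 h) (fun h => h7 (Fin.ext h))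
          have e1 : delta m im l = 1 := by omega
          have e2 : delta m m'' l = 0 := by omega
          have e3 : delta m l m'' = 1 := by omega
          rw [e1, e2] at h0
          rw [e3]
          linear_combination -h0
    · rw [if_neg h6]
      by_contra h
      have := (hf m'' m (Ne.symm h)).2.2 rfl
      omega

end Projection

end
end KLRW

namespace KLRW
open Finsupp
noncomputable section

/-! ### The functor equations of `β` -/

section Functor

variable {k : Type*} [Field k] {N : ℕ} {i im ip : Fin (N + 1)}

/-- The left side projects to zero, so it is the differential of its image under `lower`, and it
suffices to identify that image. -/
theorem braid1_mul_diff_mul (him : (im : ℕ) + 1 = i) (hip : (i : ℕ) + 1 = ip) {j l : Fin (N + 1)}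
    (q : Fin (N + 1)) (b : H k) {f : Mat k N} (hf : IsBot i j l f) :
    Mat.mul (braid1 i l q b) (Mat.mul (braidObj k i l).diff f) =
      Mat.mul (braidObj k i q).diff (Mat.mul (braid1 i l q b) f) := by
  have h1 := (hf.diff_mul).braid1_mul q b
  have h2 : proj k i im ip j q (Mat.mul (braid1 i l q b) (Mat.mul (braidObj k i l).diff f)) = 0 := by
    rw [proj_braid1_mul him hip, proj_diff_mul him hip, map_zero]
  rw [← diff_mul_lower him hip h1 h2]
  congr 1
  funext m' m
  by_cases h : m = j ∧ q = i ∧ m' = i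
  · obtain ⟨rfl, rfl, rfl⟩ := h
    by_cases hl : l = m'
    · subst hl
      have h0 : ¬ ((ip : ℕ) + 1 = l) := by omega
      have e1 := two_mul_delta m l im
      have e2 := two_mul_delta m l ip
      simp only [lower, LinearMap.coe_mk, AddHom.coe_mk, and_self, if_true, braid1_mul_self, him, hip,
        or_true, true_or, diff_mul, h0, if_false]
      apply toPoly_injective
      by_cases hm : m < l
      · have h' : (m : ℕ) < l := hm
        have e3 : delta m l ip = 0 := by omega
        simp [hm, toPoly_comp, toPoly_single_zero_one, e3]
      · have h' : ¬ (m : ℕ) < l := hm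
        have e3 : delta m l im = 0 := by omega
        simp [hm, toPoly_comp, toPoly_single_zero_one, e3]
    · have hf0 : f = 0 := by
        funext m₁ m₂
        by_contra h
        exact hl (hf m₁ m₂ h).2.1
      simp [hf0, Mat.mul_zero]
  · have e1 := lower_isBot (i := i) (im := im) (ip := ip) j q
      (Mat.mul (braid1 i l q b) (Mat.mul (braidObj k i l).diff f)) m' m
    have e2 := hf.braid1_mul q b m' m
    rw [not_imp_comm.1 e1 h, not_imp_comm.1 e2 h]

theorem braid2_mul_of_ne {j l : Fin (N + 1)} (hj : j ≠ i) (hl : l ≠ i) (b a : H k) (f : Mat k N)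
    (m : Fin (N + 1)) :
    Mat.mul (braid2 i j l i b a) f i m =
      if (l < i ∧ i < j) ∨ (i < l ∧ j < i) then
        comp k m j i ((((i : ℤ) - (l : ℤ)).sign : k) •
          conv k (((i : ℤ) - (l : ℤ)).natAbs - 1) b a) (f j m)
      else 0 := by
  have hs : ((i : ℤ) - (j : ℤ)) * ((i : ℤ) - (l : ℤ)) < 0 ↔ (l < i ∧ i < j) ∨ (i < l ∧ j < i) := by
    rw [mul_neg_iff]
    simp only [Fin.lt_def]
    omega
  rw [Mat.mul, Finset.sum_eq_single j]
  · simp only [braid2, hj, hl, hs, ne_eq, not_false_iff, true_and, and_true, false_and, or_false]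
    split_ifs <;> simp
  · intro m' _ h
    simp [braid2, hj, h]
  · simp

theorem braid2_mul_from (him : (im : ℕ) + 1 = i) (hip : (i : ℕ) + 1 = ip) {l : Fin (N + 1)}
    (hl : l ≠ i) (b a : H k) (f : Mat k N) (m : Fin (N + 1)) :
    Mat.mul (braid2 i i l i b a) f i m =
      if l < i then comp k m ip i (conv k ((i : ℕ) - l - 1) b a) (f ip m)
      else -comp k m im i (conv k ((l : ℕ) - i - 1) b a) (f im m) := by
  have hl' : (l : ℕ) ≠ i := fun h => hl (Fin.ext h)
  split_ifs with h
  · have h' : (l : ℕ) < i := h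
    have e1 : ((i : ℤ) - (l : ℤ)).sign = 1 := Int.sign_eq_one_of_pos (by omega)
    have e2 : ((i : ℤ) - (l : ℤ)).natAbs - 1 = (i : ℕ) - l - 1 := by omega
    rw [Mat.mul, Finset.sum_eq_single ip]
    · have e3 : (ip : ℤ) = (i : ℤ) + 1 := by omega
      simp [braid2, hl, e1, e2, e3]
    · intro m' _ hm
      have e3 : ¬ (m' : ℤ) = (i : ℤ) + 1 := fun h => hm (Fin.ext (by omega))
      simp [braid2, e1, e3]
    · simp
  · have h' : ¬ (l : ℕ) < i := h
    have e1 : ((i : ℤ) - (l : ℤ)).sign = -1 := Int.sign_eq_neg_one_of_neg (by omega)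
    have e2 : ((i : ℤ) - (l : ℤ)).natAbs - 1 = (l : ℕ) - i - 1 := by omega
    rw [Mat.mul, Finset.sum_eq_single im]
    · have e3 : (im : ℤ) = (i : ℤ) + -1 := by omega
      simp [braid2, hl, e1, e2, e3]
    · intro m' _ hm
      have e3 : ¬ (m' : ℤ) = (i : ℤ) + -1 := fun h => hm (Fin.ext (by omega))
      simp [braid2, e1, e3]
    · simp

/-- The defect of multiplicativity of `β^1`, contracted. -/
theorem lower_braid1_self (him : (im : ℕ) + 1 = i) (hip : (i : ℕ) + 1 = ip)
    (x j : Fin (N + 1)) (b a : H k) (f : Mat k N) :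
    lower k i im ip x i (Mat.mul (braid1 i i i b) (Mat.mul (braid1 i j i a) f) -
      Mat.mul (braid1 i j i (comp k j i i b a)) f) i x =
      Mat.mul (braid2 i j i i b a) f i x := by
  have n1 : ¬ ((ip : ℕ) + 1 = i) := by omega
  have n2 : ¬ ((ip : ℕ) = im) := by omega
  simp only [lower, LinearMap.coe_mk, AddHom.coe_mk, and_self, if_true, Pi.sub_apply]
  have e0 : Mat.mul (braid2 i j i i b a) f i x = 0 := by
    simp [Mat.mul, braid2]
  rw [e0]
  by_cases hj : j = i
  · subst hj
    simp only [braid1_mul_self, him, hip, true_or, or_true, if_true]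
    apply toPoly_injective
    split_ifs <;> simp only [map_neg, map_sub, map_zero, toPoly_comp, delta_self_right] <;> ring
  · simp only [braid1_mul_self, braid1_mul_to hj, him, hip, or_true, if_true, n1, n2,
      and_true, and_false, or_false, false_or]
    apply toPoly_injective
    split_ifs <;> simp only [map_neg, map_sub, map_zero, toPoly_comp, delta_self_right] <;> ring

set_option linter.unusedSimpArgs false in
-- From `T_i` to `T_l` and back, the two factors land only in the neighbour of `i` on the side of
-- `l`, whereas `β^1` of the composite acts diagonally on both neighbours. The mismatch is what
-- `β^2` has to correct.
theorem lower_braid1_from (him : (im : ℕ) + 1 = i) (hip : (i : ℕ) + 1 = ip)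
    (x : Fin (N + 1)) {l : Fin (N + 1)} (hl : l ≠ i) (b a : H k) (f : Mat k N) :
    lower k i im ip x i (Mat.mul (braid1 i l i b) (Mat.mul (braid1 i i l a) f) -
      Mat.mul (braid1 i i i (comp k i l i b a)) f) i x =
      Mat.mul (braid2 i i l i b a) f i x := by
  have hl' : (l : ℕ) ≠ i := fun h => hl (Fin.ext h)
  have n1 : ¬ ((ip : ℕ) + 1 = i) := by omega
  have n2 : ¬ ((ip : ℕ) = im) := by omega
  simp only [lower, LinearMap.coe_mk, AddHom.coe_mk, and_self, if_true, Pi.sub_apply]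
  rw [braid2_mul_from him hip hl]
  simp only [braid1_mul_self, braid1_mul_to hl, braid1_mul_from him hip hl, him, hip, true_or,
    or_true, if_true, n1, n2, and_true, and_false, or_false, false_or]
  have d1 := two_mul_delta x l im
  have d2 := two_mul_delta x l ip
  have d3 := two_mul_delta x im l
  have d4 := two_mul_delta x ip l
  have d5 := two_mul_delta x im i
  have d6 := two_mul_delta x ip i
  have d7 := two_mul_delta i l i
  apply toPoly_injective
  by_cases h : l < i <;> by_cases hx : x < i
  · have h' : (l : ℕ) < i := h
    have hx' : (x : ℕ) < i := hx
    have e1 : delta i l i = (i : ℕ) - l - 1 + 1 := by omega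
    have e2 : delta x ip i = 1 := by omega
    simp only [h, hx, not_lt_of_gt h, if_true, if_false, map_zero, map_neg, map_sub, toPoly_comp,
      toPoly_conv, delta_self_right, e1, e2]
    ring
  · have h' : (l : ℕ) < i := h
    have hx' : ¬ (x : ℕ) < i := hx
    have e1 : delta i l i = delta x l im + delta x im l + 1 := by omega
    have e2 : (i : ℕ) - l - 1 = delta x l im + delta x im l := by omega
    have e3 : delta x ip l = delta x im l + delta x ip i := by omega
    simp only [h, hx, not_lt_of_gt h, if_true, if_false, map_add, map_sub, toPoly_comp,
      toPoly_conv, toPoly_mapDomain_succ, delta_self_right, e1, e2, e3]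
    ring
  · have h2 : i < l := lt_of_le_of_ne (not_lt.1 h) (Ne.symm hl)
    have h' : (i : ℕ) < l := h2
    have hx' : (x : ℕ) < i := hx
    have e1 : delta i l i = delta x l ip + delta x ip l + 1 := by omega
    have e2 : (l : ℕ) - i - 1 = delta x l ip + delta x ip l := by omega
    have e3 : delta x im l = delta x ip l + delta x im i := by omega
    simp only [h, hx, h2, if_true, if_false, map_add, map_neg, map_sub, toPoly_comp,
      toPoly_conv, toPoly_mapDomain_succ, delta_self_right, e1, e2, e3]
    ring
  · have h2 : i < l := lt_of_le_of_ne (not_lt.1 h) (Ne.symm hl)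
    have h' : (i : ℕ) < l := h2
    have hx' : ¬ (x : ℕ) < i := hx
    have e1 : delta i l i = (l : ℕ) - i - 1 + 1 := by omega
    have e2 : delta x im i = 1 := by omega
    simp only [h, hx, h2, if_true, if_false, map_zero, map_neg, map_sub, toPoly_comp,
      toPoly_conv, delta_self_right, e1, e2]
    ring

set_option linter.unusedSimpArgs false in
set_option maxHeartbeats 800000 in
-- The two factors land in the neighbour on the side of `l`, the composite in the one on the side of
-- `j`. These differ exactly when `i` separates `j` and `l`, the case in which `β^2` is nonzero.
theorem lower_braid1_of_ne (him : (im : ℕ) + 1 = i) (hip : (i : ℕ) + 1 = ip)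
    (x : Fin (N + 1)) {j l : Fin (N + 1)} (hj : j ≠ i) (hl : l ≠ i) (b a : H k) (f : Mat k N) :
    lower k i im ip x i (Mat.mul (braid1 i l i b) (Mat.mul (braid1 i j l a) f) -
      Mat.mul (braid1 i j i (comp k j l i b a)) f) i x =
      Mat.mul (braid2 i j l i b a) f i x := by
  have hl' : (l : ℕ) ≠ i := fun h => hl (Fin.ext h)
  have n1 : ¬ ((ip : ℕ) + 1 = i) := by omega
  have n2 : ¬ ((ip : ℕ) = im) := by omega
  simp only [lower, LinearMap.coe_mk, AddHom.coe_mk, and_self, if_true, Pi.sub_apply]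
  have hj' : (j : ℕ) ≠ i := fun h => hj (Fin.ext h)
  rw [braid2_mul_of_ne hj hl]
  simp only [braid1_mul_to hl, braid1_mul_to hj, braid1_mul_of_ne hj hl, him, hip,
    if_true, n1, n2, and_true, and_false, or_false, false_or]
  have d1 := two_mul_delta x l im
  have d2 := two_mul_delta x l ip
  have d3 := two_mul_delta x j im
  have d4 := two_mul_delta x j ip
  have d5 := two_mul_delta x j l
  have d6 := two_mul_delta x j i
  have d7 := two_mul_delta j l i
  apply toPoly_injective
  have key : ∀ (P : Polynomial k) {r s t u : ℕ}, r + s = t + u →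
      P * Polynomial.X ^ r * Polynomial.X ^ s = P * Polynomial.X ^ t * Polynomial.X ^ u := by
    intro P r s t u h
    rw [mul_assoc, ← pow_add, h, pow_add, mul_assoc]
  have sgn_pos : l < i → ((i : ℤ) - (l : ℤ)).sign = 1 ∧
      ((i : ℤ) - (l : ℤ)).natAbs - 1 = (i : ℕ) - l - 1 := by
    intro h
    have h' : (l : ℕ) < i := h
    exact ⟨Int.sign_eq_one_of_pos (by omega), by omega⟩
  have sgn_neg : i < l → ((i : ℤ) - (l : ℤ)).sign = -1 ∧
      ((i : ℤ) - (l : ℤ)).natAbs - 1 = (l : ℕ) - i - 1 := by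
    intro h
    have h' : (i : ℕ) < l := h
    exact ⟨Int.sign_eq_neg_one_of_neg (by omega), by omega⟩
  rcases lt_or_gt_of_ne hl with h | h <;> rcases lt_or_gt_of_ne hj with h' | h' <;>
    by_cases hx : x < i
  · have r1 : (l : ℕ) < i := h
    have r2 : (j : ℕ) < i := h'
    have r3 : (x : ℕ) < i := hx
    simp only [h, not_lt_of_gt h, h', not_lt_of_gt h', hx, if_true, if_false, and_true, and_false,
      or_false, or_true, or_self, map_zero, map_neg, map_sub, map_smul, toPoly_comp, toPoly_conv, LinearMap.smul_apply]
    ring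
  · have r1 : (l : ℕ) < i := h
    have r2 : (j : ℕ) < i := h'
    have r3 : ¬ (x : ℕ) < i := hx
    simp only [h, not_lt_of_gt h, h', not_lt_of_gt h', hx, if_true, if_false, and_true, and_false,
      or_false, or_true, or_self, map_zero, map_neg, map_sub, map_smul, toPoly_comp, toPoly_conv, LinearMap.smul_apply]
    have e := key (toPoly k b * toPoly k a * toPoly k (f j x)) (show delta x j l + delta x l im = delta j l i + delta x j im by omega)
    linear_combination e
  · have r1 : (l : ℕ) < i := h
    have r2 : (j : ℕ) > i := h'
    have r3 : (x : ℕ) < i := hx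
    simp only [h, not_lt_of_gt h, h', not_lt_of_gt h', hx, if_true, if_false, and_true, and_false,
      or_false, or_true, or_self, map_zero, map_neg, map_sub, map_smul, toPoly_comp, toPoly_conv, LinearMap.smul_apply, (sgn_pos h).1, (sgn_pos h).2]
    have e := key (toPoly k b * toPoly k a * toPoly k (f j x)) (show delta j l i + delta x j ip = ((i : ℕ) - l - 1) + delta x j i by omega)
    simp only [Int.cast_one, Int.cast_neg, one_smul, neg_smul]
    linear_combination e
  · have r1 : (l : ℕ) < i := h
    have r2 : (j : ℕ) > i := h'
    have r3 : ¬ (x : ℕ) < i := hx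
    simp only [h, not_lt_of_gt h, h', not_lt_of_gt h', hx, if_true, if_false, and_true, and_false,
      or_false, or_true, or_self, map_zero, map_neg, map_sub, map_smul, toPoly_comp, toPoly_conv, LinearMap.smul_apply, (sgn_pos h).1, (sgn_pos h).2]
    have e := key (toPoly k b * toPoly k a * toPoly k (f j x)) (show delta x j l + delta x l im = ((i : ℕ) - l - 1) + delta x j i by omega)
    simp only [Int.cast_one, Int.cast_neg, one_smul, neg_smul]
    linear_combination e
  · have r1 : (l : ℕ) > i := h
    have r2 : (j : ℕ) < i := h'
    have r3 : (x : ℕ) < i := hx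
    simp only [h, not_lt_of_gt h, h', not_lt_of_gt h', hx, if_true, if_false, and_true, and_false,
      or_false, or_true, or_self, map_zero, map_neg, map_sub, map_smul, toPoly_comp, toPoly_conv, LinearMap.smul_apply, (sgn_neg h).1, (sgn_neg h).2]
    have e := key (toPoly k b * toPoly k a * toPoly k (f j x)) (show delta x j l + delta x l ip = ((l : ℕ) - i - 1) + delta x j i by omega)
    simp only [Int.cast_one, Int.cast_neg, one_smul, neg_smul]
    linear_combination -e
  · have r1 : (l : ℕ) > i := h
    have r2 : (j : ℕ) < i := h'
    have r3 : ¬ (x : ℕ) < i := hx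
    simp only [h, not_lt_of_gt h, h', not_lt_of_gt h', hx, if_true, if_false, and_true, and_false,
      or_false, or_true, or_self, map_zero, map_neg, map_sub, map_smul, toPoly_comp, toPoly_conv, LinearMap.smul_apply, (sgn_neg h).1, (sgn_neg h).2]
    have e := key (toPoly k b * toPoly k a * toPoly k (f j x)) (show delta j l i + delta x j im = ((l : ℕ) - i - 1) + delta x j i by omega)
    simp only [Int.cast_one, Int.cast_neg, one_smul, neg_smul]
    linear_combination -e
  · have r1 : (l : ℕ) > i := h
    have r2 : (j : ℕ) > i := h'
    have r3 : (x : ℕ) < i := hx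
    simp only [h, not_lt_of_gt h, h', not_lt_of_gt h', hx, if_true, if_false, and_true, and_false,
      or_false, or_true, or_self, map_zero, map_neg, map_sub, map_smul, toPoly_comp, toPoly_conv, LinearMap.smul_apply]
    have e := key (toPoly k b * toPoly k a * toPoly k (f j x)) (show delta x j l + delta x l ip = delta j l i + delta x j ip by omega)
    linear_combination -e
  · have r1 : (l : ℕ) > i := h
    have r2 : (j : ℕ) > i := h'
    have r3 : ¬ (x : ℕ) < i := hx
    simp only [h, not_lt_of_gt h, h', not_lt_of_gt h', hx, if_true, if_false, and_true, and_false,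
      or_false, or_true, or_self, map_zero, map_neg, map_sub, map_smul, toPoly_comp, toPoly_conv, LinearMap.smul_apply]
    ring

/-- The defect of multiplicativity projects to zero, because the projection sees only composition in
`C`. So it is the differential of its image under `lower`, and the preceding case analysis
identifies that image with `β^2`. -/
theorem braid1_mul_braid1_mul (him : (im : ℕ) + 1 = i) (hip : (i : ℕ) + 1 = ip)
    {x j : Fin (N + 1)} (l q : Fin (N + 1)) (b a : H k) {f : Mat k N} (hf : IsTop i x j f) :
    Mat.mul (braid1 i l q b) (Mat.mul (braid1 i j l a) f) =
      Mat.mul (braid1 i j q (comp k j l q b a)) f +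
        Mat.mul (braidObj k i q).diff (Mat.mul (braid2 i j l q b a) f) := by
  rw [← sub_eq_iff_eq_add']
  set D := Mat.mul (braid1 i l q b) (Mat.mul (braid1 i j l a) f) -
    Mat.mul (braid1 i j q (comp k j l q b a)) f with hD
  have h1 : IsTop i x q D := by
    rw [hD, sub_eq_add_neg, ← neg_one_smul k]
    exact ((hf.braid1_mul l a).braid1_mul q b).add ((hf.braid1_mul q _).smul _)
  have h2 : proj k i im ip x q D = 0 := by
    rw [hD, map_sub, proj_braid1_mul him hip, proj_braid1_mul him hip, proj_braid1_mul him hip,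
      comp_assoc, sub_self]
  rw [← diff_mul_lower him hip h1 h2]
  congr 1
  funext m' m
  by_cases h : m = x ∧ q = i ∧ m' = i
  · obtain ⟨rfl, rfl, rfl⟩ := h
    by_cases hl : l = m'
    · subst hl
      exact lower_braid1_self him hip _ _ _ _ _
    · by_cases hj : j = m'
      · subst hj
        exact lower_braid1_from him hip _ hl _ _ _
      · exact lower_braid1_of_ne him hip _ hj hl _ _ _
  · have e1 := lower_isBot (i := i) (im := im) (ip := ip) x q D m' m
    have e2 := hf.braid2_mul l q b a m' m
    rw [not_imp_comm.1 e1 h, not_imp_comm.1 e2 h]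

end Functor

end
end KLRW

namespace KLRW
open Finsupp
noncomputable section

/-! ### The Hochschild differential with values in `β` -/

section Chains

variable {k : Type*} [Field k] {N : ℕ}

theorem init_mergeObj_castSucc {n : ℕ} (t : Fin n) (X : Fin (n + 3) → Fin (N + 1)) :
    Fin.init (mergeObj t.castSucc X) = mergeObj t (Fin.init X) := by
  funext s
  simp only [mergeObj, Fin.init]
  congr 1
  rw [← Fin.castSucc_succAbove_castSucc]
  rfl

theorem mergeObj_castSucc_last {n : ℕ} (t : Fin n) (X : Fin (n + 3) → Fin (N + 1)) :
    mergeObj t.castSucc X (Fin.last n).castSucc = X (Fin.last (n + 1)).castSucc := by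
  have := congrFun (init_mergeObj_castSucc t X) (Fin.last n)
  rw [mergeObj_last] at this
  exact this

theorem init_mergeHom_castSucc {n : ℕ} (t : Fin n) (X : Fin (n + 3) → Fin (N + 1))
    (a : Fin (n + 2) → H k) :
    Fin.init (mergeHom t.castSucc X a) = mergeHom t (Fin.init X) (Fin.init a) := by
  funext s
  simp only [mergeHom, Fin.init, Fin.contractNth, Fin.val_castSucc]
  rfl

theorem mergeHom_castSucc_last {n : ℕ} (t : Fin n) (X : Fin (n + 3) → Fin (N + 1))
    (a : Fin (n + 2) → H k) :
    mergeHom t.castSucc X a (Fin.last n) = a (Fin.last (n + 1)) := by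
  simp only [mergeHom, Fin.contractNth, Fin.val_castSucc, Fin.val_last]
  rw [if_neg (by omega), if_neg (by omega)]
  rfl

theorem init_mergeObj_last {n : ℕ} (X : Fin (n + 3) → Fin (N + 1)) :
    Fin.init (mergeObj (Fin.last n) X) = Fin.init (Fin.init X) := by
  funext s
  simp only [mergeObj, Fin.init]
  rw [Fin.succAbove_of_castSucc_lt _ _ (by
    simp only [Fin.lt_def, Fin.val_castSucc, Fin.val_succ, Fin.val_last]
    omega)]

theorem init_mergeHom_last {n : ℕ} (X : Fin (n + 3) → Fin (N + 1)) (a : Fin (n + 2) → H k) :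
    Fin.init (mergeHom (Fin.last n) X a) = Fin.init (Fin.init a) := by
  funext s
  simp only [mergeHom, Fin.init, Fin.contractNth, Fin.val_castSucc, Fin.val_last]
  rw [if_pos s.2]

theorem mergeHom_last_last {n : ℕ} (X : Fin (n + 3) → Fin (N + 1)) (a : Fin (n + 2) → H k) :
    mergeHom (Fin.last n) X a (Fin.last n) =
      comp k (X (Fin.last n).castSucc.castSucc) (X (Fin.last (n + 1)).castSucc)
        (X (Fin.last (n + 2))) (a (Fin.last (n + 1))) (a (Fin.last n).castSucc) := by
  simp only [mergeHom, Fin.contractNth, Fin.val_castSucc, Fin.val_last]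
  rw [if_neg (lt_irrefl _), if_pos trivial]
  rfl

end Chains

section Twisted

universe u

variable {k : Type u} [Field k] {N : ℕ} {i im ip : Fin (N + 1)}

/-- Functions on the chains of length `n`, with values in matrices of morphisms. -/
abbrev MFun (k : Type*) [Field k] (N n : ℕ) : Type _ :=
  (Fin (n + 1) → Fin (N + 1)) → (Fin n → H k) → Mat k N

/-- The right action on matrices of morphisms. -/
def Mat.ract (k : Type*) [Field k] (x j : Fin (N + 1)) (b : H k) : Mat k N →ₗ[k] Mat k N where
  toFun f := Mat.mul f (incl k x j b)
  map_add' _ _ := Mat.add_mul _ _ _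
  map_smul' _ _ := Mat.smul_mul _ _ _

/-- The Hochschild differential, where the left action is through `β^1`. -/
def nHoch (i : Fin (N + 1)) (n : ℕ) (φ : MFun k N n) : MFun k N (n + 1) := fun X a =>
  rightDiff (Mat.ract k) n φ X a + (-1 : k) ^ (n + 1) •
    Mat.mul (braid1 i (X (Fin.last n).castSucc) (X (Fin.last (n + 1))) (a (Fin.last n)))
      (φ (Fin.init X) (Fin.init a))

/-- The composition with the differential of `β T_l`. -/
def del (i : Fin (N + 1)) {n : ℕ} (φ : MFun k N n) : MFun k N n := fun X a =>
  Mat.mul (braidObj k i (X (Fin.last n))).diff (φ X a)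

/-- The composition with `β^2`. -/
def postBraid2 (i : Fin (N + 1)) {n : ℕ} (φ : MFun k N n) : MFun k N (n + 2) := fun X a =>
  Mat.mul (braid2 i (X (Fin.last n).castSucc.castSucc) (X (Fin.last (n + 1)).castSucc)
      (X (Fin.last (n + 2))) (a (Fin.last (n + 1))) (a (Fin.last n).castSucc))
    (φ (Fin.init (Fin.init X)) (Fin.init (Fin.init a)))

/-- Functions with values in the morphisms of degree `0`. -/
def TopValued (i : Fin (N + 1)) {n : ℕ} (φ : MFun k N n) : Prop :=
  ∀ X a, IsTop i (X 0) (X (Fin.last n)) (φ X a)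

/-- Functions with values in the morphisms of degree `-1`. -/
def BotValued (i : Fin (N + 1)) {n : ℕ} (φ : MFun k N n) : Prop :=
  ∀ X a, IsBot i (X 0) (X (Fin.last n)) (φ X a)

theorem TopValued.nHoch {n : ℕ} {φ : MFun k N n} (hφ : TopValued i φ) :
    TopValued i (nHoch i n φ) := by
  intro X a
  have h1 := (hφ (Fin.tail X) (Fin.tail a)).mul_incl (X 0) (a 0)
  have h2 : ∀ t : Fin n, IsTop i (X 0) (X (Fin.last (n + 1)))
      ((-1 : k) ^ ((t : ℕ) + 1) • φ (mergeObj t X) (mergeHom t X a)) := by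
    intro t
    have := (hφ (mergeObj t X) (mergeHom t X a)).smul ((-1 : k) ^ ((t : ℕ) + 1))
    rwa [mergeObj_zero, mergeObj_last] at this
  have h3 := ((hφ (Fin.init X) (Fin.init a)).braid1_mul (X (Fin.last (n + 1)))
    (a (Fin.last n))).smul ((-1 : k) ^ (n + 1))
  exact (h1.add (IsTop.sum Finset.univ h2)).add h3

theorem BotValued.nHoch {n : ℕ} {φ : MFun k N n} (hφ : BotValued i φ) :
    BotValued i (nHoch i n φ) := by
  intro X a
  have h1 := (hφ (Fin.tail X) (Fin.tail a)).mul_incl (X 0) (a 0)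
  have h2 : ∀ t : Fin n, IsBot i (X 0) (X (Fin.last (n + 1)))
      ((-1 : k) ^ ((t : ℕ) + 1) • φ (mergeObj t X) (mergeHom t X a)) := by
    intro t
    have := (hφ (mergeObj t X) (mergeHom t X a)).smul ((-1 : k) ^ ((t : ℕ) + 1))
    rwa [mergeObj_zero, mergeObj_last] at this
  have h3 := ((hφ (Fin.init X) (Fin.init a)).braid1_mul (X (Fin.last (n + 1)))
    (a (Fin.last n))).smul ((-1 : k) ^ (n + 1))
  exact (h1.add (IsBot.sum Finset.univ h2)).add h3

theorem TopValued.postBraid2 {n : ℕ} {φ : MFun k N n} (hφ : TopValued i φ) :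
    BotValued i (postBraid2 i φ) := by
  intro X a
  exact (hφ (Fin.init (Fin.init X)) (Fin.init (Fin.init a))).braid2_mul
    (X (Fin.last (n + 1)).castSucc) (X (Fin.last (n + 2))) (a (Fin.last (n + 1)))
    (a (Fin.last n).castSucc)

theorem BotValued.postBraid2 {n : ℕ} {φ : MFun k N n} (hφ : BotValued i φ) :
    postBraid2 i φ = 0 := by
  funext X a
  exact (hφ (Fin.init (Fin.init X)) (Fin.init (Fin.init a))).braid2_mul
    (X (Fin.last (n + 1)).castSucc) (X (Fin.last (n + 2))) (a (Fin.last (n + 1)))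
    (a (Fin.last n).castSucc)

theorem TopValued.del {n : ℕ} {φ : MFun k N n} (hφ : TopValued i φ) : del i φ = 0 := by
  funext X a
  exact (hφ _ _).diff_mul

theorem nHoch_add {n : ℕ} (φ ψ : MFun k N n) : nHoch i n (φ + ψ) = nHoch i n φ + nHoch i n ψ := by
  funext X a
  simp only [nHoch, rightDiff, Pi.add_apply, map_add, smul_add, Finset.sum_add_distrib,
    Mat.mul_add]
  abel

theorem nHoch_smul {n : ℕ} (c : k) (φ : MFun k N n) : nHoch i n (c • φ) = c • nHoch i n φ := by
  funext X a
  simp only [nHoch, rightDiff, Pi.smul_apply, map_smul, smul_add, Finset.smul_sum, Mat.mul_smul,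
    smul_comm c]

theorem del_add {n : ℕ} (φ ψ : MFun k N n) : del i (φ + ψ) = del i φ + del i ψ := by
  funext X a
  exact Mat.mul_add _ _ _

theorem del_smul {n : ℕ} (c : k) (φ : MFun k N n) : del i (c • φ) = c • del i φ := by
  funext X a
  exact Mat.mul_smul _ _ _

theorem nHoch_del (him : (im : ℕ) + 1 = i) (hip : (i : ℕ) + 1 = ip) {n : ℕ} {φ : MFun k N n}
    (hφ : BotValued i φ) : nHoch i n (del i φ) = del i (nHoch i n φ) := by
  funext X a
  have h1 := braid1_mul_diff_mul him hip (X (Fin.last (n + 1))) (a (Fin.last n))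
    (hφ (Fin.init X) (Fin.init a))
  simp only [nHoch, rightDiff, del, Mat.mul_add, Mat.mul_sum, Mat.mul_smul, mergeObj_last]
  refine congrArg₂ _ (congrArg₂ _ (Mat.mul_assoc _ _ _) rfl) (congrArg _ h1)

/-- The right part squares to zero and the mixed terms cancel. What is left is `β^1` of the
composite of the last two morphisms against the product of the two values of `β^1`. -/
theorem nHoch_nHoch (him : (im : ℕ) + 1 = i) (hip : (i : ℕ) + 1 = ip) {n : ℕ} {φ : MFun k N n}
    (hφ : TopValued i φ) : nHoch i (n + 1) (nHoch i n φ) = -del i (postBraid2 i φ) := by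
  have hR := rightDiff_rightDiff (Mat.ract k) (fun x j m a b w => Mat.mul_incl_incl w x j m a b) n φ
  funext X a
  replace hR := congrFun (congrFun hR X) a
  have h2 := braid1_mul_braid1_mul him hip (X (Fin.last (n + 1)).castSucc) (X (Fin.last (n + 2)))
    (a (Fin.last (n + 1))) (a (Fin.last n).castSucc) (hφ (Fin.init (Fin.init X))
      (Fin.init (Fin.init a)))
  set M := Mat.mul (braid1 i (X (Fin.last n).castSucc.castSucc) (X (Fin.last (n + 2)))
    (comp k (X (Fin.last n).castSucc.castSucc) (X (Fin.last (n + 1)).castSucc)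
        (X (Fin.last (n + 2))) (a (Fin.last (n + 1))) (a (Fin.last n).castSucc)))
    (φ (Fin.init (Fin.init X)) (Fin.init (Fin.init a))) with hM
  let L : MFun k N (n + 1) := fun X a =>
    Mat.mul (braid1 i (X (Fin.last n).castSucc) (X (Fin.last (n + 1))) (a (Fin.last n)))
      (φ (Fin.init X) (Fin.init a))
  let B := braid1 i (X (Fin.last (n + 1)).castSucc) (X (Fin.last (n + 2))) (a (Fin.last (n + 1)))
  -- The left action commutes with every face except the one that merges the last two morphisms, and
  -- that face is `M`.
  have h3 : rightDiff (Mat.ract k) (n + 1) L X a =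
      Mat.mul B (rightDiff (Mat.ract k) n φ (Fin.init X) (Fin.init a)) + (-1 : k) ^ (n + 1) • M := by
    rw [rightDiff, rightDiff, Fin.sum_univ_castSucc, Mat.mul_add, Mat.mul_sum]
    refine Eq.trans ?_ (add_assoc _ _ _).symm
    refine congrArg₂ _ ?_ (congrArg₂ _ (Finset.sum_congr rfl fun t _ => ?_) (congrArg _ ?_))
    · exact Mat.mul_assoc _ _ _
    · rw [Mat.mul_smul]
      simp only [L, init_mergeObj_castSucc, init_mergeHom_castSucc, mergeObj_castSucc_last,
        mergeHom_castSucc_last, mergeObj_last]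
      rfl
    · simp only [L, init_mergeObj_last, init_mergeHom_last, mergeHom_last_last, mergeObj_last, hM]
      have := congrFun (init_mergeObj_last X) (Fin.last n)
      simp only [Fin.init] at this
      rw [this]
  have h4 : nHoch i n φ = rightDiff (Mat.ract k) n φ + (-1 : k) ^ (n + 1) • L := rfl
  have h5 : rightDiff (Mat.ract k) (n + 1) (nHoch i n φ) X a =
      rightDiff (Mat.ract k) (n + 1) (rightDiff (Mat.ract k) n φ) X a +
        (-1 : k) ^ (n + 1) • rightDiff (Mat.ract k) (n + 1) L X a := by
    rw [h4]
    simp only [rightDiff, Pi.add_apply, Pi.smul_apply, map_add, map_smul, smul_add,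
      Finset.sum_add_distrib, Finset.smul_sum, smul_comm ((-1 : k) ^ (n + 1))]
    abel
  have h6 : nHoch i (n + 1) (nHoch i n φ) X a = rightDiff (Mat.ract k) (n + 1) (nHoch i n φ) X a +
      (-1 : k) ^ (n + 2) • Mat.mul B (nHoch i n φ (Fin.init X) (Fin.init a)) := rfl
  have h7 : Mat.mul B (L (Fin.init X) (Fin.init a)) = M +
      del i (postBraid2 i φ) X a := h2
  have h8 : nHoch i n φ (Fin.init X) (Fin.init a) =
      rightDiff (Mat.ract k) n φ (Fin.init X) (Fin.init a) +
        (-1 : k) ^ (n + 1) • L (Fin.init X) (Fin.init a) := rfl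
  have h9 : (-1 : k) ^ (n + 1) * (-1 : k) ^ (n + 1) = 1 := by
    rw [← mul_pow]
    simp
  rw [h6, h5, hR, h3, h8, Mat.mul_add, Mat.mul_smul, h7, pow_succ (-1 : k) (n + 1)]
  simp only [smul_add, smul_smul, h9, mul_neg, mul_one, neg_mul, neg_smul, one_smul, Pi.zero_apply,
    Pi.neg_apply]
  abel

end Twisted

end
end KLRW

namespace KLRW
open Finsupp
noncomputable section

/-! ### The comparison of natural transformations with Hochschild cochains -/

section Comparison

universe u

variable {k : Type u} [Field k] {N : ℕ} {i im ip : Fin (N + 1)}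

theorem braid1_add (j l : Fin (N + 1)) (f g : H k) :
    braid1 i j l (f + g) = braid1 i j l f + braid1 i j l g := by
  funext m' m
  simp only [braid1, Pi.add_apply, Finsupp.mapDomain_add]
  split_ifs <;> simp

theorem braid1_smul (j l : Fin (N + 1)) (c : k) (f : H k) :
    braid1 i j l (c • f) = c • braid1 i j l f := by
  funext m' m
  simp only [braid1, Pi.smul_apply, Finsupp.mapDomain_smul]
  split_ifs <;> simp

theorem incl_add (j l : Fin (N + 1)) (f g : H k) :
    incl k j l (f + g) = incl k j l f + incl k j l g := by
  funext m' m
  simp only [incl, Pi.add_apply]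
  split_ifs <;> simp

theorem incl_smul (j l : Fin (N + 1)) (c : k) (f : H k) :
    incl k j l (c • f) = c • incl k j l f := by
  funext m' m
  simp only [incl, Pi.smul_apply]
  split_ifs <;> simp

theorem nHoch_isMultilin {n : ℕ} {φ : MFun k N n} (hφ : ∀ X, IsMultilin (φ X))
    (X : Fin (n + 2) → Fin (N + 1)) : IsMultilin (nHoch i n φ X) := by
  let R : H k →ₗ[k] Mat k N →ₗ[k] Mat k N :=
    LinearMap.mk₂ k (fun b f => Mat.mul f (incl k (X 0) (X 1) b))
      (fun _ _ _ => by rw [incl_add, Mat.mul_add]) (fun _ _ _ => by rw [incl_smul, Mat.mul_smul])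
      (fun _ _ _ => Mat.add_mul _ _ _) (fun _ _ _ => Mat.smul_mul _ _ _)
  let L : H k →ₗ[k] Mat k N →ₗ[k] Mat k N :=
    LinearMap.mk₂ k (fun b f =>
      Mat.mul (braid1 i (X (Fin.last n).castSucc) (X (Fin.last (n + 1))) b) f)
      (fun _ _ _ => by rw [braid1_add, Mat.add_mul])
      (fun _ _ _ => by rw [braid1_smul, Mat.smul_mul])
      (fun _ _ _ => Mat.mul_add _ _ _) (fun _ _ _ => Mat.mul_smul _ _ _)
  exact ((IsMultilin.tail R (hφ (Fin.tail X))).add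
    (IsMultilin.sum _ fun t => ((hφ (mergeObj t X)).merge t X).smul _)).add
    ((IsMultilin.init L (hφ (Fin.init X))).smul _)

/-- The Hochschild cochain of a function with values in the morphisms to `β`. -/
def toBim (hi : 0 < (i : ℕ)) (im ip : Fin (N + 1)) (n : ℕ) : MFun k N n →ₗ[k] HFun k N i n where
  toFun φ := fun X a => Bim.insert k hi (X 0) (X (Fin.last n))
    (proj k i im ip (X 0) (X (Fin.last n)) (φ X a))
  map_add' φ ψ := by
    funext X a
    simp only [Pi.add_apply, map_add]
  map_smul' c φ := by
    funext X a
    simp only [Pi.smul_apply, map_smul, RingHom.id_apply]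

theorem forget_toBim (hi : 0 < (i : ℕ)) (him : (im : ℕ) + 1 = i) (hip : (i : ℕ) + 1 = ip) {n : ℕ}
    (φ : MFun k N n) (X : Fin (n + 1) → Fin (N + 1)) (a : Fin n → H k) :
    Bim.forget k N i (toBim hi im ip n φ X a) = proj k i im ip (X 0) (X (Fin.last n)) (φ X a) :=
  Bim.forget_insert hi (proj_mem him hip _ _ _)

theorem toBim_apply_mem (hi : 0 < (i : ℕ)) {n : ℕ} (φ : MFun k N n)
    (X : Fin (n + 1) → Fin (N + 1)) (a : Fin n → H k) :
    toBim hi im ip n φ X a ∈ Bim.part k N i (X 0) (X (Fin.last n)) :=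
  Bim.insert_mem _ _ _ _

theorem toBim_mem (hi : 0 < (i : ℕ)) {n : ℕ} {φ : MFun k N n} (hφ : ∀ X, IsMultilin (φ X)) :
    toBim hi im ip n φ ∈ HCochain k N i n := fun X =>
  ⟨((hφ X).map (proj k i im ip (X 0) (X (Fin.last n)))).map
    (Bim.insert k hi (X 0) (X (Fin.last n))), toBim_apply_mem hi φ X⟩

theorem toBim_del (hi : 0 < (i : ℕ)) (him : (im : ℕ) + 1 = i) (hip : (i : ℕ) + 1 = ip) {n : ℕ}
    (φ : MFun k N n) : toBim hi im ip n (del i φ) = 0 := by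
  funext X a
  simp only [toBim, LinearMap.coe_mk, AddHom.coe_mk, del, proj_diff_mul him hip, map_zero]
  rfl

theorem hDiff_toBim (hi : 0 < (i : ℕ)) (him : (im : ℕ) + 1 = i) (hip : (i : ℕ) + 1 = ip) {n : ℕ}
    (φ : MFun k N n) :
    hDiff k N i n (toBim hi im ip n φ) = toBim hi im ip (n + 1) (nHoch i n φ) := by
  funext X a
  have hmem : hDiff k N i n (toBim hi im ip n φ) X a ∈
      Bim.part k N i (X 0) (X (Fin.last (n + 1))) := by
    refine add_mem (add_mem ?_ (sum_mem fun t _ => Submodule.smul_mem _ _ ?_))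
      (Submodule.smul_mem _ _ ?_)
    · exact Bim.ract_mem _ _ (toBim_apply_mem hi φ (Fin.tail X) (Fin.tail a))
    · have := toBim_apply_mem (im := im) (ip := ip) hi φ (mergeObj t X) (mergeHom t X a)
      rwa [mergeObj_zero, mergeObj_last] at this
    · exact Bim.lact_mem _ _ (toBim_apply_mem hi φ (Fin.init X) (Fin.init a))
  refine Bim.forget_inj hi hmem (toBim_apply_mem hi _ X a) ?_
  rw [forget_hDiff (toBim_apply_mem hi φ), forget_toBim hi him hip]
  simp only [forget_toBim hi him hip, nHoch, rightDiff, map_add, map_sum, map_smul,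
    proj_braid1_mul him hip, mergeObj_zero, mergeObj_last]
  refine congrArg₂ _ (congrArg₂ _ ?_ rfl) rfl
  exact (proj_mul_incl (X 0) (X 1) (X (Fin.last (n + 1))) (φ (Fin.tail X) (Fin.tail a)) (a 0)).symm

theorem exists_toBim (hi : 0 < (i : ℕ)) (him : (im : ℕ) + 1 = i) (hip : (i : ℕ) + 1 = ip) {n : ℕ}
    {z : HFun k N i n} (hz : z ∈ HCochain k N i n) :
    ∃ φ : MFun k N n, TopValued i φ ∧ (∀ X, IsMultilin (φ X)) ∧ toBim hi im ip n φ = z := by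
  refine ⟨fun X a => sect k i im ip (X 0) (X (Fin.last n)) (Bim.forget k N i (z X a)),
    fun X a => sect_isTop him hip _ _ _, fun X => ?_, ?_⟩
  · have h : IsMultilin (z X) := (hz X).1
    exact (h.map (Bim.forget k N i)).map (sect k i im ip (X 0) (X (Fin.last n)))
  · funext X a
    have h := HCochain.apply_mem hz X a
    simp only [toBim, LinearMap.coe_mk, AddHom.coe_mk]
    rw [proj_sect him hip (Bim.forget_mem h), Bim.insert_forget hi h]

theorem exists_del (hi : 0 < (i : ℕ)) (him : (im : ℕ) + 1 = i) (hip : (i : ℕ) + 1 = ip) {n : ℕ}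
    {φ : MFun k N n} (hφ : TopValued i φ) (hm : ∀ X, IsMultilin (φ X))
    (h0 : toBim hi im ip n φ = 0) :
    ∃ ψ : MFun k N n, BotValued i ψ ∧ (∀ X, IsMultilin (ψ X)) ∧ del i ψ = φ := by
  refine ⟨fun X a => lower k i im ip (X 0) (X (Fin.last n)) (φ X a),
    fun X a => lower_isBot _ _ _, fun X => ?_, ?_⟩
  · exact (hm X).map (lower k i im ip (X 0) (X (Fin.last n)))
  · funext X a
    refine diff_mul_lower him hip (hφ X a) ?_
    rw [← forget_toBim hi him hip, h0]
    exact map_zero _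

theorem del_injective (him : (im : ℕ) + 1 = i) (hip : (i : ℕ) + 1 = ip) {n : ℕ} {φ ψ : MFun k N n}
    (hφ : BotValued i φ) (hψ : BotValued i ψ) (h : del i φ = del i ψ) : φ = ψ := by
  funext X a
  rw [← lower_diff_mul him hip (hφ X a), ← lower_diff_mul him hip (hψ X a)]
  exact congrArg _ (congrFun (congrFun h X) a)

/-! #### The differential of natural transformations -/

theorem sgn_add (r s : ℤ) : sgn k (r + s) = sgn k r * sgn k s := by
  simp [sgn, Int.negOnePow_add]

theorem sgn_natCast (n : ℕ) : sgn k (n : ℤ) = (-1) ^ n := by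
  simp [sgn, Int.negOnePow_def]

theorem sgn_neg (r : ℤ) : sgn k (-r) = sgn k r := by
  simp [sgn, Int.negOnePow_neg]

theorem sgn_zero : sgn k 0 = 1 := by
  simp [sgn]

theorem sgn_neg_one : sgn k (-1) = -1 := by
  simp [sgn]

theorem sgn_natCast_sub_one (n : ℕ) : sgn k ((n : ℤ) - 1) = (-1) ^ (n + 1) := by
  rw [sub_eq_add_neg, sgn_add, sgn_natCast, sgn_neg_one, pow_succ]

theorem mu1_gen (j : Fin (N + 1)) (Q : Tw k N) (r : ℤ) (f : Mat k N) :
    Tw.mu1 (gen k j) Q r f = sgn k r • Mat.mul Q.diff f := by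
  simp only [Tw.mu1, gen, Mat.mul_zero, sub_zero]

theorem nDiff_zero (g : ℤ) (η : NFun k N) : nDiff k N i g η 0 = sgn k g • del i (η 0) := by
  funext X a
  simp only [nDiff, LinearMap.coe_mk, AddHom.coe_mk, mu1_gen, postTerm, postTerm2, preTerm,
    innerTerm, add_zero, sub_zero, Nat.cast_zero]
  rfl

/-- After a common factor `sgn k (g - 1)` is taken out, the remaining signs are those of the
Hochschild differential. -/
theorem nDiff_succ (g : ℤ) (η : NFun k N) (d : ℕ) : nDiff k N i g η (d + 1) =
    sgn k (g - (d + 1)) • del i (η (d + 1)) + sgn k (g - 1) • nHoch i d (η d) +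
      postTerm2 i g η (d + 1) := by
  funext X a
  have h1 : sgn k (g - d) = sgn k (g - 1) * (-1) ^ (d + 1) := by
    have : g - d = (g - 1) + (1 + -(d : ℤ)) := by ring
    rw [this, sgn_add, sgn_add, sgn_neg, sgn_natCast, ← sgn_neg 1, sgn_neg_one, pow_succ]
    ring
  have h2 : ∀ t : ℕ, sgn k (-(t : ℤ) + g - 1) = -(sgn k (g - 1) * (-1) ^ (t + 1)) := by
    intro t
    have : -(t : ℤ) + g - 1 = (g - 1) + -(t : ℤ) := by ring
    rw [this, sgn_add, sgn_neg, sgn_natCast, pow_succ]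
    ring
  simp only [nDiff, LinearMap.coe_mk, AddHom.coe_mk, mu1_gen, postTerm, preTerm, innerTerm,
    Tw.mu2, nHoch, rightDiff, Pi.add_apply, Pi.smul_apply, h1, h2, sgn_zero, one_smul, smul_add,
    Finset.smul_sum, smul_smul, neg_smul, Finset.sum_neg_distrib, sub_neg_eq_add, Nat.cast_add,
    Nat.cast_one, del]
  have h3 : Mat.ract k (X 0) (X 1) (a 0) (η d (Fin.tail X) (Fin.tail a)) =
      Mat.mul (η d (Fin.tail X) (Fin.tail a)) (incl k (X 0) (X 1) (a 0)) := rfl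
  rw [h3]
  abel

theorem postTerm2_add_two (g : ℤ) (η : NFun k N) (d : ℕ) :
    postTerm2 i g η (d + 2) = sgn k (g - d) • postBraid2 i (η d) := rfl

theorem NCochain.topValued {g : ℤ} {η : NFun k N} (hη : η ∈ NCochain k N i g) {d : ℕ}
    (h : g = d) : TopValued i (η d) := by
  intro X a
  have := (hη d X).2 a
  rwa [h, sub_self, mem_hom_zero] at this

theorem NCochain.botValued {g : ℤ} {η : NFun k N} (hη : η ∈ NCochain k N i g) {d : ℕ}
    (h : g + 1 = d) : BotValued i (η d) := by
  intro X a
  have := (hη d X).2 a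
  rwa [← h, sub_add_cancel_left, mem_hom_neg_one] at this

/-- Morphisms from `T_j` to `β T_l` exist only in degrees `0` and `-1`, so all components other than
`g` and `g + 1` vanish. -/
theorem NCochain.eq_zero {g : ℤ} {η : NFun k N} (hη : η ∈ NCochain k N i g) {d : ℕ}
    (h : g ≠ d) (h' : g + 1 ≠ d) : η d = 0 := by
  funext X a
  exact eq_zero_of_mem_hom (by omega) (by omega) ((hη d X).2 a)

theorem del_zero {n : ℕ} : del i (0 : MFun k N n) = 0 := by
  funext X a
  exact Mat.mul_zero _

theorem nHoch_zero {n : ℕ} : nHoch i n (0 : MFun k N n) = 0 := by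
  have := nHoch_smul (i := i) (0 : k) (0 : MFun k N n)
  rwa [zero_smul, zero_smul] at this

theorem postBraid2_zero {n : ℕ} : postBraid2 i (0 : MFun k N n) = 0 := by
  funext X a
  exact Mat.mul_zero _

theorem nDiff_top {n : ℕ} {η : NFun k N} (hη : η ∈ NCochain k N i n) :
    nDiff k N i n η (n + 1) =
      -del i (η (n + 1)) + (-1 : k) ^ (n + 1) • nHoch i n (η n) := by
  have h : postTerm2 i (n : ℤ) η (n + 1) = 0 := by
    cases n with
    | zero => rfl
    | succ n =>
      rw [postTerm2_add_two, NCochain.eq_zero hη (by omega) (by omega), postBraid2_zero, smul_zero]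
  rw [nDiff_succ, h, add_zero, sub_add_cancel_left, sgn_neg_one, neg_one_smul, sgn_natCast_sub_one]

theorem nDiff_bot {n : ℕ} {η : NFun k N} (hη : η ∈ NCochain k N i n) :
    nDiff k N i n η (n + 2) =
      postBraid2 i (η n) + (-1 : k) ^ (n + 1) • nHoch i (n + 1) (η (n + 1)) := by
  rw [nDiff_succ, postTerm2_add_two, NCochain.eq_zero hη (d := n + 1 + 1) (by omega) (by omega),
    del_zero, smul_zero, zero_add, sub_self, sgn_zero, one_smul, sgn_natCast_sub_one]
  exact add_comm _ _

theorem nDiff_eq_zero {g : ℤ} {η : NFun k N} (hη : η ∈ NCochain k N i g) {d : ℕ}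
    (h1 : g + 1 ≠ d) (h2 : g + 2 ≠ d) : nDiff k N i g η d = 0 := by
  have hdel : del i (η d) = 0 := by
    by_cases h : g = d
    · exact (NCochain.topValued hη h).del
    · rw [NCochain.eq_zero hη h h1, del_zero]
  cases d with
  | zero => rw [nDiff_zero, hdel, smul_zero]
  | succ d =>
    have hd : η d = 0 := NCochain.eq_zero hη (by omega) (by omega)
    rw [nDiff_succ, hdel, hd, nHoch_zero, smul_zero, smul_zero, zero_add, zero_add]
    cases d with
    | zero => rfl
    | succ d =>
      rw [postTerm2_add_two]
      by_cases h : g + 1 = d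
      · rw [(NCochain.botValued hη h).postBraid2, smul_zero]
      · rw [NCochain.eq_zero hη (d := d) (by omega) h, postBraid2_zero, smul_zero]

/-- The vanishing of the squared differential, in components: applying `del` to the lower part
produces the `β^2` term that `nHoch_nHoch` cancels. -/
theorem del_nDiff_bot (him : (im : ℕ) + 1 = i) (hip : (i : ℕ) + 1 = ip) {n : ℕ} {η : NFun k N}
    (hη : η ∈ NCochain k N i n) :
    del i (nDiff k N i n η (n + 2)) = (-1 : k) ^ n • nHoch i (n + 1) (nDiff k N i n η (n + 1)) := by
  have hx := NCochain.topValued hη rfl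
  have hy : BotValued i (η (n + 1)) := NCochain.botValued hη (by push_cast; rfl)
  have h9 : (-1 : k) ^ n * (-1 : k) ^ n = 1 := by
    rw [← mul_pow]
    simp
  rw [nDiff_bot hη, nDiff_top hη, del_add, del_smul, nHoch_add, ← neg_one_smul k (del i _),
    nHoch_smul, nHoch_smul, nHoch_del him hip hy, nHoch_nHoch him hip hx]
  simp only [smul_add, smul_smul, pow_succ, mul_neg, mul_one, neg_smul, h9, smul_neg, one_smul,
    neg_neg]
  abel

theorem nDiff_bot_botValued {n : ℕ} {η : NFun k N} (hη : η ∈ NCochain k N i n) :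
    BotValued i (nDiff k N i n η (n + 2)) := by
  have hx := NCochain.topValued hη rfl
  have hy : BotValued i (η (n + 1)) := NCochain.botValued hη (by push_cast; rfl)
  rw [nDiff_bot hη]
  exact fun X a => (hx.postBraid2 X a).add ((hy.nHoch X a).smul _)

/-- The equation with values in degree `-1` is automatic: by `del_nDiff_bot` it holds after applying
`del`, which is injective there. -/
theorem mem_NCocycle_iff (him : (im : ℕ) + 1 = i) (hip : (i : ℕ) + 1 = ip) {n : ℕ} {η : NFun k N}
    (hη : η ∈ NCochain k N i n) :
    η ∈ NCocycle k N i n ↔ del i (η (n + 1)) = (-1 : k) ^ (n + 1) • nHoch i n (η n) := by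
  have h1 : nDiff k N i n η (n + 1) = 0 ↔
      del i (η (n + 1)) = (-1 : k) ^ (n + 1) • nHoch i n (η n) := by
    rw [nDiff_top hη, neg_add_eq_zero]
  rw [← h1]
  constructor
  · intro h
    exact congrFun (LinearMap.mem_ker.1 h.2) (n + 1)
  · intro h
    refine ⟨hη, LinearMap.mem_ker.2 (funext fun d => ?_)⟩
    by_cases e1 : d = n + 1
    · subst e1
      exact h
    · by_cases e2 : d = n + 2
      · subst e2
        refine del_injective him hip (nDiff_bot_botValued hη) (ψ := 0) (fun X a _ _ h => absurd rfl h) ?_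
        rw [del_nDiff_bot him hip hη, h, nHoch_zero, smul_zero, del_zero]
      · exact nDiff_eq_zero hη (by omega) (by omega)

/-- The pre-natural transformation with two given components. -/
def ofComponents (n : ℕ) (x : MFun k N n) (y : MFun k N (n + 1)) : NFun k N :=
  Function.update (Function.update 0 n x) (n + 1) y

theorem ofComponents_top (n : ℕ) (x : MFun k N n) (y : MFun k N (n + 1)) :
    ofComponents n x y n = x := by
  rw [ofComponents, Function.update_of_ne (by omega), Function.update_self]

theorem ofComponents_bot (n : ℕ) (x : MFun k N n) (y : MFun k N (n + 1)) :
    ofComponents n x y (n + 1) = y := by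
  rw [ofComponents, Function.update_self]

theorem ofComponents_mem {n : ℕ} {x : MFun k N n} {y : MFun k N (n + 1)} (hx : TopValued i x)
    (hx' : ∀ X, IsMultilin (x X)) (hy : BotValued i y) (hy' : ∀ X, IsMultilin (y X)) :
    ofComponents n x y ∈ NCochain k N i n := by
  intro d X
  by_cases e1 : d = n + 1
  · subst e1
    rw [ofComponents_bot]
    refine ⟨hy' X, fun a => ?_⟩
    have := mem_hom_neg_one.2 (hy X a)
    rwa [Nat.cast_add, Nat.cast_one, sub_add_cancel_left]
  · by_cases e2 : d = n
    · subst e2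
      rw [ofComponents_top]
      refine ⟨hx' X, fun a => ?_⟩
      rw [sub_self]
      exact mem_hom_zero.2 (hx X a)
    · have : ofComponents n x y d = 0 := by
        rw [ofComponents, Function.update_of_ne e1, Function.update_of_ne e2]
        rfl
      rw [this]
      exact ⟨⟨0, fun _ => rfl⟩, fun _ => zero_mem _⟩

end Comparison

end
end KLRW

namespace KLRW
open Finsupp
noncomputable section

/-! ### The isomorphism of natural transformations with Hochschild cohomology -/

section Isomorphism

universe u

variable {k : Type u} [Field k] {N : ℕ} {i im ip : Fin (N + 1)}

theorem toBim_mem_HCocycle (hi : 0 < (i : ℕ)) (him : (im : ℕ) + 1 = i) (hip : (i : ℕ) + 1 = ip)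
    {n : ℕ} {η : NFun k N} (hη : η ∈ NCocycle k N i n) :
    toBim hi im ip n (η n) ∈ HCocycle k N i n := by
  refine ⟨toBim_mem hi fun X => (hη.1 n X).1, LinearMap.mem_ker.2 ?_⟩
  have h := congrArg (toBim hi im ip (n + 1)) ((mem_NCocycle_iff him hip hη.1).1 hη)
  rw [toBim_del hi him hip, map_smul] at h
  rw [hDiff_toBim hi him hip]
  exact (smul_eq_zero.1 h.symm).resolve_left (pow_ne_zero _ (neg_ne_zero.2 one_ne_zero))

/-- A pointwise lift of `z` has a differential that projects to zero. That differential is therefore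
in the image of `del`, and a preimage serves as the second component. -/
theorem exists_NCocycle (hi : 0 < (i : ℕ)) (him : (im : ℕ) + 1 = i) (hip : (i : ℕ) + 1 = ip)
    {n : ℕ} {z : HFun k N i n} (hz : z ∈ HCocycle k N i n) :
    ∃ η ∈ NCocycle k N i n, toBim hi im ip n (η n) = z := by
  obtain ⟨x, hx, hx', rfl⟩ := exists_toBim hi him hip hz.1
  have h0 : toBim hi im ip (n + 1) ((-1 : k) ^ (n + 1) • nHoch i n x) = 0 := by
    have h := LinearMap.mem_ker.1 hz.2
    rw [hDiff_toBim hi him hip] at h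
    rw [map_smul, h, smul_zero]
  obtain ⟨y, hy, hy', hxy⟩ := exists_del hi him hip
    (φ := (-1 : k) ^ (n + 1) • nHoch i n x) (fun X a => (hx.nHoch X a).smul _) (fun X => (nHoch_isMultilin hx' X).smul _) h0
  refine ⟨ofComponents n x y, ?_, by rw [ofComponents_top]⟩
  rw [mem_NCocycle_iff him hip (ofComponents_mem hx hx' hy hy'), ofComponents_top,
    ofComponents_bot, hxy]

theorem toBim_mem_HCobound (hi : 0 < (i : ℕ)) (him : (im : ℕ) + 1 = i) (hip : (i : ℕ) + 1 = ip)
    {n : ℕ} {η : NFun k N} (hη : η ∈ NCobound k N i n) :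
    toBim hi im ip n (η n) ∈ HCobound k N i n := by
  obtain ⟨η, hη, rfl⟩ := hη
  cases n with
  | zero =>
    rw [nDiff_zero, map_smul, toBim_del hi him hip, smul_zero]
    exact zero_mem _
  | succ n =>
    have e : ((n + 1 : ℕ) : ℤ) - 1 = n := by
      push_cast
      ring
    rw [e] at hη ⊢
    rw [nDiff_top hη, map_add, map_neg, toBim_del hi him hip, neg_zero, zero_add, map_smul,
      ← hDiff_toBim hi him hip]
    exact Submodule.smul_mem _ _ ⟨_, toBim_mem hi fun X => (hη n X).1, rfl⟩

/-- A cocycle is determined by its component with values in degree `0`. This reduces the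
identification of coboundaries below to one component. -/
theorem botValued_unique (him : (im : ℕ) + 1 = i) (hip : (i : ℕ) + 1 = ip) {n : ℕ}
    {η η' : NFun k N} (hη : η ∈ NCocycle k N i n) (h : η' n = η n)
    (hb : BotValued i (η' (n + 1)))
    (hd : del i (η' (n + 1)) = (-1 : k) ^ (n + 1) • nHoch i n (η' n))
    (h0 : ∀ d, d ≠ n → d ≠ n + 1 → η' d = 0) : η' = η := by
  funext d
  by_cases e1 : d = n
  · subst e1
    exact h
  · by_cases e2 : d = n + 1
    · subst e2
      refine del_injective him hip hb (NCochain.botValued hη.1 (by push_cast; rfl)) ?_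
      rw [hd, h, (mem_NCocycle_iff him hip hη.1).1 hη]
    · rw [h0 d e1 e2, NCochain.eq_zero hη.1 (by omega) (by omega)]

/-- Here the primitive has degree `-1`, hence a single component with values in the part of degree
`-1`, and no Hochschild cochain lies behind it. -/
theorem mem_NCobound_zero (hi : 0 < (i : ℕ)) (him : (im : ℕ) + 1 = i) (hip : (i : ℕ) + 1 = ip)
    {η : NFun k N} (hη : η ∈ NCocycle k N i (0 : ℕ)) (h : toBim hi im ip 0 (η 0) = 0) :
    η ∈ NCobound k N i (0 : ℕ) := by
  obtain ⟨y, hy, hy', hxy⟩ := exists_del hi him hip (NCochain.topValued hη.1 rfl)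
    (fun X => (hη.1 0 X).1) h
  have hy1 : BotValued i (-y) := by
    rw [← neg_one_smul k y]
    exact fun X a => (hy X a).smul _
  have hy1' : ∀ X, IsMultilin ((-y) X) := by
    rw [← neg_one_smul k y]
    exact fun X => (hy' X).smul _
  -- The minus sign compensates the sign of `del` in the differential on degree `-1`.
  let ζ : NFun k N := Function.update 0 0 (-y)
  have z0 : ζ 0 = -y := Function.update_self _ _ _
  have z1 : ∀ d, d ≠ 0 → ζ d = 0 := fun d hd => Function.update_of_ne hd _ _
  have hζ : ζ ∈ NCochain k N i (((0 : ℕ) : ℤ) - 1) := by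
    intro d X
    by_cases e : d = 0
    · subst e
      rw [z0]
      exact ⟨hy1' X, fun a => mem_hom_neg_one.2 (hy1 X a)⟩
    · rw [z1 d e]
      exact ⟨⟨0, fun _ => rfl⟩, fun _ => zero_mem _⟩
  have e1 : nDiff k N i (((0 : ℕ) : ℤ) - 1) ζ 0 = η 0 := by
    have hs : sgn k (((0 : ℕ) : ℤ) - 1) = -1 := sgn_neg_one
    rw [nDiff_zero, hs, z0, ← neg_one_smul k y, del_smul, smul_smul, hxy]
    simp
  have e2 : nDiff k N i (((0 : ℕ) : ℤ) - 1) ζ 1 = nHoch i 0 (-y) := by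
    have hs : sgn k (((0 : ℕ) : ℤ) - 1 - 1) = 1 := by
      have : ((0 : ℕ) : ℤ) - 1 - 1 = -((2 : ℕ) : ℤ) := rfl
      rw [this, sgn_neg, sgn_natCast]
      simp
    have h1 := nDiff_succ (i := i) (((0 : ℕ) : ℤ) - 1) ζ 0
    have h2 : postTerm2 i (((0 : ℕ) : ℤ) - 1) ζ (0 + 1) = 0 := rfl
    rw [z1 (0 + 1) one_ne_zero, del_zero, smul_zero, hs, one_smul, z0, h2] at h1
    exact h1.trans ((add_zero _).trans (zero_add _))
  refine ⟨ζ, hζ, botValued_unique him hip hη e1 ?_ ?_ ?_⟩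
  · rw [e2]
    exact hy1.nHoch
  · rw [e1, e2, ← nHoch_del him hip hy1, ← hxy, ← neg_one_smul k y, del_smul, nHoch_smul]
    simp
  · intro d h1 h2
    exact nDiff_eq_zero hζ (by omega) (by omega)

/-- A Hochschild primitive is lifted to the first component. The remaining difference from `η`
projects to zero and is absorbed by the second component `y` through `del`. -/
theorem mem_NCobound_succ (hi : 0 < (i : ℕ)) (him : (im : ℕ) + 1 = i) (hip : (i : ℕ) + 1 = ip)
    {n : ℕ} {η : NFun k N} (hη : η ∈ NCocycle k N i (n + 1 : ℕ))
    (h : toBim hi im ip (n + 1) (η (n + 1)) ∈ HCobound k N i (n + 1)) :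
    η ∈ NCobound k N i (n + 1 : ℕ) := by
  obtain ⟨w, hw, hw'⟩ := h
  obtain ⟨x, hx, hx', rfl⟩ := exists_toBim hi him hip hw
  have hxη : TopValued i (η (n + 1)) := NCochain.topValued hη.1 rfl
  have hmη : ∀ X, IsMultilin (η (n + 1) X) := fun X => (hη.1 (n + 1) X).1
  have h0 : toBim hi im ip (n + 1) (nHoch i n x + (-1 : k) • η (n + 1)) = 0 := by
    rw [map_add, map_smul, ← hDiff_toBim hi him hip, hw', neg_one_smul, add_neg_cancel]
  obtain ⟨y, hy, hy', hxy⟩ := exists_del hi him hip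
    (φ := nHoch i n x + (-1 : k) • η (n + 1)) (fun X a => (hx.nHoch X a).add ((hxη X a).smul _))
    (fun X => (nHoch_isMultilin hx' X).add ((hmη X).smul _)) h0
  have hx1 : TopValued i ((-1 : k) ^ (n + 1) • x) := fun X a => (hx X a).smul _
  have hζ := ofComponents_mem hx1 (fun X => (hx' X).smul _) hy hy'
  set ζ := ofComponents n ((-1 : k) ^ (n + 1) • x) y with hζ_def
  have e : ((n + 1 : ℕ) : ℤ) - 1 = n := by
    push_cast
    ring
  have e1 : nDiff k N i n ζ (n + 1) = η (n + 1) := by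
    have h9 : (-1 : k) ^ (n + 1) * (-1 : k) ^ (n + 1) = 1 := by
      rw [← mul_pow]
      simp
    rw [nDiff_top hζ, hζ_def, ofComponents_top, ofComponents_bot, hxy, nHoch_smul, smul_smul, h9,
      one_smul, neg_one_smul]
    abel
  refine ⟨ζ, by rwa [e], ?_⟩
  rw [e]
  refine botValued_unique him hip hη e1 (nDiff_bot_botValued hζ) ?_ ?_
  · rw [del_nDiff_bot him hip hζ]
    simp [pow_succ]
  · intro d h1 h2
    exact nDiff_eq_zero hζ (by omega) (by omega)

/-- Natural transformations from the identity to `β` compute Hochschild cohomology. -/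
theorem HNat.equiv (hi : 0 < (i : ℕ)) (hi' : (i : ℕ) < N) (n : ℕ) :
    Nonempty (HNat k N i (n : ℤ) ≃ₗ[k] HH k N i n) := by
  let im : Fin (N + 1) := ⟨(i : ℕ) - 1, by omega⟩
  let ip : Fin (N + 1) := ⟨(i : ℕ) + 1, by omega⟩
  have him : (im : ℕ) + 1 = i := Nat.sub_add_cancel hi
  have hip : (i : ℕ) + 1 = ip := rfl
  let F : NCocycle k N i n →ₗ[k] HCocycle k N i n :=
    LinearMap.codRestrict (HCocycle k N i n)
      ((toBim hi im ip n ∘ₗ LinearMap.proj n) ∘ₗ (NCocycle k N i n).subtype)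
      (fun η => toBim_mem_HCocycle hi him hip η.2)
  let G : NCocycle k N i n →ₗ[k] HH k N i n := Submodule.mkQ _ ∘ₗ F
  have hG : Function.Surjective G := by
    refine (Submodule.mkQ_surjective _).comp fun z => ?_
    obtain ⟨η, hη, h⟩ := exists_NCocycle hi him hip z.2
    exact ⟨⟨η, hη⟩, Subtype.ext h⟩
  have hk : (NCobound k N i n).comap (NCocycle k N i n).subtype = LinearMap.ker G := by
    ext η
    rw [LinearMap.mem_ker]
    have h : G η = 0 ↔ toBim hi im ip n (η.1 n) ∈ HCobound k N i n :=
      Submodule.Quotient.mk_eq_zero _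
    rw [h]
    refine ⟨toBim_mem_HCobound hi him hip, fun h => ?_⟩
    cases n with
    | zero => exact mem_NCobound_zero hi him hip η.2 h
    | succ n => exact mem_NCobound_succ hi him hip η.2 h
  exact ⟨(Submodule.quotEquivOfEq _ _ hk).trans (G.quotKerEquivOfSurjective hG)⟩

end Isomorphism

end
end KLRW

theorem mainTheorem2 (k : Type*) [Field k] (N : ℕ) (i : Fin (N + 1))
    (hi : 0 < (i : ℕ)) (hi' : (i : ℕ) < N) :
    (∀ n : ℕ, Nonempty (KLRW.HNat k N i (n : ℤ) ≃ₗ[k] KLRW.HH k N i n)) ∧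
    Nonempty (KLRW.HH k N i 0 ≃ₗ[k] ({l : ℕ // 1 ≤ l} →₀ k)) ∧
    Nonempty (KLRW.HH k N i 1 ≃ₗ[k] (ℕ →₀ k)) ∧
    Nonempty (KLRW.HH k N i 2 ≃ₗ[k] (Fin (N - 2) → k)) ∧
    ∀ n : ℕ, 3 ≤ n → Subsingleton (KLRW.HH k N i n) := by
  refine ⟨fun n => KLRW.HNat.equiv hi hi' n, KLRW.HH.zero hi, KLRW.HH.one hi hi',
    KLRW.HH.two hi hi', fun n hn => KLRW.HH.subsingleton hi (by omega) n hn⟩
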